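/- Let $F(x,n)=(2x-x^2)n-n^2$ and $T>0$. An *entropy solution* on $[0,T]\times[0,\infty)$ of $$\partial_t n+\partial_x F(x,n)=0\quad (0<t<T,\ x>0),\qquad F(x,n)\to 0\ \text{ as } x\to\infty,$$ is a function $n\in L^1([0,T]\times[0,\infty))\cap L^1([0,T];L^2([0,\infty)))$ such that 1. for every $\phi\in C_c^\infty((0,T)\times(0,\infty))$, $$\int_0^T\!\!\int_0^\infty \big(n\,\partial_t\phi+F(x,n)\,\partial_x\phi\big)\,dx\,dt=0;$$ 2. for every $k\in\mathbb R$ and every non-negative $\phi\in C_c^\infty((0,T)\times(0,\infty))$, $$\int_0^T\!\!\int_0^\infty\Big(|n-k|\,\partial_t\phi+\operatorname{sgn}(n-k)\,[F(x,n)-F(x,k)]\,\partial_x\phi-\operatorname{sgn}(n-k)\,F_x(x,k)\,\phi\Big)\,dx\,dt\ \ge 0$$ (the integrands in 1 and 2 being integrable); 3. $\displaystyle\lim_{R\to\infty}\int_0^T|F(R,n(t,R))|\,dt=0$. It has initial data $n_0\in L^1(0,\infty)$ if $\int_0^r|n(t,x)-n_0(x)|\,dx\to0$ as $t\downarrow0$,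 for every $r>0$. As $n$ is determined only up to null sets, limits of $n(t,\cdot)$ in $t$ and of $n(\cdot,x)$ or $F(x,n(\cdot,x))$ in $x$ are essential limits (limits outside a null set), and the values $n(T,\cdot)$, $n(\cdot,0)$ and $n(\cdot,R)$ denote strong traces: the limit of $n(t,\cdot)$ in $L^1(0,r)$ for every $r>0$ as $t\uparrow T$, and the limits of $n(\cdot,x)$ in $L^1(0,T)$ as $x\downarrow0$ and as $x\to R$, respectively. **Lemma ($L^1$ contraction).** Let $n$ and $n'$ be two non-negative bounded entropy solutions on $[0,T]\times[0,\infty)$ with initial data $n_0,n_0'\in L^1(0,\infty)$. Then the traces $n(T,\cdot)$, $n(\cdot,0)$, and $n(\cdot,R)$ for every $R>2$, and likewise those of $n'$, exist and are bounded, and for every $R>2$ $$\int_0^R|n(T,x)-n'(T,x)|\,dx+\int_0^T|n(t,0)^2-n'(t,0)^2|\,dt\ \le\ \int_0^R|n_0(x)-n_0'(x)|\,dx+\int_0^T|F(R,n(t,R))-F(R,n'(t,R))|\,dt .$$ -/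

import Mathlib

open MeasureTheory Filter Topology Set
open scoped ContDiff

namespace Kompaneets

/-- The flux `F(x, n) = (2x - x²) n - n²`. -/
def flux (x n : ℝ) : ℝ := (2 * x - x ^ 2) * n - n ^ 2

/-- The open space-time domain `(0, T) × (0, ∞)`; points are pairs `(t, x)`. -/
def domain (T : ℝ) : Set (ℝ × ℝ) := Ioo 0 T ×ˢ Ioi 0

/-- Test functions `φ ∈ C_c^∞((0, T) × (0, ∞))`. -/
structure IsTest (T : ℝ) (φ : ℝ × ℝ → ℝ) : Prop where
  smooth : ContDiff ℝ ∞ φ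
  compact : HasCompactSupport φ
  support_subset : tsupport φ ⊆ domain T

/-- The partial derivative `∂_t φ`. -/
noncomputable def dt (φ : ℝ × ℝ → ℝ) (p : ℝ × ℝ) : ℝ := fderiv ℝ φ p (1, 0)

/-- The partial derivative `∂_x φ`. -/
noncomputable def dx (φ : ℝ × ℝ → ℝ) (p : ℝ × ℝ) : ℝ := fderiv ℝ φ p (0, 1)

/-- The integrand `n ∂_t φ + F(x, n) ∂_x φ` of the weak formulation. -/
noncomputable def weakIntegrand (n : ℝ → ℝ → ℝ) (φ : ℝ × ℝ → ℝ) (p : ℝ × ℝ) : ℝ :=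
  n p.1 p.2 * dt φ p + flux p.2 (n p.1 p.2) * dx φ p

/-- The integrand
`|n - k| ∂_t φ + sgn(n - k) (F(x, n) - F(x, k)) ∂_x φ - sgn(n - k) F_x(x, k) φ`
of the Kruzkov entropy inequality. -/
noncomputable def entropyIntegrand (n : ℝ → ℝ → ℝ) (k : ℝ) (φ : ℝ × ℝ → ℝ) (p : ℝ × ℝ) : ℝ :=
  |n p.1 p.2 - k| * dt φ p
    + Real.sign (n p.1 p.2 - k) * (flux p.2 (n p.1 p.2) - flux p.2 k) * dx φ p
    - Real.sign (n p.1 p.2 - k) * deriv (fun y => flux y k) p.2 * φ p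

/-- Entropy solutions of `∂_t n + ∂_x F(x, n) = 0` on `(0, T) × (0, ∞)` with `F(x, n) → 0` as
`x → ∞`. Functions are considered up to null sets; accordingly the limit `R → ∞` in the boundary
condition is an essential limit (the filter `atTop ⊓ ae volume`). -/
structure IsEntropySolution (T : ℝ) (n : ℝ → ℝ → ℝ) : Prop where
  /-- `n ∈ L¹([0, T] × [0, ∞))` -/
  integrable : IntegrableOn (fun p : ℝ × ℝ => n p.1 p.2) (domain T)
  /-- `n ∈ L¹([0, T]; L²([0, ∞)))` -/
  l1l2 : ∫⁻ t in Ioo 0 T, eLpNorm (n t) 2 (volume.restrict (Ioi 0)) < ⊤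
  /-- the weak formulation -/
  weak : ∀ φ, IsTest T φ →
    IntegrableOn (weakIntegrand n φ) (domain T) ∧ ∫ p in domain T, weakIntegrand n φ p = 0
  /-- the Kruzkov entropy inequalities -/
  entropy : ∀ (k : ℝ) (φ : ℝ × ℝ → ℝ), IsTest T φ → (∀ p, 0 ≤ φ p) →
    IntegrableOn (entropyIntegrand n k φ) (domain T) ∧
      0 ≤ ∫ p in domain T, entropyIntegrand n k φ p
  /-- vanishing of the flux at infinity, in the `L¹` sense -/
  flux_infty : Tendsto (fun R : ℝ => ∫⁻ t in Ioo 0 T, ‖flux R (n t R)‖ₑ)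
    (atTop ⊓ ae volume) (𝓝 0)

/-- `n(t, ·) → u` in `L¹(0, r)` for every `r > 0`, as `t` tends along `l` outside a null set. -/
def HasTimeTrace (n : ℝ → ℝ → ℝ) (l : Filter ℝ) (u : ℝ → ℝ) : Prop :=
  ∀ r > 0, Tendsto (fun t : ℝ => ∫⁻ x in Ioo 0 r, ‖n t x - u x‖ₑ) (l ⊓ ae volume) (𝓝 0)

/-- `n(·, x) → γ` in `L¹(0, T)`, as `x` tends along `l` outside a null set. -/
def HasSpaceTrace (T : ℝ) (n : ℝ → ℝ → ℝ) (l : Filter ℝ) (γ : ℝ → ℝ) : Prop :=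
  Tendsto (fun x : ℝ => ∫⁻ t in Ioo 0 T, ‖n t x - γ t‖ₑ) (l ⊓ ae volume) (𝓝 0)

/-- A non-negative bounded entropy solution on `(0, T) × (0, ∞)` with initial data
`n₀ ∈ L¹(0, ∞)`, attained in the strong local `L¹` sense. -/
structure IsNonnegBoundedSolution (T : ℝ) (n : ℝ → ℝ → ℝ) (n₀ : ℝ → ℝ) : Prop where
  solution : IsEntropySolution T n
  nonneg : ∀ᵐ p ∂(volume.restrict (domain T)), 0 ≤ n p.1 p.2
  bounded : ∃ M : ℝ, ∀ᵐ p ∂(volume.restrict (domain T)), |n p.1 p.2| ≤ M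
  initial_integrable : IntegrableOn n₀ (Ioi 0)
  initial : HasTimeTrace n (𝓝[>] 0) n₀

/-- `u` is the (bounded, strong) trace `n(T, ·)` of `n` at the time `T`. -/
def IsFinalValue (T : ℝ) (n : ℝ → ℝ → ℝ) (u : ℝ → ℝ) : Prop :=
  MemLp u ⊤ (volume.restrict (Ioi 0)) ∧ HasTimeTrace n (𝓝[<] T) u

/-- `γ` is the (bounded, strong) trace `n(·, 0)` of `n` on `(0, T)` at the boundary `x = 0`. -/
def IsValueAtZero (T : ℝ) (n : ℝ → ℝ → ℝ) (γ : ℝ → ℝ) : Prop :=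
  MemLp γ ⊤ (volume.restrict (Ioo 0 T)) ∧ HasSpaceTrace T n (𝓝[>] 0) γ

/-- `γ` is the (bounded, strong, two-sided) trace `n(·, R)` of `n` on `(0, T)` at the interior
point `x = R`. -/
def IsValueAt (T : ℝ) (n : ℝ → ℝ → ℝ) (R : ℝ) (γ : ℝ → ℝ) : Prop :=
  MemLp γ ⊤ (volume.restrict (Ioo 0 T)) ∧ HasSpaceTrace T n (𝓝 R) γ

end Kompaneets

/-!
The contraction inequality is Kato's inequality for the entropy flux, integrated over a rectangle
whose sides are moved to the boundary of `(0, T) × (0, R)`; the real content is the existence of the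
strong traces through which this limit is taken.

**Kato's inequality.** Two entropy solutions satisfy
`∂ₜ |u - u'| + ∂ₓ (sgn(u - u') (F(x, u) - F(x, u'))) ≤ 0`, by doubling of variables (`kato`). Tested
with mollified indicators, it holds in integrated form on almost every rectangle (`rectangle_le`).
At `x = 0` the entropy flux is `-|a² - a'²|`, and at `x = R > 2`, where `F(R, ·)` decreases on
`[0, ∞)`, it is `-|F(R, b) - F(R, b')|`; these are the two boundary terms of the theorem.

**Traces.** The equation provides a Lipschitz potential `U` with `∂ₓ U = u` and `∂ₜ U = -F(x, u)`
(`IsRep.exists_potential`), which solves the Hamilton-Jacobi equation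
`∂ₜ U + (2x - x²) ∂ₓ U - (∂ₓ U)² = 0`. The entropy inequalities make `U` a viscosity subsolution
(`IsPotential.add_flux_nonpos`). Since the equation holds almost everywhere and `-p²` is concave,
mollifications of `U` are supersolutions up to a small error; this survives the extension of `U` to
negative `x` by its boundary values, because `U(·, 0)` increases. The average of two translates
`Y(t, x ± σ (t - t₀))` of such a supersolution `Y` is, up to an error `C σ² (t - t₀)`, again a
supersolution, so comparison gives
`U(t, x) ≤ (U(t, x + ξ) + U(t, x - ξ)) / 2 + C ξ²` with `ξ = σ (t - t₀)`
(`IsPotential.le_average_of_supersolution`, `IsPotential.exists_midpoint_le`). Hence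
`U(t, ·) + C x²` is convex with `C` uniform for `t` away from `0`; this is Oleinik's one-sided bound
on `∂ₓ u`, valid up to `x = 0` and up to `t = T`.

A semiconvex function has one-sided derivatives everywhere, with one-sided limits, and the
derivatives of convergent uniformly semiconvex functions converge almost everywhere
(`tendsto_rightDeriv_of_semiconvex`). As `u` coincides with the right derivative of `U` almost
everywhere, dominated convergence turns this into strong traces at `t = T` and from either side of
every `x` (`exists_tendsto_lintegral_sub`). At `R > 2` the two one-sided traces have the same flux,
and `F(R, ·)` is injective on `[0, ∞)`, so they agree (`IsRep.spaceTrace_unique`).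
-/

namespace Kompaneets

/-! ### Mollification on the plane -/

/-- A smooth bump function on the plane, centred at the origin, of outer radius `1 / (j + 1)`. -/
noncomputable def stdBump (j : ℕ) : ContDiffBump (0 : ℝ × ℝ) where
  rIn := 1 / (2 * ((j : ℝ) + 1))
  rOut := 1 / ((j : ℝ) + 1)
  rIn_pos := by positivity
  rIn_lt_rOut := by
    apply one_div_lt_one_div_of_lt <;> nlinarith [(Nat.cast_nonneg j : (0 : ℝ) ≤ j)]

/-- The smooth kernel of integral one supported in the ball of radius `1 / (j + 1)`. -/
noncomputable def kernel (j : ℕ) : ℝ × ℝ → ℝ := (stdBump j).normed volume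

/-- The radius of the support of `kernel j`. -/
noncomputable def radius (j : ℕ) : ℝ := 1 / ((j : ℝ) + 1)

/-- The mollification of `f` by `kernel j`. -/
noncomputable def mol (j : ℕ) (f : ℝ × ℝ → ℝ) : ℝ × ℝ → ℝ :=
  convolution (kernel j) f (ContinuousLinearMap.lsmul ℝ ℝ) volume

theorem mol_apply (j : ℕ) (f : ℝ × ℝ → ℝ) (z : ℝ × ℝ) :
    mol j f z = ∫ w, kernel j w * f (z - w) := rfl

theorem radius_pos (j : ℕ) : 0 < radius j := by unfold radius; positivity

theorem radius_le_one (j : ℕ) : radius j ≤ 1 := by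
  unfold radius
  rw [div_le_one (by positivity)]
  linarith [(Nat.cast_nonneg j : (0 : ℝ) ≤ j)]

theorem tendsto_radius : Tendsto radius atTop (𝓝 0) :=
  tendsto_one_div_add_atTop_nhds_zero_nat

theorem kernel_nonneg (j : ℕ) (w : ℝ × ℝ) : 0 ≤ kernel j w := (stdBump j).nonneg_normed w

theorem kernel_contDiff (j : ℕ) : ContDiff ℝ ∞ (kernel j) :=
  (stdBump j).contDiff_normed (n := ⊤)

theorem kernel_hasCompactSupport (j : ℕ) : HasCompactSupport (kernel j) :=
  (stdBump j).hasCompactSupport_normed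

theorem integral_kernel (j : ℕ) : ∫ w, kernel j w = 1 := (stdBump j).integral_normed

theorem integrable_kernel (j : ℕ) : Integrable (kernel j) := (stdBump j).integrable_normed

theorem kernel_support (j : ℕ) : Function.support (kernel j) = Metric.ball 0 (radius j) :=
  (stdBump j).support_normed_eq

theorem kernel_tsupport (j : ℕ) : tsupport (kernel j) = Metric.closedBall 0 (radius j) :=
  (stdBump j).tsupport_normed_eq

theorem kernel_eq_zero {j : ℕ} {w : ℝ × ℝ} (hw : radius j ≤ ‖w‖) : kernel j w = 0 := by
  by_contra h
  have : w ∈ Function.support (kernel j) := h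
  rw [kernel_support] at this
  simp at this
  linarith

theorem integrable_kernel_mul (j : ℕ) {g : ℝ × ℝ → ℝ} (hg : AEStronglyMeasurable g)
    {c : ℝ} (hc : ∀ w, |g w| ≤ c) : Integrable (fun w => kernel j w * g w) :=
  (integrable_kernel j).mul_bdd hg (Eventually.of_forall hc)

theorem le_integral_kernel_mul (j : ℕ) {g : ℝ × ℝ → ℝ}
    (hg : Integrable (fun w => kernel j w * g w)) {a : ℝ}
    (h : ∀ᵐ w, ‖w‖ < radius j → a ≤ g w) : a ≤ ∫ w, kernel j w * g w := by
  have : a = ∫ w, kernel j w * a := by rw [integral_mul_const, integral_kernel, one_mul]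
  rw [this]
  apply integral_mono_ae ((integrable_kernel j).mul_const a) hg
  filter_upwards [h] with w hw
  rcases lt_or_ge ‖w‖ (radius j) with h1 | h1
  · exact mul_le_mul_of_nonneg_left (hw h1) (kernel_nonneg j w)
  · simp [kernel_eq_zero h1]

theorem integral_kernel_mul_le (j : ℕ) {g : ℝ × ℝ → ℝ}
    (hg : Integrable (fun w => kernel j w * g w)) {a : ℝ}
    (h : ∀ᵐ w, ‖w‖ < radius j → g w ≤ a) : ∫ w, kernel j w * g w ≤ a := by
  have h1 := le_integral_kernel_mul j (g := fun w => -g w) (a := -a) (by simpa using! hg.neg)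
    (h.mono fun w hw h2 => neg_le_neg (hw h2))
  simp only [mul_neg, integral_neg] at h1
  linarith

theorem mol_contDiff (j : ℕ) {f : ℝ × ℝ → ℝ} (hf : LocallyIntegrable f) :
    ContDiff ℝ ∞ (mol j f) :=
  (kernel_hasCompactSupport j).contDiff_convolution_left _ (kernel_contDiff j) hf

theorem mol_hasFDerivAt (j : ℕ) {f : ℝ × ℝ → ℝ} (hf : LocallyIntegrable f) (z : ℝ × ℝ) :
    HasFDerivAt (mol j f) (fderiv ℝ (mol j f) z) z :=
  ((mol_contDiff j hf).differentiable (by simp) z).hasFDerivAt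

theorem mol_ae_tendsto {f : ℝ × ℝ → ℝ} (hf : LocallyIntegrable f) :
    ∀ᵐ z, Tendsto (fun j => mol j f z) atTop (𝓝 (f z)) := by
  refine ContDiffBump.ae_convolution_tendsto_right_of_locallyIntegrable (φ := stdBump) (K := 2)
    tendsto_radius (Eventually.of_forall fun j => ?_) hf
  change 1 / ((j : ℝ) + 1) ≤ 2 * (1 / (2 * ((j : ℝ) + 1)))
  apply le_of_eq
  field_simp

theorem abs_mol_sub_le (j : ℕ) {f : ℝ × ℝ → ℝ} {L : NNReal} (hf : LipschitzWith L f)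
    (z : ℝ × ℝ) : |mol j f z - f z| ≤ L * radius j := by
  have := (stdBump j).dist_normed_convolution_le (μ := volume) (g := f) (x₀ := z)
    (ε := L * radius j) hf.continuous.aestronglyMeasurable ?_
  · exact this
  · intro x hx
    refine (hf.dist_le_mul x z).trans ?_
    gcongr
    exact (Metric.mem_ball.1 hx).le

/-- Mollification commutes with the directional derivatives of a Lipschitz function. -/
theorem fderiv_mol_apply (j : ℕ) {f : ℝ × ℝ → ℝ} {L : NNReal} (hf : LipschitzWith L f)
    (z v : ℝ × ℝ) :
    fderiv ℝ (mol j f) z v = ∫ w, kernel j w * lineDeriv ℝ f (z - w) v := by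
  have h1 : HasLineDerivAt ℝ (mol j f) (fderiv ℝ (mol j f) z v) z v :=
    (mol_hasFDerivAt j hf.continuous.locallyIntegrable z).hasLineDerivAt v
  have hk := integrable_kernel j
  have h2 : HasDerivAt (fun s : ℝ => ∫ w, kernel j w * f (z + s • v - w))
      (∫ w, kernel j w * lineDeriv ℝ f (z - w) v) 0 := by
    refine (hasDerivAt_integral_of_dominated_loc_of_lip (s := univ)
      (F := fun s w => kernel j w * f (z + s • v - w))
      (bound := fun w => kernel j w * (L * ‖v‖)) univ_mem ?_ ?_ ?_ ?_ (hk.mul_const _) ?_).2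
    · refine Eventually.of_forall fun s => Continuous.aestronglyMeasurable ?_
      exact (kernel_contDiff j).continuous.mul (hf.continuous.comp (by fun_prop))
    · refine Continuous.integrable_of_hasCompactSupport ?_ ?_
      · exact (kernel_contDiff j).continuous.mul (hf.continuous.comp (by fun_prop))
      · exact (kernel_hasCompactSupport j).mul_right
    · refine (kernel_contDiff j).continuous.aestronglyMeasurable.mul ?_
      exact ((measurable_lineDeriv (𝕜 := ℝ) (v := v) hf.continuous).comp
        (measurable_const.sub measurable_id)).aestronglyMeasurable
    · refine Eventually.of_forall fun w => LipschitzOnWith.of_dist_le_mul fun s _ s' _ => ?_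
      rw [Real.dist_eq, ← mul_sub, abs_mul, abs_of_nonneg (kernel_nonneg j w)]
      have h3 := hf.dist_le_mul (z + s • v - w) (z + s' • v - w)
      have h4 : dist (z + s • v - w) (z + s' • v - w) = dist s s' * ‖v‖ := by
        rw [dist_eq_norm, dist_eq_norm, ← norm_smul]
        congr 1
        rw [sub_smul]; abel
      rw [h4, Real.dist_eq] at h3
      rw [Real.coe_nnabs, abs_of_nonneg (mul_nonneg (kernel_nonneg j w) (by positivity))]
      calc kernel j w * |f (z + s • v - w) - f (z + s' • v - w)|
          ≤ kernel j w * (L * (dist s s' * ‖v‖)) :=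
            mul_le_mul_of_nonneg_left h3 (kernel_nonneg j w)
        _ = kernel j w * (L * ‖v‖) * dist s s' := by ring
    · have h5 : ∀ᵐ w, LineDifferentiableAt ℝ f (z - w) v :=
        (Measure.measurePreserving_sub_left volume z).quasiMeasurePreserving.ae
          (hf.ae_lineDifferentiableAt v)
      filter_upwards [h5] with w hw
      have h6 : HasDerivAt (fun s : ℝ => f (z - w + s • v)) (lineDeriv ℝ f (z - w) v) 0 :=
        hw.hasLineDerivAt
      have h7 := h6.const_mul (kernel j w)
      refine h7.congr_of_eventuallyEq (Eventually.of_forall fun s => ?_)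
      simp only
      congr 2
      abel
  have h3 : HasDerivAt (fun s : ℝ => mol j f (z + s • v)) (fderiv ℝ (mol j f) z v) 0 := h1
  exact h3.unique h2

theorem abs_fderiv_mol_apply_le (j : ℕ) {f : ℝ × ℝ → ℝ} {L : NNReal} (hf : LipschitzWith L f)
    (z v : ℝ × ℝ) : |fderiv ℝ (mol j f) z v| ≤ L * ‖v‖ := by
  have hb : ∀ w, |lineDeriv ℝ f (z - w) v| ≤ L * ‖v‖ := fun w =>
    norm_lineDeriv_le_of_lipschitz ℝ hf
  have hm : AEStronglyMeasurable (fun w => lineDeriv ℝ f (z - w) v) :=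
    ((measurable_lineDeriv (𝕜 := ℝ) (v := v) hf.continuous).comp
        (measurable_const.sub measurable_id)).aestronglyMeasurable
  have hi := integrable_kernel_mul j hm hb
  rw [fderiv_mol_apply j hf, abs_le]
  exact ⟨le_integral_kernel_mul j hi (Eventually.of_forall fun w _ => (abs_le.1 (hb w)).1),
    integral_kernel_mul_le j hi (Eventually.of_forall fun w _ => (abs_le.1 (hb w)).2)⟩

theorem mol_eq_zero {j : ℕ} {f : ℝ × ℝ → ℝ} {z : ℝ × ℝ}
    (hz : z ∉ Metric.cthickening (radius j) (tsupport f)) : mol j f z = 0 := by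
  rw [mol_apply]
  apply integral_eq_zero_of_ae
  refine Eventually.of_forall fun w => ?_
  rcases lt_or_ge ‖w‖ (radius j) with h1 | h1
  · have : f (z - w) = 0 := by
      by_contra h2
      apply hz
      refine Metric.mem_cthickening_of_dist_le z (z - w) _ _ (subset_tsupport f h2) ?_
      simpa [dist_eq_norm] using h1.le
    simp [this]
  · simp [kernel_eq_zero h1]

theorem tsupport_mol_subset (j : ℕ) (f : ℝ × ℝ → ℝ) :
    tsupport (mol j f) ⊆ Metric.cthickening (radius j) (tsupport f) := by
  refine closure_minimal (fun z hz => ?_) Metric.isClosed_cthickening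
  by_contra h
  exact hz (mol_eq_zero h)

theorem isOpen_domain (T : ℝ) : IsOpen (domain T) := isOpen_Ioo.prod isOpen_Ioi

/-- Boundedness on compact sets. -/
def CompactBounded (A : ℝ × ℝ → ℝ) : Prop := ∀ K, IsCompact K → ∃ c, ∀ z ∈ K, |A z| ≤ c

theorem lineDeriv_eq_zero_of_notMem_tsupport {Θ : ℝ × ℝ → ℝ} {z v : ℝ × ℝ}
    (hz : z ∉ tsupport Θ) : lineDeriv ℝ Θ z v = 0 := by
  have h : Θ =ᶠ[𝓝 z] fun _ => 0 := notMem_tsupport_iff_eventuallyEq.1 hz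
  rw [h.lineDeriv_eq]
  simp [lineDeriv]

/-- A differential inequality tested by smooth functions may be tested by Lipschitz functions. -/
theorem integral_nonneg_of_lipschitz {T : ℝ} {A B C : ℝ × ℝ → ℝ}
    (mA : Measurable A) (mB : Measurable B) (mC : Measurable C)
    (bA : CompactBounded A) (bB : CompactBounded B) (bC : CompactBounded C)
    (h : ∀ φ, IsTest T φ → (∀ p, 0 ≤ φ p) →
      0 ≤ ∫ z, (A z * dt φ z + B z * dx φ z + C z * φ z))
    {Θ : ℝ × ℝ → ℝ} {L : NNReal} (hL : LipschitzWith L Θ) (hc : HasCompactSupport Θ)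
    (hs : tsupport Θ ⊆ domain T) (h0 : ∀ z, 0 ≤ Θ z) :
    0 ≤ ∫ z, (A z * lineDeriv ℝ Θ z (1, 0) + B z * lineDeriv ℝ Θ z (0, 1) + C z * Θ z) := by
  obtain ⟨δ, δpos, hδ⟩ := IsCompact.exists_cthickening_subset_open hc (isOpen_domain T) hs
  set K := Metric.cthickening 1 (tsupport Θ) with hK
  have cK : IsCompact K := IsCompact.cthickening hc
  obtain ⟨a, ha⟩ := bA K cK
  obtain ⟨b, hb⟩ := bB K cK
  obtain ⟨c, hc'⟩ := bC K cK
  obtain ⟨d, hd⟩ := cK.exists_bound_of_continuousOn hL.continuous.continuousOn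
  have hloc : LocallyIntegrable Θ := hL.continuous.locallyIntegrable
  have hout : ∀ j, ∀ z ∉ K, ∀ v, fderiv ℝ (mol j Θ) z v = 0 := by
    intro j z hz v
    have h1 : z ∉ tsupport (mol j Θ) := fun h2 =>
      hz (Metric.cthickening_mono (radius_le_one j) _ (tsupport_mol_subset j Θ h2))
    have h2 : z ∉ tsupport (fderiv ℝ (mol j Θ)) := fun h3 => h1 (tsupport_fderiv_subset ℝ h3)
    rw [image_eq_zero_of_notMem_tsupport h2]; rfl
  have hout' : ∀ j, ∀ z ∉ K, mol j Θ z = 0 := fun j z hz =>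
    mol_eq_zero fun h2 => hz (Metric.cthickening_mono (radius_le_one j) _ h2)
  have hlim : Tendsto (fun j => ∫ z, (A z * dt (mol j Θ) z + B z * dx (mol j Θ) z
      + C z * mol j Θ z)) atTop
      (𝓝 (∫ z, (A z * lineDeriv ℝ Θ z (1, 0) + B z * lineDeriv ℝ Θ z (0, 1) + C z * Θ z))) := by
    refine tendsto_integral_of_dominated_convergence
      (K.indicator fun _ => a * L + b * L + c * (d + L)) ?_ ?_ ?_ ?_
    · intro j
      have hsm := mol_contDiff j hloc
      have h1 : Continuous (dt (mol j Θ)) :=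
        (hsm.continuous_fderiv (by simp)).clm_apply continuous_const
      have h2 : Continuous (dx (mol j Θ)) :=
        (hsm.continuous_fderiv (by simp)).clm_apply continuous_const
      exact (((mA.mul h1.measurable).add (mB.mul h2.measurable)).add
        (mC.mul hsm.continuous.measurable)).aestronglyMeasurable
    · exact (integrable_indicator_iff cK.measurableSet).2
        (integrableOn_const cK.measure_lt_top.ne)
    · intro j
      refine Eventually.of_forall fun z => ?_
      by_cases hz : z ∈ K
      · rw [indicator_of_mem hz]
        have e1 : |dt (mol j Θ) z| ≤ L := by
          simpa [dt, dx, Prod.norm_def] using abs_fderiv_mol_apply_le j hL z (1, 0)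
        have e2 : |dx (mol j Θ) z| ≤ L := by
          simpa [dt, dx, Prod.norm_def] using abs_fderiv_mol_apply_le j hL z (0, 1)
        have e3 : |mol j Θ z| ≤ d + L := by
          have h1 := abs_mol_sub_le j hL z
          have h2 : |Θ z| ≤ d := hd z hz
          have h3 : (L : ℝ) * radius j ≤ L * 1 := by
            gcongr; exact radius_le_one j
          have h4 : mol j Θ z = (mol j Θ z - Θ z) + Θ z := by ring
          rw [h4]
          refine (abs_add_le _ _).trans ?_
          linarith
        rw [Real.norm_eq_abs]
        refine (abs_add_three _ _ _).trans ?_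
        rw [abs_mul, abs_mul, abs_mul]
        have := ha z hz
        have := hb z hz
        have := hc' z hz
        have : 0 ≤ a := (abs_nonneg _).trans (ha z hz)
        have : 0 ≤ b := (abs_nonneg _).trans (hb z hz)
        have : 0 ≤ c := (abs_nonneg _).trans (hc' z hz)
        gcongr
      · rw [indicator_of_notMem hz]
        simp [dt, dx, hout j z hz, hout' j z hz]
    · have key : ∀ v, ∀ᵐ z, Tendsto (fun j => fderiv ℝ (mol j Θ) z v) atTop
          (𝓝 (lineDeriv ℝ Θ z v)) := by
        intro v
        filter_upwards [mol_ae_tendsto (hL.locallyIntegrable_lineDeriv v)] with z hz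
        refine hz.congr fun j => ?_
        rw [fderiv_mol_apply j hL, mol_apply]
      filter_upwards [key (1, 0), key (0, 1), mol_ae_tendsto hloc] with z h1 h2 h3
      exact ((h1.const_mul _).add (h2.const_mul _)).add (h3.const_mul _)
  refine ge_of_tendsto hlim ?_
  have hev : ∀ᶠ j in atTop, radius j < δ := tendsto_radius.eventually (gt_mem_nhds δpos)
  filter_upwards [hev] with j hj
  refine h _ ⟨mol_contDiff j hloc, ?_, ?_⟩ fun p => ?_
  · exact HasCompactSupport.of_support_subset_isCompact cK fun z hz => by
      by_contra h2
      exact hz (hout' j z h2)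
  · exact (tsupport_mol_subset j Θ).trans ((Metric.cthickening_mono hj.le _).trans hδ)
  · rw [mol_apply]
    exact integral_nonneg fun w => mul_nonneg (kernel_nonneg j w) (h0 _)

/-! ### Normalized solutions -/

/-- The coefficient `2x - x²` of the linear part of the flux. -/
def drift (x : ℝ) : ℝ := 2 * x - x ^ 2

theorem continuous_drift : Continuous drift := by unfold drift; fun_prop

theorem flux_eq (x k : ℝ) : flux x k = drift x * k - k ^ 2 := rfl

theorem deriv_flux (x k : ℝ) : deriv (fun y => flux y k) x = (2 - 2 * x) * k := by
  have h : HasDerivAt (fun y : ℝ => (2 * y - y ^ 2) * k - k ^ 2)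
      ((2 * 1 - ((2 : ℕ) : ℝ) * x ^ (2 - 1)) * k) x :=
    ((((hasDerivAt_id x).const_mul 2).sub (hasDerivAt_pow 2 x)).mul_const k).sub_const (k ^ 2)
  rw [show (fun y => flux y k) = fun y : ℝ => (2 * y - y ^ 2) * k - k ^ 2 from rfl, h.deriv]
  norm_num

theorem sign_mul_eq_abs (r : ℝ) : Real.sign r * r = |r| := by
  rcases lt_trichotomy r 0 with h | h | h
  · rw [Real.sign_of_neg h, abs_of_neg h]; ring
  · simp [h]
  · rw [Real.sign_of_pos h, abs_of_pos h]; ring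

theorem abs_sign_le (r : ℝ) : |Real.sign r| ≤ 1 := by
  rcases Real.sign_apply_eq r with h | h | h <;> simp [h]

theorem measurable_sign : Measurable Real.sign := by
  unfold Real.sign
  exact Measurable.ite measurableSet_Iio measurable_const
    (Measurable.ite measurableSet_Ioi measurable_const measurable_const)

/-- A non-negative solution on `(0, T) × (0, ∞)` bounded by `M`, represented by a measurable and
integrable function on the whole plane that obeys the bounds everywhere. Its values off the domain
play no role, since test functions are supported in the domain. The entropy inequality uses
`sgn(u - k) (F(x, u) - F(x, k)) = |u - k| (2x - x² - u - k)`. -/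
structure IsRep (T M : ℝ) (u : ℝ × ℝ → ℝ) : Prop where
  meas : Measurable u
  nonneg : ∀ z, 0 ≤ u z
  le : ∀ z, u z ≤ M
  integrable : Integrable u
  weak : ∀ φ, IsTest T φ → ∫ z, (u z * dt φ z + flux z.2 (u z) * dx φ z) = 0
  entropy : ∀ (k : ℝ) (φ : ℝ × ℝ → ℝ), IsTest T φ → (∀ p, 0 ≤ φ p) →
    0 ≤ ∫ z, (|u z - k| * dt φ z + |u z - k| * (drift z.2 - u z - k) * dx φ z
      + -(Real.sign (u z - k) * ((2 - 2 * z.2) * k)) * φ z)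

theorem IsTest.dt_eq_zero {T : ℝ} {φ : ℝ × ℝ → ℝ} (h : IsTest T φ) {z : ℝ × ℝ}
    (hz : z ∉ domain T) : dt φ z = 0 := by
  have h3 : z ∉ tsupport (fderiv ℝ φ) := fun h3 =>
    hz (h.support_subset (tsupport_fderiv_subset ℝ h3))
  rw [dt, image_eq_zero_of_notMem_tsupport h3]; rfl

theorem IsTest.dx_eq_zero {T : ℝ} {φ : ℝ × ℝ → ℝ} (h : IsTest T φ) {z : ℝ × ℝ}
    (hz : z ∉ domain T) : dx φ z = 0 := by
  have h3 : z ∉ tsupport (fderiv ℝ φ) := fun h3 =>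
    hz (h.support_subset (tsupport_fderiv_subset ℝ h3))
  rw [dx, image_eq_zero_of_notMem_tsupport h3]; rfl

theorem IsTest.eq_zero {T : ℝ} {φ : ℝ × ℝ → ℝ} (h : IsTest T φ) {z : ℝ × ℝ}
    (hz : z ∉ domain T) : φ z = 0 :=
  image_eq_zero_of_notMem_tsupport fun h3 => hz (h.support_subset h3)

/-- Truncation and extension by zero change a solution on a null set of the domain only. -/
theorem IsNonnegBoundedSolution.exists_rep {T : ℝ} {n : ℝ → ℝ → ℝ} {n₀ : ℝ → ℝ}
    (h : IsNonnegBoundedSolution T n n₀) : ∃ M u, IsRep T M u ∧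
      ∀ᵐ p ∂(volume.restrict (domain T)), n p.1 p.2 = u p := by
  obtain ⟨M, hM⟩ := h.bounded
  have hi := h.solution.integrable
  have mD : MeasurableSet (domain T) := (isOpen_domain T).measurableSet
  set f := hi.aestronglyMeasurable.mk with hf
  have mf : Measurable f := hi.aestronglyMeasurable.stronglyMeasurable_mk.measurable
  have ef : ∀ᵐ p ∂(volume.restrict (domain T)), n p.1 p.2 = f p :=
    hi.aestronglyMeasurable.ae_eq_mk
  set u : ℝ × ℝ → ℝ := (domain T).indicator fun z => max 0 (min |M| (f z)) with hu
  have eu : ∀ᵐ p ∂(volume.restrict (domain T)), n p.1 p.2 = u p := by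
    filter_upwards [ef, h.nonneg, hM, ae_restrict_mem mD] with p h1 h2 h3 h4
    rw [hu, indicator_of_mem h4, ← h1, min_eq_right, max_eq_right h2]
    exact (le_abs_self _).trans (h3.trans (le_abs_self M))
  refine ⟨|M|, u, ⟨?_, ?_, ?_, ?_, ?_, ?_⟩, eu⟩
  · exact (measurable_const.max (measurable_const.min mf)).indicator mD
  · intro z
    exact indicator_nonneg (fun _ _ => le_max_left _ _) z
  · intro z
    exact indicator_apply_le' (fun _ => max_le (abs_nonneg M) (min_le_left _ _))
      fun _ => abs_nonneg M
  · rw [hu, integrable_indicator_iff mD]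
    refine IntegrableOn.congr_fun_ae hi ?_
    filter_upwards [eu, ae_restrict_mem mD] with p h1 h4
    rw [h1, hu, indicator_of_mem h4]
  · intro φ hφ
    rw [← (h.solution.weak φ hφ).2, ← setIntegral_eq_integral_of_forall_compl_eq_zero
      (s := domain T)]
    · refine integral_congr_ae ?_
      filter_upwards [eu] with p h1
      rw [weakIntegrand, h1]
    · intro z hz
      simp [hφ.dt_eq_zero hz, hφ.dx_eq_zero hz]
  · intro k φ hφ h0
    have h1 := (h.solution.entropy k φ hφ h0).2
    rw [← setIntegral_eq_integral_of_forall_compl_eq_zero (s := domain T)]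
    · convert! h1 using 1
      refine integral_congr_ae ?_
      filter_upwards [eu] with p h1
      rw [entropyIntegrand, h1, deriv_flux, flux_eq, flux_eq, ← sign_mul_eq_abs]
      ring
    · intro z hz
      simp [hφ.dt_eq_zero hz, hφ.dx_eq_zero hz, hφ.eq_zero hz]

theorem IsRep.mono {T M M' : ℝ} {u : ℝ × ℝ → ℝ} (h : IsRep T M u) (hM : M ≤ M') :
    IsRep T M' u :=
  ⟨h.meas, h.nonneg, fun z => (h.le z).trans hM, h.integrable, h.weak, h.entropy⟩

/-! ### Continuity of translations in the mean -/

theorem tendsto_integral_abs_translate_sub {u : ℝ × ℝ → ℝ} (hu : Integrable u) :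
    Tendsto (fun h => ∫ z, |u (z - h) - u z|) (𝓝 0) (𝓝 0) := by
  rw [Metric.tendsto_nhds]
  intro ε hε
  obtain ⟨g, gc, hg, gcont, gi⟩ :=
    hu.exists_hasCompactSupport_integral_sub_le (show 0 < ε / 4 by positivity)
  have htr : ∀ h : ℝ × ℝ, Integrable fun z => u (z - h) := fun h => hu.comp_sub_right h
  have gtr : ∀ h : ℝ × ℝ, Integrable fun z => g (z - h) := fun h => gi.comp_sub_right h
  have h1 : Tendsto (fun h => ∫ z, |g (z - h) - g z|) (𝓝 0) (𝓝 (∫ z : ℝ × ℝ, (0 : ℝ))) := by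
    obtain ⟨c, hc⟩ := gc.exists_bound_of_continuous gcont
    set K := Metric.cthickening 1 (tsupport g)
    have cK : IsCompact K := IsCompact.cthickening gc
    refine tendsto_integral_filter_of_dominated_convergence (K.indicator fun _ => 2 * c) ?_ ?_ ?_ ?_
    · refine Eventually.of_forall fun h => Continuous.aestronglyMeasurable ?_
      fun_prop
    · filter_upwards [Metric.closedBall_mem_nhds (0 : ℝ × ℝ) one_pos] with h hh
      refine Eventually.of_forall fun z => ?_
      by_cases hz : z ∈ K
      · rw [indicator_of_mem hz, Real.norm_eq_abs, abs_abs]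
        refine (abs_sub _ _).trans ?_
        have h2 := hc (z - h)
        have h3 := hc z
        rw [Real.norm_eq_abs] at h2 h3
        linarith
      · rw [indicator_of_notMem hz]
        have h2 : g z = 0 := image_eq_zero_of_notMem_tsupport fun h3 =>
          hz (Metric.self_subset_cthickening _ h3)
        have h4 : g (z - h) = 0 := image_eq_zero_of_notMem_tsupport fun h3 =>
          hz (Metric.mem_cthickening_of_dist_le z (z - h) _ _ h3 (by
            simpa [dist_eq_norm] using hh))
        simp [h2, h4]
    · exact (integrable_indicator_iff cK.measurableSet).2
        (integrableOn_const cK.measure_lt_top.ne)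
    · refine Eventually.of_forall fun z => ?_
      have : Continuous fun h => |g (z - h) - g z| := by fun_prop
      simpa using this.tendsto 0
  rw [integral_zero] at h1
  filter_upwards [h1.eventually (gt_mem_nhds (show 0 < ε / 4 by positivity))] with h hh
  have i1 : Integrable fun z => |u (z - h) - g (z - h)| := ((htr h).sub (gtr h)).abs
  have i2 : Integrable fun z => |g (z - h) - g z| := ((gtr h).sub gi).abs
  have i3 : Integrable fun z => |u z - g z| := (hu.sub gi).abs
  have i12 : Integrable fun z => |u (z - h) - g (z - h)| + |g (z - h) - g z| := i1.add i2
  have h4 : ∫ z, |u (z - h) - g (z - h)| = ∫ z, |u z - g z| :=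
    integral_sub_right_eq_self (fun z => |u z - g z|) h
  have h5 : ∫ z, |u (z - h) - u z| ≤ ∫ z, (|u (z - h) - g (z - h)| + |g (z - h) - g z|
      + |u z - g z|) := by
    refine integral_mono ((htr h).sub hu).abs (i12.add i3) fun z => ?_
    have : u (z - h) - u z = (u (z - h) - g (z - h)) + (g (z - h) - g z) + -(u z - g z) := by ring
    simp only
    rw [this]
    refine (abs_add_three _ _ _).trans ?_
    rw [abs_neg]
  rw [integral_add i12 i3, integral_add i1 i2, h4] at h5
  simp only [Real.norm_eq_abs] at hg
  rw [Real.dist_eq, sub_zero, abs_of_nonneg (integral_nonneg fun z => abs_nonneg _)]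
  linarith

/-! ### Doubling of variables -/

theorem fderiv_mul_kernel {ψ κ : ℝ × ℝ → ℝ} (hψ : ContDiff ℝ ∞ ψ) (hκ : ContDiff ℝ ∞ κ)
    (l : ℝ) (z w v : ℝ × ℝ) :
    fderiv ℝ (fun z => ψ z * κ (l • (z - w))) z v
      = fderiv ℝ ψ z v * κ (l • (z - w)) + ψ z * (l * fderiv ℝ κ (l • (z - w)) v) := by
  have h1 := (hψ.differentiable (by simp) z).hasFDerivAt
  have h2 := (hκ.differentiable (by simp) (l • (z - w))).hasFDerivAt
  have h3 : HasFDerivAt (fun z : ℝ × ℝ => l • (z - w)) (l • ContinuousLinearMap.id ℝ (ℝ × ℝ)) z :=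
    ((hasFDerivAt_id z).sub_const w).const_smul l
  have h4 := h1.mul (h2.comp z h3)
  have h5 : fderiv ℝ (fun z => ψ z * κ (l • (z - w))) z = _ := h4.fderiv
  rw [h5]
  simp
  ring

theorem fderiv_kernel_sub {κ : ℝ × ℝ → ℝ} (hκ : ContDiff ℝ ∞ κ)
    (l c : ℝ) (z w v : ℝ × ℝ) :
    fderiv ℝ (fun w => c * κ (l • (z - w))) w v
      = -(c * (l * fderiv ℝ κ (l • (z - w)) v)) := by
  have h2 := (hκ.differentiable (by simp) (l • (z - w))).hasFDerivAt
  have h3 : HasFDerivAt (fun w : ℝ × ℝ => l • (z - w))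
      (l • -ContinuousLinearMap.id ℝ (ℝ × ℝ)) w :=
    ((hasFDerivAt_id w).const_sub z).const_smul l
  have h4 := (h2.comp w h3).const_mul c
  have h5 : fderiv ℝ (fun w => c * κ (l • (z - w))) w = _ := h4.fderiv
  rw [h5]
  simp

theorem hasCompactSupport_prod {A B : ℝ × ℝ → ℝ} (hA : HasCompactSupport A)
    (hB : HasCompactSupport B) :
    HasCompactSupport fun p : (ℝ × ℝ) × (ℝ × ℝ) => A p.1 * B p.2 := by
  refine HasCompactSupport.of_support_subset_isCompact (hA.isCompact.prod hB.isCompact) ?_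
  intro p hp
  exact ⟨subset_tsupport A (left_ne_zero_of_mul hp), subset_tsupport B (right_ne_zero_of_mul hp)⟩

theorem hasCompactSupport_shear {A B : ℝ × ℝ → ℝ} (hA : HasCompactSupport A)
    (hB : HasCompactSupport B) {l : ℝ} (hl : l ≠ 0) :
    HasCompactSupport fun p : (ℝ × ℝ) × (ℝ × ℝ) => A p.1 * B (l • (p.1 - p.2)) := by
  have hc : IsCompact ((fun p : (ℝ × ℝ) × (ℝ × ℝ) => (p.1, p.1 - l⁻¹ • p.2)) ''
      (tsupport A ×ˢ tsupport B)) :=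
    (hA.isCompact.prod hB.isCompact).image (by fun_prop)
  refine HasCompactSupport.of_support_subset_isCompact hc ?_
  intro p hp
  refine ⟨(p.1, l • (p.1 - p.2)), ⟨subset_tsupport A (left_ne_zero_of_mul hp),
    subset_tsupport B (right_ne_zero_of_mul hp)⟩, ?_⟩
  simp [smul_smul, inv_mul_cancel₀ hl]

theorem integrable_bdd_mul_compact {g P : (ℝ × ℝ) × (ℝ × ℝ) → ℝ} (mg : Measurable g) {c : ℝ}
    (hg : ∀ p, |g p| ≤ c) (cP : Continuous P) (hP : HasCompactSupport P) :
    Integrable (fun p => g p * P p) :=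
  (cP.integrable_of_hasCompactSupport hP).bdd_mul mg.aestronglyMeasurable (Eventually.of_forall hg)

theorem abs_abs_sub_le_of_mem {M a b c : ℝ} (hb : 0 ≤ b) (hb' : b ≤ M)
    (hc : 0 ≤ c) (hc' : c ≤ M) (ha : 0 ≤ a) :
    |(|a - b| * (a + b)) - |a - c| * (a + c)| ≤ |b - c| * (2 * M) := by
  rw [← abs_of_nonneg (add_nonneg ha hb), ← abs_mul, ← abs_of_nonneg (add_nonneg ha hc),
    ← abs_mul]
  refine (abs_abs_sub_abs_le _ _).trans ?_
  have : (a - b) * (a + b) - (a - c) * (a + c) = -((b - c) * (b + c)) := by ring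
  rw [this, abs_neg, abs_mul]
  refine mul_le_mul_of_nonneg_left ?_ (abs_nonneg _)
  rw [abs_of_nonneg (add_nonneg hb hc)]
  linarith

/-- The term `F_x(x, k) φ` of the Kruzkov inequality is cancelled, in the doubled inequality, by the
difference of the drifts at the two points times the derivative of the kernel; this is the first
moment of that derivative. -/
theorem integral_snd_mul_dx_kernel : ∫ h, h.2 * dx (kernel 0) h = -1 := by
  have hκ := kernel_contDiff 0
  have hc := kernel_hasCompactSupport 0
  have cx : Continuous (dx (kernel 0)) :=
    (hκ.continuous_fderiv (by simp)).clm_apply continuous_const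
  have hcx : HasCompactSupport (dx (kernel 0)) :=
    (hc.fderiv (𝕜 := ℝ)).comp_left (g := fun L : ℝ × ℝ →L[ℝ] ℝ => L (0, 1)) rfl
  have hd : ∀ h : ℝ × ℝ, fderiv ℝ (fun h : ℝ × ℝ => h.2) h (0, 1) = 1 := by
    intro h
    have : fderiv ℝ (fun h : ℝ × ℝ => h.2) h = ContinuousLinearMap.snd ℝ ℝ ℝ := fderiv_snd
    rw [this]; rfl
  have := integral_mul_fderiv_eq_neg_fderiv_mul_of_integrable (μ := (volume : Measure (ℝ × ℝ)))
    (f := fun h : ℝ × ℝ => h.2) (g := kernel 0) (v := (0, 1)) ?_ ?_ ?_ ?_ ?_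
  · simp only [hd, one_mul, integral_kernel] at this
    exact this
  · simpa [hd] using integrable_kernel 0
  · exact (continuous_snd.mul cx).integrable_of_hasCompactSupport (hcx.mul_left)
  · exact (continuous_snd.mul hκ.continuous).integrable_of_hasCompactSupport (hc.mul_left)
  · intro x _; fun_prop
  · intro x _; exact hκ.differentiable (by simp) x

/-- The integrand of the doubled entropy inequality, as a function of `z` and of the rescaled
difference `h` of the two variables; `v` stands for the value of the second solution, and `e` is
the inverse of the scale. -/
noncomputable def doubled (u : ℝ × ℝ → ℝ) (ψ : ℝ × ℝ → ℝ) (e v : ℝ) (z h : ℝ × ℝ) : ℝ :=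
  |u z - v| * ((dt ψ z + drift z.2 * dx ψ z + (2 - 2 * z.2) * ψ z) * kernel 0 h)
    + |u z - v| * (((2 - 2 * z.2) * ψ z) * (h.2 * dx (kernel 0) h))
    - (|u z - v| * (u z + v)) * (dx ψ z * kernel 0 h)
    + e * ((2 * Real.sign (u z - v) * u z) * (ψ z * (h.2 * kernel 0 h))
      + |u z - v| * (ψ z * (h.2 ^ 2 * dx (kernel 0) h)))

section

variable {T M : ℝ} {u u' : ℝ × ℝ → ℝ} {ψ : ℝ × ℝ → ℝ}

/-- The Kruzkov inequalities of two solutions, tested with `ψ z * kernel 0 (l • (z - w))` in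
either variable, add up to an inequality for the doubled integrand. -/
theorem integral_doubled_nonneg (hu : IsRep T M u) (hu' : IsRep T M u') (hψ : IsTest T ψ)
    (h0 : ∀ z, 0 ≤ ψ z) {l : ℝ} (hl : 0 < l)
    (hsub : Metric.cthickening l⁻¹ (tsupport ψ) ⊆ domain T) :
    0 ≤ ∫ z, ∫ h, doubled u ψ l⁻¹ (u' (z - l⁻¹ • h)) z h := by
  have hκ := kernel_contDiff 0
  have hc := kernel_hasCompactSupport 0
  set κ := kernel 0 with hκdef
  have ct : Continuous (dt κ) := (hκ.continuous_fderiv (by simp)).clm_apply continuous_const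
  have cx : Continuous (dx κ) := (hκ.continuous_fderiv (by simp)).clm_apply continuous_const
  have hct : HasCompactSupport (dt κ) :=
    (hc.fderiv (𝕜 := ℝ)).comp_left (g := fun L : ℝ × ℝ →L[ℝ] ℝ => L (1, 0)) rfl
  have hcx : HasCompactSupport (dx κ) :=
    (hc.fderiv (𝕜 := ℝ)).comp_left (g := fun L : ℝ × ℝ →L[ℝ] ℝ => L (0, 1)) rfl
  have cψt : Continuous (dt ψ) :=
    (hψ.smooth.continuous_fderiv (by simp)).clm_apply continuous_const
  have cψx : Continuous (dx ψ) :=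
    (hψ.smooth.continuous_fderiv (by simp)).clm_apply continuous_const
  have hψt : HasCompactSupport (dt ψ) :=
    (hψ.compact.fderiv (𝕜 := ℝ)).comp_left (g := fun L : ℝ × ℝ →L[ℝ] ℝ => L (1, 0)) rfl
  have hψx : HasCompactSupport (dx ψ) :=
    (hψ.compact.fderiv (𝕜 := ℝ)).comp_left (g := fun L : ℝ × ℝ →L[ℝ] ℝ => L (0, 1)) rfl
  have cψ := hψ.smooth.continuous
  have cd := continuous_drift
  -- the two Kruzkov integrands
  set I₁ : (ℝ × ℝ) × (ℝ × ℝ) → ℝ := fun p =>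
    |u p.1 - u' p.2| * (dt ψ p.1 * κ (l • (p.1 - p.2)) + ψ p.1 * (l * dt κ (l • (p.1 - p.2))))
    + |u p.1 - u' p.2| * (drift p.1.2 - u p.1 - u' p.2) *
      (dx ψ p.1 * κ (l • (p.1 - p.2)) + ψ p.1 * (l * dx κ (l • (p.1 - p.2))))
    + -(Real.sign (u p.1 - u' p.2) * ((2 - 2 * p.1.2) * u' p.2)) *
      (ψ p.1 * κ (l • (p.1 - p.2))) with hI₁
  set I₂ : (ℝ × ℝ) × (ℝ × ℝ) → ℝ := fun p =>
    |u' p.2 - u p.1| * (-(ψ p.1 * (l * dt κ (l • (p.1 - p.2)))))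
    + |u' p.2 - u p.1| * (drift p.2.2 - u' p.2 - u p.1) *
      (-(ψ p.1 * (l * dx κ (l • (p.1 - p.2)))))
    + -(Real.sign (u' p.2 - u p.1) * ((2 - 2 * p.2.2) * u p.1)) *
      (ψ p.1 * κ (l • (p.1 - p.2))) with hI₂
  have mu : Measurable fun p : (ℝ × ℝ) × (ℝ × ℝ) => u p.1 := hu.meas.comp measurable_fst
  have mu' : Measurable fun p : (ℝ × ℝ) × (ℝ × ℝ) => u' p.2 := hu'.meas.comp measurable_snd
  have ba : ∀ p : (ℝ × ℝ) × (ℝ × ℝ), |u p.1 - u' p.2| ≤ M := fun p => by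
    have := hu.nonneg p.1; have := hu.le p.1; have := hu'.nonneg p.2; have := hu'.le p.2
    rw [abs_le]; constructor <;> linarith
  have hM : 0 ≤ M := (hu.nonneg 0).trans (hu.le 0)
  have bb : ∀ p : (ℝ × ℝ) × (ℝ × ℝ), |(|u p.1 - u' p.2| * (u p.1 + u' p.2))| ≤ M * (2 * M) :=
    fun p => by
    have := hu.nonneg p.1; have := hu.le p.1; have := hu'.nonneg p.2; have := hu'.le p.2
    rw [abs_mul, abs_abs]
    refine mul_le_mul (ba p) ?_ (abs_nonneg _) hM
    rw [abs_le]; constructor <;> linarith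
  have bs : ∀ p : (ℝ × ℝ) × (ℝ × ℝ), |Real.sign (u p.1 - u' p.2) * u' p.2| ≤ M := fun p => by
    have := hu'.nonneg p.2; have := hu'.le p.2
    rw [abs_mul]
    calc _ ≤ 1 * |u' p.2| := by gcongr; exact abs_sign_le _
      _ ≤ M := by rw [abs_of_nonneg (by assumption)]; linarith
  have bs' : ∀ p : (ℝ × ℝ) × (ℝ × ℝ), |Real.sign (u' p.2 - u p.1) * u p.1| ≤ M := fun p => by
    have := hu.nonneg p.1; have := hu.le p.1
    rw [abs_mul]
    calc _ ≤ 1 * |u p.1| := by gcongr; exact abs_sign_le _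
      _ ≤ M := by rw [abs_of_nonneg (by assumption)]; linarith
  have ma : Measurable fun p : (ℝ × ℝ) × (ℝ × ℝ) => |u p.1 - u' p.2| := (mu.sub mu').abs
  have mb : Measurable fun p : (ℝ × ℝ) × (ℝ × ℝ) => |u p.1 - u' p.2| * (u p.1 + u' p.2) :=
    ma.mul (mu.add mu')
  have ba' : ∀ p : (ℝ × ℝ) × (ℝ × ℝ), |(|u p.1 - u' p.2|)| ≤ M := fun p => by
    rw [abs_abs]; exact ba p
  have ms : Measurable fun p : (ℝ × ℝ) × (ℝ × ℝ) => Real.sign (u p.1 - u' p.2) * u' p.2 :=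
    (measurable_sign.comp (mu.sub mu')).mul mu'
  have ms' : Measurable fun p : (ℝ × ℝ) × (ℝ × ℝ) => Real.sign (u' p.2 - u p.1) * u p.1 :=
    (measurable_sign.comp (mu'.sub mu)).mul mu
  have hκs : ∀ {A B D : ℝ × ℝ → ℝ}, HasCompactSupport A → HasCompactSupport B →
      HasCompactSupport fun p : (ℝ × ℝ) × (ℝ × ℝ) => A p.1 * B (l • (p.1 - p.2)) * D p.2 :=
    fun hA hB => (hasCompactSupport_shear hA hB hl.ne').mul_right
  have one : Continuous fun _ : ℝ × ℝ => (1 : ℝ) := continuous_const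
  have int : ∀ {g : (ℝ × ℝ) × (ℝ × ℝ) → ℝ} {c : ℝ} {A B D : ℝ × ℝ → ℝ}, Measurable g →
      (∀ p, |g p| ≤ c) → Continuous A → HasCompactSupport A → Continuous B → HasCompactSupport B →
      Continuous D →
      Integrable fun p => g p * (A p.1 * B (l • (p.1 - p.2)) * D p.2) :=
    fun mg hg cA hA cB hB cD =>
      integrable_bdd_mul_compact mg hg (by fun_prop) (hκs hA hB)
  have cg : Continuous fun z : ℝ × ℝ => drift z.2 := cd.comp continuous_snd
  have cg' : Continuous fun z : ℝ × ℝ => 2 - 2 * z.2 := by fun_prop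
  have i₁ : Integrable I₁ := by
    have t1 := int ma ba' cψt hψt hκ.continuous hc one
    have t2 := int ma ba' (cψ.mul continuous_const) (hψ.compact.mul_right (f' := fun _ => l))
      ct hct one
    have t3 := int ma ba' (cg.mul cψx) hψx.mul_left hκ.continuous hc one
    have t4 := int ma ba' ((cg.mul cψ).mul continuous_const)
      ((hψ.compact.mul_left (f := fun z : ℝ × ℝ => drift z.2)).mul_right (f' := fun _ => l))
      cx hcx one
    have t5 := int mb bb cψx hψx hκ.continuous hc one
    have t6 := int mb bb (cψ.mul continuous_const) (hψ.compact.mul_right (f' := fun _ => l))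
      cx hcx one
    have t7 := int ms bs (cg'.mul cψ) hψ.compact.mul_left hκ.continuous hc one
    refine ((((((t1.add t2).add t3).add t4).sub t5).sub t6).sub t7).congr
      (Eventually.of_forall fun p => ?_)
    simp only [hI₁, Pi.add_apply, Pi.sub_apply, Pi.mul_apply]
    ring
  have i₂ : Integrable I₂ := by
    have t2 := int ma ba' (cψ.mul continuous_const) (hψ.compact.mul_right (f' := fun _ => l))
      ct hct one
    have t4 := int ma ba' (cψ.mul continuous_const) (hψ.compact.mul_right (f' := fun _ => l))
      cx hcx cg
    have t6 := int mb bb (cψ.mul continuous_const) (hψ.compact.mul_right (f' := fun _ => l))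
      cx hcx one
    have t7 := int ms' bs' cψ hψ.compact hκ.continuous hc cg'
    refine (((t6.sub t2).sub t4).sub t7).congr
      (Eventually.of_forall fun p => ?_)
    simp only [hI₂, Pi.sub_apply, Pi.mul_apply, abs_sub_comm (u' p.2) (u p.1)]
    ring
  have e₁ : 0 ≤ ∫ p, I₁ p := by
    rw [Measure.volume_eq_prod, integral_prod_symm _ i₁]
    refine integral_nonneg fun w => ?_
    have ht : IsTest T fun z => ψ z * κ (l • (z - w)) :=
      ⟨hψ.smooth.mul (hκ.comp (by fun_prop)), hψ.compact.mul_right,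
        (tsupport_mul_subset_left).trans hψ.support_subset⟩
    have := hu.entropy (u' w) _ ht fun z => mul_nonneg (h0 z) (kernel_nonneg 0 _)
    simp only [dt, dx, fderiv_mul_kernel hψ.smooth hκ] at this
    exact this
  have e₂ : 0 ≤ ∫ p, I₂ p := by
    rw [Measure.volume_eq_prod, integral_prod _ i₂]
    refine integral_nonneg fun z => ?_
    have ht : IsTest T fun w => ψ z * κ (l • (z - w)) := by
      have hsupp : Function.support (fun w => ψ z * κ (l • (z - w))) ⊆
          Metric.cthickening l⁻¹ (tsupport ψ) := by
        intro w hw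
        refine Metric.mem_cthickening_of_dist_le w z _ _
          (subset_tsupport ψ (left_ne_zero_of_mul hw)) ?_
        have h1 : l • (z - w) ∈ Function.support κ := right_ne_zero_of_mul hw
        rw [hκdef, kernel_support, mem_ball_zero_iff, norm_smul, Real.norm_eq_abs,
          abs_of_pos hl] at h1
        rw [dist_comm, dist_eq_norm]
        have h2 := h1.le.trans (radius_le_one 0)
        rw [← one_div, le_div_iff₀ hl]
        linarith
      exact ⟨contDiff_const.mul (hκ.comp (by fun_prop)),
        HasCompactSupport.of_support_subset_isCompact (IsCompact.cthickening hψ.compact) hsupp,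
        (closure_minimal hsupp Metric.isClosed_cthickening).trans hsub⟩
    have := hu'.entropy (u z) _ ht fun w => mul_nonneg (h0 z) (kernel_nonneg 0 _)
    simp only [dt, dx, fderiv_kernel_sub hκ] at this
    exact this
  have e₃ : 0 ≤ ∫ z, ∫ w, (I₁ (z, w) + I₂ (z, w)) := by
    have := integral_prod (μ := (volume : Measure (ℝ × ℝ))) (ν := (volume : Measure (ℝ × ℝ)))
      (fun p => I₁ p + I₂ p) (i₁.add i₂)
    rw [← this]
    have h2 := integral_add i₁ i₂
    rw [Measure.volume_eq_prod] at h2 e₁ e₂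
    rw [h2]
    exact add_nonneg e₁ e₂
  have e₄ : ∀ z, ∫ h, doubled u ψ l⁻¹ (u' (z - l⁻¹ • h)) z h
      = l ^ 2 * ∫ w, (I₁ (z, w) + I₂ (z, w)) := by
    intro z
    have h1 := Measure.integral_comp_inv_smul (volume : Measure (ℝ × ℝ))
      (fun w => I₁ (z, z - w) + I₂ (z, z - w)) l
    have h2 := integral_sub_left_eq_self (fun w => I₁ (z, w) + I₂ (z, w))
      (volume : Measure (ℝ × ℝ)) z
    rw [h2] at h1
    rw [Module.finrank_prod, Module.finrank_self, abs_of_nonneg (by positivity), smul_eq_mul] at h1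
    rw [← h1]
    refine integral_congr_ae (Eventually.of_forall fun h => ?_)
    have h3 : l • (z - (z - l⁻¹ • h)) = h := by
      simp [smul_smul, mul_inv_cancel₀ hl.ne']
    simp only [doubled, hI₁, hI₂, h3]
    rw [abs_sub_comm (u' (z - l⁻¹ • h)) (u z), ← neg_sub (u z) (u' (z - l⁻¹ • h)), Real.sign_neg,
      ← sign_mul_eq_abs]
    simp only [drift, Prod.snd_sub, Prod.smul_snd, smul_eq_mul]
    field_simp
    ring
  simp_rw [e₄]
  rw [integral_const_mul]
  exact mul_nonneg (by positivity) e₃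

/-- **Kato's inequality** for the difference of two solutions. In the doubled inequality the shift
of the second solution is removed by continuity of translations in `L¹`, and the scale tends to
zero. -/
theorem kato (hu : IsRep T M u) (hu' : IsRep T M u') (hψ : IsTest T ψ) (h0 : ∀ z, 0 ≤ ψ z) :
    0 ≤ ∫ z, (|u z - u' z| * dt ψ z
      + (drift z.2 * |u z - u' z| - |u z - u' z| * (u z + u' z)) * dx ψ z) := by
  have hκ := kernel_contDiff 0
  have hc := kernel_hasCompactSupport 0
  have cx : Continuous (dx (kernel 0)) :=
    (hκ.continuous_fderiv (by simp)).clm_apply continuous_const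
  have hcx : HasCompactSupport (dx (kernel 0)) :=
    (hc.fderiv (𝕜 := ℝ)).comp_left (g := fun L : ℝ × ℝ →L[ℝ] ℝ => L (0, 1)) rfl
  have cψt : Continuous (dt ψ) :=
    (hψ.smooth.continuous_fderiv (by simp)).clm_apply continuous_const
  have cψx : Continuous (dx ψ) :=
    (hψ.smooth.continuous_fderiv (by simp)).clm_apply continuous_const
  have hψt : HasCompactSupport (dt ψ) :=
    (hψ.compact.fderiv (𝕜 := ℝ)).comp_left (g := fun L : ℝ × ℝ →L[ℝ] ℝ => L (1, 0)) rfl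
  have hψx : HasCompactSupport (dx ψ) :=
    (hψ.compact.fderiv (𝕜 := ℝ)).comp_left (g := fun L : ℝ × ℝ →L[ℝ] ℝ => L (0, 1)) rfl
  have cψ := hψ.smooth.continuous
  have cd := continuous_drift
  have hM : 0 ≤ M := (hu.nonneg 0).trans (hu.le 0)
  set A₁ : ℝ × ℝ → ℝ := fun z => dt ψ z + drift z.2 * dx ψ z + (2 - 2 * z.2) * ψ z with hA₁
  set A₂ : ℝ × ℝ → ℝ := fun z => (2 - 2 * z.2) * ψ z with hA₂
  have cA₂ : Continuous A₂ := by fun_prop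
  have cA₁ : Continuous A₁ := by fun_prop
  have sA₂ : HasCompactSupport A₂ := hψ.compact.mul_left
  have sA₁ : HasCompactSupport A₁ := (hψt.add hψx.mul_left).add sA₂
  set κ := kernel 0 with hκdef
  set κ₂ : ℝ × ℝ → ℝ := fun h => h.2 * dx κ h with hκ₂
  set κ₃ : ℝ × ℝ → ℝ := fun h => h.2 * κ h with hκ₃
  set κ₄ : ℝ × ℝ → ℝ := fun h => h.2 ^ 2 * dx κ h with hκ₄
  have cκ := hκ.continuous
  have cκ₂ : Continuous κ₂ := by fun_prop
  have cκ₃ : Continuous κ₃ := by fun_prop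
  have cκ₄ : Continuous κ₄ := by fun_prop
  have sκ₂ : HasCompactSupport κ₂ := hcx.mul_left
  have sκ₃ : HasCompactSupport κ₃ := hc.mul_left
  have sκ₄ : HasCompactSupport κ₄ := hcx.mul_left
  -- `P` and `Q` bound the dependence of the doubled integrand on the shift and on the scale.
  set P : (ℝ × ℝ) × (ℝ × ℝ) → ℝ := fun p =>
    |A₁ p.1 * κ p.2| + |A₂ p.1 * κ₂ p.2| + 2 * M * |dx ψ p.1 * κ p.2| with hP
  set Q : (ℝ × ℝ) × (ℝ × ℝ) → ℝ := fun p =>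
    2 * M * |ψ p.1 * κ₃ p.2| + M * |ψ p.1 * κ₄ p.2| with hQ
  have cP : Continuous P := by fun_prop
  have cQ : Continuous Q := by fun_prop
  have sabs : ∀ {A B : ℝ × ℝ → ℝ}, HasCompactSupport A → HasCompactSupport B →
      HasCompactSupport fun p : (ℝ × ℝ) × (ℝ × ℝ) => |A p.1 * B p.2| := fun hA hB =>
    (hasCompactSupport_prod hA hB).comp_left (g := fun r : ℝ => |r|) abs_zero
  have sP : HasCompactSupport P :=
    ((sabs sA₁ hc).add (sabs sA₂ sκ₂)).add (sabs hψx hc).mul_left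
  have sQ : HasCompactSupport Q := (sabs hψ.compact sκ₃).mul_left.add (sabs hψ.compact sκ₄).mul_left
  have iQ : Integrable Q := cQ.integrable_of_hasCompactSupport sQ
  obtain ⟨C, hC⟩ := sP.exists_bound_of_continuous cP
  have hC0 : 0 ≤ C := (norm_nonneg _).trans (hC 0)
  have P_nonneg : ∀ p, 0 ≤ P p := fun p => by simp only [hP]; positivity
  have Pzero : ∀ p : (ℝ × ℝ) × (ℝ × ℝ), 1 < ‖p.2‖ → P p = 0 := by
    intro p hp
    have h1 : p.2 ∉ tsupport κ := by
      rw [hκdef, kernel_tsupport, mem_closedBall_zero_iff, not_le]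
      exact (radius_le_one 0).trans_lt hp
    have h2 : κ p.2 = 0 := image_eq_zero_of_notMem_tsupport h1
    have h3 : dx κ p.2 = 0 := by
      have h4 : p.2 ∉ tsupport (fderiv ℝ κ) := fun h3 => h1 (tsupport_fderiv_subset ℝ h3)
      rw [dx, image_eq_zero_of_notMem_tsupport h4]; rfl
    simp [hP, hκ₂, h2, h3]
  set V := volume.real (Metric.closedBall (0 : ℝ × ℝ) 1) with hV
  set J := ∫ z, (|u z - u' z| * dt ψ z
      + (drift z.2 * |u z - u' z| - |u z - u' z| * (u z + u' z)) * dx ψ z) with hJ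
  -- the doubled integrand at scale zero integrates to the right-hand side
  have hlim : ∀ z, ∫ h, doubled u ψ 0 (u' z) z h = |u z - u' z| * dt ψ z
      + (drift z.2 * |u z - u' z| - |u z - u' z| * (u z + u' z)) * dx ψ z := by
    intro z
    have i1 : Integrable κ := cκ.integrable_of_hasCompactSupport hc
    have i2 : Integrable κ₂ := cκ₂.integrable_of_hasCompactSupport sκ₂
    have e1 : ∀ h, doubled u ψ 0 (u' z) z h
        = (|u z - u' z| * A₁ z - |u z - u' z| * (u z + u' z) * dx ψ z) * κ h
          + |u z - u' z| * A₂ z * κ₂ h := by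
      intro h; simp only [doubled, hA₁, hA₂, hκ₂]; ring
    simp_rw [e1]
    rw [integral_add (i1.const_mul _) (i2.const_mul _), integral_const_mul, integral_const_mul,
      integral_kernel, integral_snd_mul_dx_kernel]
    simp only [hA₁, hA₂]
    ring
  suffices key : ∀ ε > 0, 0 ≤ J + ε * (C * V + ∫ p, Q p) by
    by_contra hneg
    push Not at hneg
    have hD : 0 ≤ C * V + ∫ p, Q p := by
      refine add_nonneg (mul_nonneg hC0 measureReal_nonneg) (integral_nonneg fun p => ?_)
      simp only [hQ]; positivity
    have := key (-J / (2 * (C * V + ∫ p, Q p) + 1)) (div_pos (by linarith) (by linarith))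
    rw [div_mul_eq_mul_div, ← neg_le_iff_add_nonneg', le_div_iff₀ (by linarith)] at this
    nlinarith
  intro ε hε
  -- The scale `l⁻¹` keeps the shifted test function in the domain, makes the translation error of
  -- `u'` at most `ε`, and is itself at most `ε`.
  obtain ⟨δ₁, δ₁pos, hδ₁⟩ :=
    IsCompact.exists_cthickening_subset_open hψ.compact (isOpen_domain T) hψ.support_subset
  obtain ⟨δ₂, δ₂pos, hδ₂⟩ := Metric.eventually_nhds_iff.1
    ((tendsto_integral_abs_translate_sub hu'.integrable).eventually (gt_mem_nhds hε))
  set l : ℝ := (min (min δ₁ (δ₂ / 2)) ε)⁻¹ with hl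
  have hlinv : l⁻¹ = min (min δ₁ (δ₂ / 2)) ε := inv_inv _
  have hlpos : 0 < l := by rw [hl]; positivity
  have hl1 : l⁻¹ ≤ δ₁ := hlinv ▸ (min_le_left _ _).trans (min_le_left _ _)
  have hl2 : l⁻¹ ≤ δ₂ / 2 := hlinv ▸ (min_le_left _ _).trans (min_le_right _ _)
  have hl3 : l⁻¹ ≤ ε := hlinv ▸ min_le_right _ _
  have main := integral_doubled_nonneg hu hu' hψ h0 hlpos
    ((Metric.cthickening_mono hl1 _).trans hδ₁)
  -- integrability on the product
  have mu : Measurable fun p : (ℝ × ℝ) × (ℝ × ℝ) => u p.1 := hu.meas.comp measurable_fst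
  have mw : Measurable fun p : (ℝ × ℝ) × (ℝ × ℝ) => u' p.1 := hu'.meas.comp measurable_fst
  have mv : Measurable fun p : (ℝ × ℝ) × (ℝ × ℝ) => u' (p.1 - l⁻¹ • p.2) :=
    hu'.meas.comp (by fun_prop)
  have inth : ∀ (e : ℝ) (v : (ℝ × ℝ) × (ℝ × ℝ) → ℝ), Measurable v → (∀ p, 0 ≤ v p) →
      (∀ p, v p ≤ M) → Integrable fun p : (ℝ × ℝ) × (ℝ × ℝ) => doubled u ψ e (v p) p.1 p.2 := by
    intro e v mv hv0 hvM
    have ma : Measurable fun p : (ℝ × ℝ) × (ℝ × ℝ) => |u p.1 - v p| := (mu.sub mv).abs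
    have ba : ∀ p : (ℝ × ℝ) × (ℝ × ℝ), |(|u p.1 - v p|)| ≤ M := fun p => by
      have := hu.nonneg p.1; have := hu.le p.1; have := hv0 p; have := hvM p
      rw [abs_abs, abs_le]; constructor <;> linarith
    have mb : Measurable fun p : (ℝ × ℝ) × (ℝ × ℝ) => |u p.1 - v p| * (u p.1 + v p) :=
      ma.mul (mu.add mv)
    have bb : ∀ p : (ℝ × ℝ) × (ℝ × ℝ), |(|u p.1 - v p| * (u p.1 + v p))| ≤ M * (2 * M) :=
      fun p => by
      have := hu.nonneg p.1; have := hu.le p.1; have := hv0 p; have := hvM p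
      rw [abs_mul]
      refine mul_le_mul (ba p) ?_ (abs_nonneg _) hM
      rw [abs_le]; constructor <;> linarith
    have ms : Measurable fun p : (ℝ × ℝ) × (ℝ × ℝ) => Real.sign (u p.1 - v p) * u p.1 :=
      (measurable_sign.comp (mu.sub mv)).mul mu
    have bs : ∀ p : (ℝ × ℝ) × (ℝ × ℝ), |Real.sign (u p.1 - v p) * u p.1| ≤ M := fun p => by
      have := hu.nonneg p.1; have := hu.le p.1
      rw [abs_mul]
      calc _ ≤ 1 * |u p.1| := by gcongr; exact abs_sign_le _
        _ ≤ M := by rw [abs_of_nonneg (by assumption)]; linarith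
    have t1 := integrable_bdd_mul_compact ma ba (P := fun p => A₁ p.1 * κ p.2) (by fun_prop)
      (hasCompactSupport_prod sA₁ hc)
    have t2 := integrable_bdd_mul_compact ma ba (P := fun p => A₂ p.1 * κ₂ p.2) (by fun_prop)
      (hasCompactSupport_prod sA₂ sκ₂)
    have t3 := integrable_bdd_mul_compact mb bb (P := fun p => dx ψ p.1 * κ p.2) (by fun_prop)
      (hasCompactSupport_prod hψx hc)
    have t4 := integrable_bdd_mul_compact ms bs (P := fun p => ψ p.1 * κ₃ p.2) (by fun_prop)
      (hasCompactSupport_prod hψ.compact sκ₃)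
    have t5 := integrable_bdd_mul_compact ma ba (P := fun p => ψ p.1 * κ₄ p.2) (by fun_prop)
      (hasCompactSupport_prod hψ.compact sκ₄)
    refine (((t1.add t2).sub t3).add (((t4.const_mul 2).add t5).const_mul e)).congr
      (Eventually.of_forall fun p => ?_)
    simp only [doubled, Pi.add_apply, Pi.sub_apply, hA₁, hA₂, hκ₂, hκ₃, hκ₄]
    ring
  have i1 := inth l⁻¹ _ mv (fun p => hu'.nonneg _) (fun p => hu'.le _)
  have i2 := inth 0 _ mw (fun p => hu'.nonneg _) (fun p => hu'.le _)
  set Δ : (ℝ × ℝ) × (ℝ × ℝ) → ℝ := fun p => |u' (p.1 - l⁻¹ • p.2) - u' p.1| with hΔ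
  have iΔ : Integrable fun p => Δ p * P p := by
    refine integrable_bdd_mul_compact (mv.sub mw).abs (c := M) (fun p => ?_) cP sP
    have := hu'.nonneg p.1; have := hu'.le p.1
    have := hu'.nonneg (p.1 - l⁻¹ • p.2); have := hu'.le (p.1 - l⁻¹ • p.2)
    rw [abs_abs, abs_le]; constructor <;> linarith
  rw [Measure.volume_eq_prod] at i1 i2 iΔ iQ
  have e1 := integral_prod _ i1
  have e2 := integral_prod _ i2
  simp only [hlim] at e2
  rw [← e1] at main
  have hpt : ∀ p : (ℝ × ℝ) × (ℝ × ℝ), doubled u ψ l⁻¹ (u' (p.1 - l⁻¹ • p.2)) p.1 p.2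
      ≤ doubled u ψ 0 (u' p.1) p.1 p.2 + Δ p * P p + ε * Q p := by
    intro p
    set v := u' (p.1 - l⁻¹ • p.2) with hv
    set w := u' p.1 with hw
    set a := u p.1 with ha
    have ha0 : 0 ≤ a := hu.nonneg _
    have haM : a ≤ M := hu.le _
    have hv0 : 0 ≤ v := hu'.nonneg _
    have hvM : v ≤ M := hu'.le _
    have hw0 : 0 ≤ w := hu'.nonneg _
    have hwM : w ≤ M := hu'.le _
    have hav : |a - v| ≤ M := by rw [abs_le]; constructor <;> linarith
    have d1 : |(|a - v| - |a - w|)| ≤ |v - w| := by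
      refine (abs_abs_sub_abs_le _ _).trans (le_of_eq ?_)
      rw [show a - v - (a - w) = -(v - w) by ring, abs_neg]
    have d2 : |(|a - v| * (a + v)) - |a - w| * (a + w)| ≤ |v - w| * (2 * M) :=
      abs_abs_sub_le_of_mem hv0 hvM hw0 hwM ha0
    have t1 : (|a - v| - |a - w|) * (A₁ p.1 * κ p.2) ≤ |v - w| * |A₁ p.1 * κ p.2| :=
      (le_abs_self _).trans (by rw [abs_mul]; gcongr)
    have t2 : (|a - v| - |a - w|) * (A₂ p.1 * κ₂ p.2) ≤ |v - w| * |A₂ p.1 * κ₂ p.2| :=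
      (le_abs_self _).trans (by rw [abs_mul]; gcongr)
    have t3 : -((|a - v| * (a + v) - |a - w| * (a + w)) * (dx ψ p.1 * κ p.2))
        ≤ |v - w| * (2 * M) * |dx ψ p.1 * κ p.2| :=
      (neg_le_abs _).trans (by rw [abs_mul]; gcongr)
    have t4 : (2 * Real.sign (a - v) * a) * (ψ p.1 * κ₃ p.2) ≤ 2 * M * |ψ p.1 * κ₃ p.2| := by
      refine (le_abs_self _).trans ?_
      rw [abs_mul]
      gcongr
      rw [abs_mul, abs_mul, abs_two, abs_of_nonneg ha0]
      have := abs_sign_le (a - v)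
      nlinarith [abs_nonneg (Real.sign (a - v))]
    have t5 : |a - v| * (ψ p.1 * κ₄ p.2) ≤ M * |ψ p.1 * κ₄ p.2| := by
      refine (le_abs_self _).trans ?_
      rw [abs_mul, abs_abs]
      gcongr
    have t6 : l⁻¹ * ((2 * Real.sign (a - v) * a) * (ψ p.1 * κ₃ p.2)
        + |a - v| * (ψ p.1 * κ₄ p.2)) ≤ ε * Q p := by
      have hQ0 : 0 ≤ Q p := by simp only [hQ]; positivity
      calc _ ≤ l⁻¹ * Q p := by
            refine mul_le_mul_of_nonneg_left (add_le_add t4 t5) (by positivity)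
        _ ≤ ε * Q p := by gcongr
    have e3 : doubled u ψ l⁻¹ v p.1 p.2 - doubled u ψ 0 w p.1 p.2 =
        (|a - v| - |a - w|) * (A₁ p.1 * κ p.2) + (|a - v| - |a - w|) * (A₂ p.1 * κ₂ p.2)
        + -((|a - v| * (a + v) - |a - w| * (a + w)) * (dx ψ p.1 * κ p.2))
        + l⁻¹ * ((2 * Real.sign (a - v) * a) * (ψ p.1 * κ₃ p.2)
        + |a - v| * (ψ p.1 * κ₄ p.2)) := by
      simp only [doubled, ← ha, hA₁, hA₂, hκ₂, hκ₃, hκ₄]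
      ring
    have e4 : Δ p * P p = |v - w| * |A₁ p.1 * κ p.2| + |v - w| * |A₂ p.1 * κ₂ p.2|
        + |v - w| * (2 * M) * |dx ψ p.1 * κ p.2| := by
      simp only [hΔ, hP, ← hv, ← hw]
      ring
    linarith
  have hΔP : ∫ p, Δ p * P p ∂(volume.prod volume) ≤ ε * (C * V) := by
    rw [integral_prod_symm _ iΔ]
    have hin : ∀ h : ℝ × ℝ, ∫ z, Δ (z, h) * P (z, h)
        ≤ (Metric.closedBall (0 : ℝ × ℝ) 1).indicator (fun _ => ε * C) h := by
      intro h
      by_cases hh : h ∈ Metric.closedBall (0 : ℝ × ℝ) 1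
      · rw [indicator_of_mem hh]
        have hh1 : ‖h‖ ≤ 1 := by simpa using hh
        have h5 := hδ₂ (y := l⁻¹ • h) (by
          rw [dist_zero_right, norm_smul, Real.norm_eq_abs, abs_of_pos (by positivity)]
          have : 0 < l⁻¹ := by positivity
          nlinarith)
        have iD : Integrable fun z => |u' (z - l⁻¹ • h) - u' z| :=
          ((hu'.integrable.comp_sub_right _).sub hu'.integrable).abs
        calc ∫ z, Δ (z, h) * P (z, h) ≤ ∫ z, |u' (z - l⁻¹ • h) - u' z| * C := by
              refine integral_mono_of_nonneg (Eventually.of_forall fun z =>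
                mul_nonneg (abs_nonneg _) (P_nonneg _)) (iD.mul_const C)
                (Eventually.of_forall fun z => ?_)
              exact mul_le_mul_of_nonneg_left ((le_abs_self _).trans (hC (z, h))) (abs_nonneg _)
          _ ≤ ε * C := by rw [integral_mul_const]; gcongr
      · rw [indicator_of_notMem hh]
        have hh1 : 1 < ‖h‖ := by simpa using hh
        simp [Pzero (_, h) hh1]
    calc ∫ h, ∫ z, Δ (z, h) * P (z, h)
        ≤ ∫ h, (Metric.closedBall (0 : ℝ × ℝ) 1).indicator (fun _ => ε * C) h := by
          refine integral_mono iΔ.integral_prod_right ?_ hin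
          exact (integrable_indicator_iff measurableSet_closedBall).2
            (integrableOn_const (isCompact_closedBall _ _).measure_lt_top.ne)
      _ = ε * (C * V) := by
          rw [integral_indicator measurableSet_closedBall, setIntegral_const, smul_eq_mul]
          ring
  have hfin := integral_mono i1 ((i2.add iΔ).add (iQ.const_mul ε)) hpt
  have hadd : ∫ p, (((fun p : (ℝ × ℝ) × (ℝ × ℝ) => doubled u ψ 0 (u' p.1) p.1 p.2)
      + (fun p => Δ p * P p)) + fun p => ε * Q p) p ∂(volume.prod volume)
      = J + ∫ p, Δ p * P p ∂(volume.prod volume) + ε * ∫ p, Q p ∂(volume.prod volume) := by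
    rw [integral_add' (i2.add iΔ) (iQ.const_mul ε), integral_add' i2 iΔ, e2, integral_const_mul]
  rw [hadd] at hfin
  rw [mul_add, ← add_assoc]
  rw [Measure.volume_eq_prod]
  linarith

end

/-! ### The potential of a solution -/

theorem abs_flux_le {M X x k : ℝ} (hk : 0 ≤ k) (hkM : k ≤ M) (hx : |x| ≤ X) :
    |flux x k| ≤ (2 * X + X ^ 2) * M + M ^ 2 := by
  have h2 : |drift x| ≤ 2 * X + X ^ 2 := by
    unfold drift
    refine (abs_sub _ _).trans ?_
    rw [abs_mul, abs_two, abs_pow]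
    have := pow_le_pow_left₀ (abs_nonneg x) hx 2
    linarith
  rw [flux_eq]
  refine (abs_sub _ _).trans ?_
  rw [abs_mul, abs_of_nonneg hk, abs_of_nonneg (sq_nonneg k)]
  gcongr
  exact (abs_nonneg _).trans h2

theorem locallyIntegrable_of_compactBounded {f : ℝ × ℝ → ℝ} (mf : Measurable f)
    (bf : CompactBounded f) : LocallyIntegrable f := by
  rw [locallyIntegrable_iff]
  intro K hK
  obtain ⟨c, hc⟩ := bf K hK
  exact Measure.integrableOn_of_bounded (M := c) hK.measure_lt_top.ne mf.aestronglyMeasurable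
    ((ae_restrict_iff' hK.measurableSet).2 (Eventually.of_forall hc))

theorem integrable_kernel_mul_of_locallyIntegrable (j : ℕ) {f : ℝ × ℝ → ℝ}
    (hf : LocallyIntegrable f) (z : ℝ × ℝ) : Integrable (fun w => kernel j w * f (z - w)) :=
  (kernel_hasCompactSupport j).convolutionExists_left (ContinuousLinearMap.lsmul ℝ ℝ)
    (kernel_contDiff j).continuous hf z

theorem abs_mol_le (j : ℕ) {f : ℝ × ℝ → ℝ} (hf : LocallyIntegrable f) {z : ℝ × ℝ} {c : ℝ}
    (h : ∀ w, ‖w‖ ≤ 1 → |f (z - w)| ≤ c) : |mol j f z| ≤ c := by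
  have hi := integrable_kernel_mul_of_locallyIntegrable j hf z
  have hb : ∀ w, ‖w‖ < radius j → |f (z - w)| ≤ c := fun w hw =>
    h w (hw.le.trans (radius_le_one j))
  rw [mol_apply, abs_le]
  exact ⟨le_integral_kernel_mul j hi (Eventually.of_forall fun w hw => (abs_le.1 (hb w hw)).1),
    integral_kernel_mul_le j hi (Eventually.of_forall fun w hw => (abs_le.1 (hb w hw)).2)⟩

theorem fderiv_mol_eq_integral (j : ℕ) {f : ℝ × ℝ → ℝ} (hf : LocallyIntegrable f)
    (z v : ℝ × ℝ) :
    fderiv ℝ (mol j f) z v = ∫ w, f w * fderiv ℝ (kernel j) (z - w) v := by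
  have h0 : mol j f = convolution f (kernel j) (ContinuousLinearMap.lsmul ℝ ℝ).flip volume :=
    (convolution_flip _).symm
  have hk : ContDiff ℝ 1 (kernel j) := (kernel_contDiff j).of_le (by simp)
  have h1 := (kernel_hasCompactSupport j).hasFDerivAt_convolution_right
    (ContinuousLinearMap.lsmul ℝ ℝ).flip hf hk z
  rw [h0, h1.fderiv, convolution_precompR_apply _ hf ((kernel_hasCompactSupport j).fderiv (𝕜 := ℝ))
    (hk.continuous_fderiv one_ne_zero), convolution_def]
  refine integral_congr_ae (Eventually.of_forall fun w => ?_)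
  simp [mul_comm]

section

variable {T M : ℝ} {u : ℝ × ℝ → ℝ}

theorem IsRep.compactBounded (hu : IsRep T M u) : CompactBounded u := fun _ _ =>
  ⟨M, fun z _ => by rw [abs_of_nonneg (hu.nonneg z)]; exact hu.le z⟩

theorem IsRep.locallyIntegrable (hu : IsRep T M u) : LocallyIntegrable u :=
  locallyIntegrable_of_compactBounded hu.meas hu.compactBounded

theorem IsRep.measurable_flux (hu : IsRep T M u) : Measurable fun z : ℝ × ℝ => flux z.2 (u z) := by
  simp only [flux_eq]
  exact ((continuous_drift.measurable.comp measurable_snd).mul hu.meas).sub (hu.meas.pow_const 2)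

theorem IsRep.compactBounded_flux (hu : IsRep T M u) :
    CompactBounded fun z : ℝ × ℝ => flux z.2 (u z) := fun K hK => by
  obtain ⟨X, hX⟩ := hK.exists_bound_of_continuousOn (f := fun z : ℝ × ℝ => z.2)
    continuous_snd.continuousOn
  exact ⟨_, fun z hz => abs_flux_le (hu.nonneg z) (hu.le z) (hX z hz)⟩

theorem IsRep.flux_locallyIntegrable (hu : IsRep T M u) :
    LocallyIntegrable fun z : ℝ × ℝ => flux z.2 (u z) :=
  locallyIntegrable_of_compactBounded hu.measurable_flux hu.compactBounded_flux

/-- Mollification turns a distributional inequality `∂ₜ A + ∂ₓ B ≤ 0` into a pointwise one, away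
from the boundary. -/
theorem fderiv_mol_add_nonpos {A B : ℝ × ℝ → ℝ} (lA : LocallyIntegrable A)
    (lB : LocallyIntegrable B)
    (h : ∀ φ, IsTest T φ → (∀ p, 0 ≤ φ p) → 0 ≤ ∫ z, (A z * dt φ z + B z * dx φ z))
    {j : ℕ} {z : ℝ × ℝ} (hz : Metric.closedBall z (radius j) ⊆ domain T) :
    fderiv ℝ (mol j A) z (1, 0) + fderiv ℝ (mol j B) z (0, 1) ≤ 0 := by
  have hk := kernel_contDiff j
  have hkc : Continuous (fderiv ℝ (kernel j)) := hk.continuous_fderiv (by simp)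
  have hd : ∀ w v, fderiv ℝ (fun w => kernel j (z - w)) w v = -fderiv ℝ (kernel j) (z - w) v := by
    intro w v
    have h2 := (hk.differentiable (by simp) (z - w)).hasFDerivAt
    have h4 := h2.comp w ((hasFDerivAt_id w).const_sub z)
    have h5 : fderiv ℝ (fun w => kernel j (z - w)) w = _ := h4.fderiv
    rw [h5]; simp
  have hsupp : Function.support (fun w => kernel j (z - w)) ⊆ Metric.closedBall z (radius j) := by
    intro w hw
    have h1 : z - w ∈ Function.support (kernel j) := hw
    rw [kernel_support, mem_ball_zero_iff] at h1
    rw [mem_closedBall_iff_norm']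
    exact h1.le
  have ht : IsTest T fun w => kernel j (z - w) :=
    ⟨hk.comp (by fun_prop),
      HasCompactSupport.of_support_subset_isCompact (isCompact_closedBall _ _) hsupp,
      (closure_minimal hsupp Metric.isClosed_closedBall).trans hz⟩
  have hw := h _ ht fun w => kernel_nonneg j _
  have hint : ∀ {g : ℝ × ℝ → ℝ} (v : ℝ × ℝ), LocallyIntegrable g →
      Integrable fun w => g w * fderiv ℝ (kernel j) (z - w) v := by
    intro g v hg
    have h1 : Continuous fun w => fderiv ℝ (kernel j) (z - w) v := by fun_prop
    have h2 : HasCompactSupport fun w => fderiv ℝ (kernel j) (z - w) v := by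
      refine HasCompactSupport.of_support_subset_isCompact (isCompact_closedBall z (radius j)) ?_
      intro w hw
      have h1 : z - w ∈ tsupport (kernel j) := by
        refine tsupport_fderiv_subset ℝ (subset_tsupport _ fun h3 => hw ?_)
        simp [h3]
      rw [kernel_tsupport, mem_closedBall_zero_iff] at h1
      rwa [mem_closedBall_iff_norm']
    exact hg.integrable_smul_left_of_hasCompactSupport h1 h2 |>.congr
      (Eventually.of_forall fun w => by simp [mul_comm])
  simp only [dt, dx, hd, mul_neg] at hw
  rw [fderiv_mol_eq_integral j lA, fderiv_mol_eq_integral j lB,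
    ← integral_add (hint _ lA) (hint _ lB), ← neg_nonneg, ← integral_neg]
  refine hw.trans_eq (integral_congr_ae (Eventually.of_forall fun w => ?_))
  simp only
  ring

/-- The integrated form of `∂ₜ A + ∂ₓ B ≤ 0` on a rectangle, for the mollified fields, by the
divergence theorem. -/
theorem eventually_mol_rectangle_le {A B : ℝ × ℝ → ℝ} (lA : LocallyIntegrable A)
    (lB : LocallyIntegrable B)
    (h : ∀ φ, IsTest T φ → (∀ p, 0 ≤ φ p) → 0 ≤ ∫ z, (A z * dt φ z + B z * dx φ z))
    {t s x y : ℝ} (ht : 0 < t) (hts : t ≤ s) (hs : s < T) (hx : 0 < x) (hxy : x ≤ y) :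
    ∀ᶠ j in atTop, (∫ r in x..y, mol j A (s, r)) - (∫ r in x..y, mol j A (t, r))
      + ((∫ r in t..s, mol j B (r, y)) - ∫ r in t..s, mol j B (r, x)) ≤ 0 := by
  set K : Set (ℝ × ℝ) := uIcc t s ×ˢ uIcc x y with hK
  have cK : IsCompact K := isCompact_uIcc.prod isCompact_uIcc
  have hKd : K ⊆ domain T := by
    rintro ⟨a, b⟩ ⟨ha, hb⟩
    rw [uIcc_of_le hts] at ha
    rw [uIcc_of_le hxy] at hb
    exact ⟨⟨ht.trans_le ha.1, ha.2.trans_lt hs⟩, hx.trans_le hb.1⟩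
  obtain ⟨δ, δpos, hδ⟩ := IsCompact.exists_cthickening_subset_open cK (isOpen_domain T) hKd
  filter_upwards [tendsto_radius.eventually (gt_mem_nhds δpos)] with j hj
  have h1 : ∀ z ∈ K, fderiv ℝ (mol j A) z (1, 0) + fderiv ℝ (mol j B) z (0, 1) ≤ 0 := fun z hz =>
    fderiv_mol_add_nonpos lA lB h ((Metric.closedBall_subset_cthickening hz _).trans
      ((Metric.cthickening_mono hj.le _).trans hδ))
  have c1 := mol_contDiff j lA
  have c2 := mol_contDiff j lB
  have c3 := c1.continuous_fderiv (by simp)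
  have c4 := c2.continuous_fderiv (by simp)
  have c5 : Continuous fun z => fderiv ℝ (mol j A) z (1, 0) + fderiv ℝ (mol j B) z (0, 1) := by
    fun_prop
  have h2 := integral2_divergence_prod_of_hasFDerivAt (mol j A) (mol j B)
    (fderiv ℝ (mol j A)) (fderiv ℝ (mol j B)) t x s y
    c1.continuous.continuousOn c2.continuous.continuousOn
    (fun z _ => mol_hasFDerivAt j lA z) (fun z _ => mol_hasFDerivAt j lB z)
    (c5.continuousOn.integrableOn_compact cK)
  have h3 : (∫ r in t..s, ∫ q in x..y, (fderiv ℝ (mol j A) (r, q) (1, 0)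
      + fderiv ℝ (mol j B) (r, q) (0, 1))) ≤ 0 := by
    rw [← neg_nonneg, ← intervalIntegral.integral_neg]
    refine intervalIntegral.integral_nonneg hts fun r hr => ?_
    rw [← intervalIntegral.integral_neg]
    refine intervalIntegral.integral_nonneg hxy fun q hq => ?_
    rw [← uIcc_of_le hts] at hr
    rw [← uIcc_of_le hxy] at hq
    exact neg_nonneg.2 (h1 (r, q) ⟨hr, hq⟩)
  rw [h2] at h3
  linarith

theorem ae_ae_swap {p : ℝ × ℝ → Prop} (h : ∀ᵐ z : ℝ × ℝ, p z) : ∀ᵐ x : ℝ, ∀ᵐ t : ℝ, p (t, x) := by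
  rw [Measure.volume_eq_prod] at h
  have h1 := (Measure.measurePreserving_swap (μ := (volume : Measure ℝ))
    (ν := (volume : Measure ℝ))).quasiMeasurePreserving.ae h
  exact Measure.ae_ae_of_ae_prod h1

theorem ae_mol_tendsto_left {f : ℝ × ℝ → ℝ} (lf : LocallyIntegrable f) :
    ∀ᵐ t, ∀ᵐ r, Tendsto (fun j => mol j f (t, r)) atTop (𝓝 (f (t, r))) := by
  have := mol_ae_tendsto lf
  rw [Measure.volume_eq_prod] at this
  exact Measure.ae_ae_of_ae_prod this

theorem ae_mol_tendsto_right {f : ℝ × ℝ → ℝ} (lf : LocallyIntegrable f) :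
    ∀ᵐ x, ∀ᵐ r, Tendsto (fun j => mol j f (r, x)) atTop (𝓝 (f (r, x))) :=
  ae_ae_swap (mol_ae_tendsto lf)

theorem tendsto_integral_mol {f : ℝ × ℝ → ℝ} (mf : Measurable f) (bf : CompactBounded f)
    {p : ℝ → ℝ × ℝ} (hp : Continuous p) {a b : ℝ}
    (h : ∀ᵐ r, Tendsto (fun j => mol j f (p r)) atTop (𝓝 (f (p r)))) :
    Tendsto (fun j => ∫ r in a..b, mol j f (p r)) atTop (𝓝 (∫ r in a..b, f (p r))) := by
  have lf := locallyIntegrable_of_compactBounded mf bf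
  obtain ⟨c, hc⟩ := bf (Metric.cthickening 1 (p '' uIcc a b))
    ((isCompact_uIcc.image hp).cthickening)
  refine intervalIntegral.tendsto_integral_filter_of_dominated_convergence (fun _ => c) ?_ ?_
    intervalIntegrable_const (h.mono fun r hr _ => hr)
  · exact Eventually.of_forall fun j =>
      ((mol_contDiff j lf).continuous.comp hp).aestronglyMeasurable
  · refine Eventually.of_forall fun j => Eventually.of_forall fun r hr => ?_
    refine abs_mol_le j lf fun w hw => hc _ ?_
    refine Metric.closedBall_subset_cthickening (mem_image_of_mem p (uIoc_subset_uIcc hr)) 1 ?_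
    simpa [mem_closedBall_iff_norm] using hw

/-- The integrated form of `∂ₜ A + ∂ₓ B ≤ 0` on almost every rectangle: each side lies on a line on
which the mollifications converge almost everywhere. -/
theorem rectangle_le {A B : ℝ × ℝ → ℝ} (mA : Measurable A) (mB : Measurable B)
    (bA : CompactBounded A) (bB : CompactBounded B)
    (h : ∀ φ, IsTest T φ → (∀ p, 0 ≤ φ p) → 0 ≤ ∫ z, (A z * dt φ z + B z * dx φ z))
    {t s x y : ℝ} (ht : 0 < t) (hts : t ≤ s) (hs : s < T) (hx : 0 < x) (hxy : x ≤ y)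
    (ht' : ∀ᵐ r, Tendsto (fun j => mol j A (t, r)) atTop (𝓝 (A (t, r))))
    (hs' : ∀ᵐ r, Tendsto (fun j => mol j A (s, r)) atTop (𝓝 (A (s, r))))
    (hx' : ∀ᵐ r, Tendsto (fun j => mol j B (r, x)) atTop (𝓝 (B (r, x))))
    (hy' : ∀ᵐ r, Tendsto (fun j => mol j B (r, y)) atTop (𝓝 (B (r, y)))) :
    (∫ r in x..y, A (s, r)) - (∫ r in x..y, A (t, r))
      + ((∫ r in t..s, B (r, y)) - ∫ r in t..s, B (r, x)) ≤ 0 := by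
  have c₁ : ∀ t : ℝ, Continuous fun r : ℝ => (t, r) := fun t => by fun_prop
  have c₂ : ∀ x : ℝ, Continuous fun r : ℝ => (r, x) := fun x => by fun_prop
  exact le_of_tendsto
    (((tendsto_integral_mol mA bA (c₁ s) hs').sub (tendsto_integral_mol mA bA (c₁ t) ht')).add
      ((tendsto_integral_mol mB bB (c₂ y) hy').sub (tendsto_integral_mol mB bB (c₂ x) hx')))
    (eventually_mol_rectangle_le (locallyIntegrable_of_compactBounded mA bA)
      (locallyIntegrable_of_compactBounded mB bB) h ht hts hs hx hxy)

/-- Conservation of mass on almost every rectangle. -/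
theorem IsRep.rectangle_eq (hu : IsRep T M u) {t s x y : ℝ} (ht : t ∈ Ioo 0 T) (hs : s ∈ Ioo 0 T)
    (hx : 0 < x) (hy : 0 < y)
    (ht' : ∀ᵐ r, Tendsto (fun j => mol j u (t, r)) atTop (𝓝 (u (t, r))))
    (hs' : ∀ᵐ r, Tendsto (fun j => mol j u (s, r)) atTop (𝓝 (u (s, r))))
    (hx' : ∀ᵐ r, Tendsto (fun j => mol j (fun z => flux z.2 (u z)) (r, x)) atTop
      (𝓝 (flux x (u (r, x)))))
    (hy' : ∀ᵐ r, Tendsto (fun j => mol j (fun z => flux z.2 (u z)) (r, y)) atTop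
      (𝓝 (flux y (u (r, y))))) :
    (∫ r in x..y, u (s, r)) - ∫ r in x..y, u (t, r)
      = -((∫ r in t..s, flux y (u (r, y))) - ∫ r in t..s, flux x (u (r, x))) := by
  have main : ∀ t ∈ Ioo 0 T, ∀ s ∈ Ioo 0 T, ∀ x > 0, ∀ y > 0, t ≤ s → x ≤ y →
      (∀ᵐ r, Tendsto (fun j => mol j u (t, r)) atTop (𝓝 (u (t, r)))) →
      (∀ᵐ r, Tendsto (fun j => mol j u (s, r)) atTop (𝓝 (u (s, r)))) →
      (∀ᵐ r, Tendsto (fun j => mol j (fun z => flux z.2 (u z)) (r, x)) atTop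
        (𝓝 (flux x (u (r, x))))) →
      (∀ᵐ r, Tendsto (fun j => mol j (fun z => flux z.2 (u z)) (r, y)) atTop
        (𝓝 (flux y (u (r, y))))) →
      (∫ r in x..y, u (s, r)) - ∫ r in x..y, u (t, r)
        = -((∫ r in t..s, flux y (u (r, y))) - ∫ r in t..s, flux x (u (r, x))) := by
    intro t ht s hs x hx y hy hts hxy ht' hs' hx' hy'
    have mneg : ∀ (f : ℝ × ℝ → ℝ) j z, mol j (fun z => -f z) z = -mol j f z := fun f j z => by
      simp only [mol_apply, mul_neg, integral_neg]
    have neg : ∀ {f : ℝ × ℝ → ℝ} {z}, Tendsto (fun j => mol j f z) atTop (𝓝 (f z)) →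
        Tendsto (fun j => mol j (fun z => -f z) z) atTop (𝓝 (-f z)) := fun h => by
      simpa only [mneg] using h.neg
    have bneg : ∀ {f : ℝ × ℝ → ℝ}, CompactBounded f → CompactBounded fun z => -f z :=
      fun h K hK => by simpa only [abs_neg] using h K hK
    have h1 := rectangle_le hu.meas hu.measurable_flux hu.compactBounded hu.compactBounded_flux
      (fun φ hφ _ => (hu.weak φ hφ).ge) ht.1 hts hs.2 hx hxy ht' hs' hx' hy'
    have h2 := rectangle_le hu.meas.neg hu.measurable_flux.neg (bneg hu.compactBounded)
      (bneg hu.compactBounded_flux) (fun φ hφ _ => by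
        have h3 := hu.weak φ hφ
        rw [← neg_eq_zero, ← integral_neg] at h3
        refine (h3.symm.trans (integral_congr_ae (Eventually.of_forall fun z => ?_))).le
        simp only [Pi.neg_apply]; ring) ht.1 hts hs.2 hx hxy (ht'.mono fun _ => neg)
      (hs'.mono fun _ => neg) (hx'.mono fun _ => neg) (hy'.mono fun _ => neg)
    simp only [Pi.neg_apply, intervalIntegral.integral_neg] at h2
    linarith
  rcases le_total t s with hts | hts <;> rcases le_total x y with hxy | hxy
  · exact main t ht s hs x hx y hy hts hxy ht' hs' hx' hy'
  · have := main t ht s hs y hy x hx hts hxy ht' hs' hy' hx'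
    rw [intervalIntegral.integral_symm y x, intervalIntegral.integral_symm y x]
    linarith
  · have := main s hs t ht x hx y hy hts hxy hs' ht' hx' hy'
    rw [intervalIntegral.integral_symm s t, intervalIntegral.integral_symm s t]
    linarith
  · have := main s hs t ht y hy x hx hts hxy hs' ht' hy' hx'
    rw [intervalIntegral.integral_symm y x, intervalIntegral.integral_symm y x,
      intervalIntegral.integral_symm s t, intervalIntegral.integral_symm s t]
    linarith

theorem norm_intervalIntegral_le_of_forall {f : ℝ → ℝ} {c : ℝ} (hf : ∀ r, |f r| ≤ c) (a b : ℝ) :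
    |∫ r in a..b, f r| ≤ c * |b - a| :=
  intervalIntegral.norm_integral_le_of_norm_le_const (f := f) (C := c) fun r _ => hf r

theorem intervalIntegrable_of_bound {f : ℝ → ℝ} (mf : Measurable f) {c : ℝ} (hf : ∀ r, |f r| ≤ c)
    (a b : ℝ) : IntervalIntegrable f volume a b := by
  refine (intervalIntegrable_const (c := c)).mono_fun mf.aestronglyMeasurable
    (Eventually.of_forall fun r => ?_)
  exact (hf r).trans (le_abs_self c)

theorem lipschitzWith_primitive {f : ℝ → ℝ} (mf : Measurable f) {c : NNReal}
    (hf : ∀ r, |f r| ≤ c) (a : ℝ) : LipschitzWith c fun x => ∫ r in a..x, f r := by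
  refine LipschitzWith.of_dist_le_mul fun x y => ?_
  rw [Real.dist_eq, Real.dist_eq, intervalIntegral.integral_interval_sub_left
    (intervalIntegrable_of_bound mf hf _ _) (intervalIntegrable_of_bound mf hf _ _)]
  exact norm_intervalIntegral_le_of_forall hf _ _

theorem mem_closure_inter_of_ae {p : ℝ → Prop} (hp : ∀ᵐ t, p t) {s : Set ℝ} (hs : IsOpen s)
    {t : ℝ} (ht : t ∈ s) : t ∈ closure (s ∩ {t | p t}) :=
  (Measure.dense_of_ae hp).open_subset_closure_inter hs ht

/-- A Lipschitz potential of `u` on `(0, T) × (0, X)`: a function with `∂ₓ U = u` and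
`∂ₜ U = -F(x, u)`, both in integrated form on almost every line parallel to an axis. -/
structure IsPotential (T X : ℝ) (u U : ℝ × ℝ → ℝ) (L : NNReal) : Prop where
  lip : LipschitzWith L U
  space : ∀ᵐ t, t ∈ Ioo 0 T → ∀ x ∈ Ioo 0 X, ∀ y ∈ Ioo 0 X,
    U (t, y) - U (t, x) = ∫ r in x..y, u (t, r)
  time : ∀ᵐ x, x ∈ Ioo 0 X → ∀ t ∈ Ioo 0 T, ∀ s ∈ Ioo 0 T,
    U (s, x) - U (t, x) = -∫ r in t..s, flux x (u (r, x))

/-- The potential is obtained by integrating `u dx - F(x, u) dt` along a good vertical line and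
then in `x`. Conservation of mass makes it Lipschitz on a dense set of good lines, from which it is
extended to the plane. -/
theorem IsRep.exists_potential (hu : IsRep T M u) (hT : 0 < T) {X : ℝ} (hX : 0 < X) :
    ∃ U L, IsPotential T X u U L := by
  set f : ℝ × ℝ → ℝ := fun z => flux z.2 (u z) with hf
  have hM : 0 ≤ M := (hu.nonneg 0).trans (hu.le 0)
  set c : ℝ := (2 * (X + 1) + (X + 1) ^ 2) * M + M ^ 2 with hc
  have hc0 : 0 ≤ c := by positivity
  have li := hu.locallyIntegrable
  have lf := hu.flux_locallyIntegrable
  have mf := hu.measurable_flux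
  have G := ae_mol_tendsto_left li
  have G' := ae_mol_tendsto_right lf
  have bu : ∀ z, |u z| ≤ M := fun z => by rw [abs_of_nonneg (hu.nonneg z)]; exact hu.le z
  have bf : ∀ x ∈ Ioo 0 X, ∀ r, |f (r, x)| ≤ c := fun x hx r =>
    abs_flux_le (hu.nonneg _) (hu.le _) (by rw [abs_of_pos hx.1]; linarith [hx.2])
  have rect : ∀ t ∈ Ioo 0 T, ∀ s ∈ Ioo 0 T, ∀ x ∈ Ioo 0 X, ∀ y ∈ Ioo 0 X,
      (∀ᵐ r, Tendsto (fun j => mol j u (t, r)) atTop (𝓝 (u (t, r)))) →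
      (∀ᵐ r, Tendsto (fun j => mol j u (s, r)) atTop (𝓝 (u (s, r)))) →
      (∀ᵐ r, Tendsto (fun j => mol j f (r, x)) atTop (𝓝 (f (r, x)))) →
      (∀ᵐ r, Tendsto (fun j => mol j f (r, y)) atTop (𝓝 (f (r, y)))) →
      (∫ r in x..y, u (s, r)) - ∫ r in x..y, u (t, r)
        = -((∫ r in t..s, f (r, y)) - ∫ r in t..s, f (r, x)) := by
    intro t ht s hs x hx y hy h1 h2 h3 h4
    exact hu.rectangle_eq ht hs hx.1 hy.1 h1 h2 h3 h4
  -- a line on which the flux may be integrated in time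
  obtain ⟨x₀, hx₀, gx₀⟩ : ∃ x₀ ∈ Ioo 0 X,
      ∀ᵐ r, Tendsto (fun j => mol j f (r, x₀)) atTop (𝓝 (f (r, x₀))) := by
    have h1 := mem_closure_inter_of_ae G' isOpen_Ioo (show X / 2 ∈ Ioo 0 X by
      constructor <;> linarith)
    obtain ⟨x₀, h2⟩ := closure_nonempty_iff.1 ⟨_, h1⟩
    exact ⟨x₀, h2.1, h2.2⟩
  set U₀ : ℝ × ℝ → ℝ := fun z => (∫ r in x₀..z.2, u (z.1, r)) - ∫ r in (0 : ℝ)..z.1, f (r, x₀)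
    with hU₀
  have mu_t : ∀ t, Measurable fun r => u (t, r) := fun t => hu.meas.comp measurable_prodMk_left
  have mfx : ∀ x, Measurable fun r => f (r, x) := fun x => mf.comp measurable_prodMk_right
  have iu : ∀ t a b, IntervalIntegrable (fun r => u (t, r)) volume a b := fun t a b =>
    intervalIntegrable_of_bound (mu_t t) (fun r => bu _) a b
  have if' : ∀ x ∈ Ioo 0 X, ∀ a b, IntervalIntegrable (fun r => f (r, x)) volume a b :=
    fun x hx a b => intervalIntegrable_of_bound (mfx x) (bf x hx) a b
  have lx : ∀ t, LipschitzWith M.toNNReal fun x => ∫ r in x₀..x, u (t, r) := fun t =>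
    lipschitzWith_primitive (mu_t t) (fun r => by rw [Real.coe_toNNReal M hM]; exact bu _) x₀
  have dU₀ : ∀ t ∈ Ioo 0 T, ∀ s ∈ Ioo 0 T, ∀ x ∈ Ioo 0 X,
      (∀ᵐ r, Tendsto (fun j => mol j u (t, r)) atTop (𝓝 (u (t, r)))) →
      (∀ᵐ r, Tendsto (fun j => mol j u (s, r)) atTop (𝓝 (u (s, r)))) →
      (∀ᵐ r, Tendsto (fun j => mol j f (r, x)) atTop (𝓝 (f (r, x)))) →
      U₀ (s, x) - U₀ (t, x) = -∫ r in t..s, f (r, x) := by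
    intro t ht s hs x hx h1 h2 h3
    have h4 := rect t ht s hs x₀ hx₀ x hx h1 h2 gx₀ h3
    have h5 := intervalIntegral.integral_interval_sub_left (if' x₀ hx₀ 0 s) (if' x₀ hx₀ 0 t)
    simp only [hU₀]
    linarith
  have dU₀' : ∀ t ∈ Ioo 0 T, ∀ s ∈ Ioo 0 T, ∀ x ∈ Ioo 0 X,
      (∀ᵐ r, Tendsto (fun j => mol j u (t, r)) atTop (𝓝 (u (t, r)))) →
      (∀ᵐ r, Tendsto (fun j => mol j u (s, r)) atTop (𝓝 (u (s, r)))) →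
      |U₀ (s, x) - U₀ (t, x)| ≤ c * |s - t| := by
    intro t ht s hs x hx h1 h2
    have hcl : IsClosed {x | |U₀ (s, x) - U₀ (t, x)| ≤ c * |s - t|} := by
      refine isClosed_le ?_ continuous_const
      have c1 := (lx s).continuous
      have c2 := (lx t).continuous
      simp only [hU₀]
      fun_prop
    refine closure_minimal (fun y hy => ?_) hcl (mem_closure_inter_of_ae G' isOpen_Ioo hx)
    rw [mem_ofPred_eq, dU₀ t ht s hs y hy.1 h1 h2 hy.2, abs_neg]
    exact norm_intervalIntegral_le_of_forall (bf y hy.1) t s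
  set S : Set (ℝ × ℝ) := {z | (z.1 ∈ Ioo 0 T ∧
    ∀ᵐ r, Tendsto (fun j => mol j u (z.1, r)) atTop (𝓝 (u (z.1, r)))) ∧ z.2 ∈ Ioo 0 X} with hS
  have hLip : LipschitzOnWith (Real.toNNReal (c + M)) U₀ S := by
    refine LipschitzOnWith.of_dist_le_mul fun z hz w hw => ?_
    rw [Real.coe_toNNReal _ (by linarith), Real.dist_eq]
    have h1 := dU₀' w.1 hw.1.1 z.1 hz.1.1 z.2 hz.2 hw.1.2 hz.1.2
    have h2 : |U₀ (w.1, z.2) - U₀ (w.1, w.2)| ≤ M * |z.2 - w.2| := by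
      have := (lx w.1).dist_le_mul z.2 w.2
      rw [Real.dist_eq, Real.dist_eq, Real.coe_toNNReal M hM] at this
      simpa only [hU₀, sub_sub_sub_cancel_right] using this
    have h3 : |z.1 - w.1| ≤ dist z w := by
      rw [← Real.dist_eq, Prod.dist_eq]; exact le_max_left _ _
    have h4 : |z.2 - w.2| ≤ dist z w := by
      rw [← Real.dist_eq, Prod.dist_eq]; exact le_max_right _ _
    calc |U₀ z - U₀ w| = |(U₀ (z.1, z.2) - U₀ (w.1, z.2)) + (U₀ (w.1, z.2) - U₀ (w.1, w.2))| := by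
          congr 1; simp
      _ ≤ c * |z.1 - w.1| + M * |z.2 - w.2| := (abs_add_le _ _).trans (add_le_add h1 h2)
      _ ≤ c * dist z w + M * dist z w := by gcongr
      _ = (c + M) * dist z w := by ring
  obtain ⟨U, hUL, hUe⟩ := hLip.extend_real
  refine ⟨U, _, ⟨hUL, ?_, ?_⟩⟩
  · filter_upwards [G] with t gt ht x hx y hy
    rw [← hUe (show (t, y) ∈ S from ⟨⟨ht, gt⟩, hy⟩), ← hUe (show (t, x) ∈ S from ⟨⟨ht, gt⟩, hx⟩)]
    simp only [hU₀, sub_sub_sub_cancel_right]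
    exact intervalIntegral.integral_interval_sub_left (iu t _ _) (iu t _ _)
  · filter_upwards [G'] with x gx hx
    have hcont : Continuous fun t => U (t, x) + ∫ r in (0 : ℝ)..t, f (r, x) := by
      refine (hUL.continuous.comp (by fun_prop)).add ?_
      exact (lipschitzWith_primitive (c := c.toNNReal) (mfx x) (fun r => by
        rw [Real.coe_toNNReal c hc0]; exact bf x hx r) 0).continuous
    obtain ⟨s₀, hs₀, gs₀⟩ := closure_nonempty_iff.1 ⟨_, mem_closure_inter_of_ae G isOpen_Ioo
      (show T / 2 ∈ Ioo 0 T by constructor <;> linarith)⟩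
    have key : ∀ t ∈ Ioo 0 T, U (t, x) + ∫ r in (0 : ℝ)..t, f (r, x)
        = U (s₀, x) + ∫ r in (0 : ℝ)..s₀, f (r, x) := by
      intro t ht
      refine closure_minimal (t := {t | U (t, x) + ∫ r in (0 : ℝ)..t, f (r, x)
        = U (s₀, x) + ∫ r in (0 : ℝ)..s₀, f (r, x)}) (fun s hs => ?_)
        (isClosed_eq hcont continuous_const) (mem_closure_inter_of_ae G isOpen_Ioo ht)
      have h1 := dU₀ s₀ hs₀ s hs.1 x hx gs₀ hs.2 gx
      rw [hUe (show (s, x) ∈ S from ⟨hs, hx⟩), hUe (show (s₀, x) ∈ S from ⟨⟨hs₀, gs₀⟩, hx⟩)] at h1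
      have h5 := intervalIntegral.integral_interval_sub_left (if' x hx 0 s) (if' x hx 0 s₀)
      rw [mem_ofPred_eq]
      linarith
    intro t ht s hs
    have h1 := key t ht
    have h2 := key s hs
    have h5 := intervalIntegral.integral_interval_sub_left (if' x hx 0 s) (if' x hx 0 t)
    change _ = -∫ r in t..s, f (r, x)
    linarith

end

/-! ### Derivatives of the potential -/

section

variable {T M X : ℝ} {u U : ℝ × ℝ → ℝ} {L : NNReal}

theorem IsRep.measurable_left (hu : IsRep T M u) (t : ℝ) : Measurable fun r => u (t, r) :=
  hu.meas.comp measurable_prodMk_left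

theorem IsRep.abs_apply_le (hu : IsRep T M u) (z : ℝ × ℝ) : |u z| ≤ M := by
  rw [abs_of_nonneg (hu.nonneg z)]; exact hu.le z

theorem IsRep.locallyIntegrable_left (hu : IsRep T M u) (t : ℝ) :
    LocallyIntegrable fun r => u (t, r) := by
  rw [locallyIntegrable_iff]
  intro K hK
  exact Measure.integrableOn_of_bounded (M := M) hK.measure_lt_top.ne
    (hu.measurable_left t).aestronglyMeasurable (Eventually.of_forall fun r => hu.abs_apply_le _)

theorem IsRep.measurable_flux_right (hu : IsRep T M u) (x : ℝ) :
    Measurable fun r => flux x (u (r, x)) := hu.measurable_flux.comp measurable_prodMk_right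

theorem IsRep.abs_flux_right_le (hu : IsRep T M u) (x r : ℝ) :
    |flux x (u (r, x))| ≤ (2 * |x| + |x| ^ 2) * M + M ^ 2 :=
  abs_flux_le (hu.nonneg _) (hu.le _) le_rfl

theorem IsRep.locallyIntegrable_flux_right (hu : IsRep T M u) (x : ℝ) :
    LocallyIntegrable fun r => flux x (u (r, x)) := by
  rw [locallyIntegrable_iff]
  intro K hK
  exact Measure.integrableOn_of_bounded hK.measure_lt_top.ne
    (hu.measurable_flux_right x).aestronglyMeasurable
    (Eventually.of_forall fun r => hu.abs_flux_right_le x r)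

/-- At almost every time, the potential is differentiable in space almost everywhere. -/
theorem IsPotential.ae_hasDerivAt_space (hU : IsPotential T X u U L) (hu : IsRep T M u) :
    ∀ᵐ t, t ∈ Ioo 0 T → ∀ᵐ x, x ∈ Ioo 0 X → HasDerivAt (fun y => U (t, y)) (u (t, x)) x := by
  filter_upwards [hU.space] with t h1 ht
  filter_upwards [
    _root_.LocallyIntegrable.ae_hasDerivAt_integral (hu.locallyIntegrable_left t)] with x h2 hx
  refine ((h2 x).const_add (U (t, x))).congr_of_eventuallyEq ?_
  filter_upwards [isOpen_Ioo.mem_nhds hx] with y hy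
  rw [← h1 ht x hx y hy]
  ring

theorem IsPotential.ae_hasDerivAt_time (hU : IsPotential T X u U L) (hu : IsRep T M u) :
    ∀ᵐ x, x ∈ Ioo 0 X → ∀ᵐ t, t ∈ Ioo 0 T →
      HasDerivAt (fun s => U (s, x)) (-flux x (u (t, x))) t := by
  filter_upwards [hU.time] with x h1 hx
  filter_upwards [
    _root_.LocallyIntegrable.ae_hasDerivAt_integral (hu.locallyIntegrable_flux_right x)]
    with t h2 ht
  refine ((h2 t).neg.const_add (U (t, x))).congr_of_eventuallyEq ?_
  filter_upwards [isOpen_Ioo.mem_nhds ht] with s hs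
  rw [Pi.neg_apply, ← h1 hx t ht s hs]
  ring

theorem lineDeriv_snd_eq {U : ℝ × ℝ → ℝ} {t x d : ℝ} (h : HasDerivAt (fun y => U (t, y)) d x) :
    lineDeriv ℝ U (t, x) (0, 1) = d := by
  have h1 : HasDerivAt (fun s : ℝ => U (t, x + s)) d 0 := by
    have := HasDerivAt.comp_const_add (a := x) (x := (0 : ℝ)) (f := fun y => U (t, y)) (f' := d)
      (by simpa using h)
    exact this
  have h2 : HasLineDerivAt ℝ U d (t, x) (0, 1) := by
    unfold HasLineDerivAt
    simpa using h1
  exact h2.lineDeriv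

theorem lineDeriv_fst_eq {U : ℝ × ℝ → ℝ} {t x d : ℝ} (h : HasDerivAt (fun s => U (s, x)) d t) :
    lineDeriv ℝ U (t, x) (1, 0) = d := by
  have h1 : HasDerivAt (fun s : ℝ => U (t + s, x)) d 0 := by
    have := HasDerivAt.comp_const_add (a := t) (x := (0 : ℝ)) (f := fun y => U (y, x)) (f' := d)
      (by simpa using h)
    exact this
  have h2 : HasLineDerivAt ℝ U d (t, x) (1, 0) := by
    unfold HasLineDerivAt
    simpa using h1
  exact h2.lineDeriv

theorem IsPotential.ae_lineDeriv_space (hU : IsPotential T X u U L) (hu : IsRep T M u) :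
    ∀ᵐ z : ℝ × ℝ, z ∈ Ioo 0 T ×ˢ Ioo 0 X → lineDeriv ℝ U z (0, 1) = u z := by
  have mD : MeasurableSet {z : ℝ × ℝ | z ∈ Ioo 0 T ×ˢ Ioo 0 X → lineDeriv ℝ U z (0, 1) = u z} := by
    have h1 : MeasurableSet {z : ℝ × ℝ | lineDeriv ℝ U z (0, 1) = u z} :=
      measurableSet_eq_fun (measurable_lineDeriv hU.lip.continuous) hu.meas
    have h2 : MeasurableSet (Ioo 0 T ×ˢ Ioo 0 X : Set (ℝ × ℝ)) :=
      measurableSet_Ioo.prod measurableSet_Ioo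
    exact h2.himp h1
  rw [Measure.volume_eq_prod, Measure.ae_prod_iff_ae_ae mD]
  filter_upwards [hU.ae_hasDerivAt_space hu] with t h1
  by_cases ht : t ∈ Ioo 0 T
  · filter_upwards [h1 ht] with x h2 hx
    exact lineDeriv_snd_eq (h2 hx.2)
  · exact Eventually.of_forall fun x hx => absurd hx.1 ht

theorem IsPotential.ae_lineDeriv_time (hU : IsPotential T X u U L) (hu : IsRep T M u) :
    ∀ᵐ z : ℝ × ℝ, z ∈ Ioo 0 T ×ˢ Ioo 0 X → lineDeriv ℝ U z (1, 0) = -flux z.2 (u z) := by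
  have mD : MeasurableSet {z : ℝ × ℝ | z ∈ Ioo 0 T ×ˢ Ioo 0 X →
      lineDeriv ℝ U z (1, 0) = -flux z.2 (u z)} := by
    have h1 : MeasurableSet {z : ℝ × ℝ | lineDeriv ℝ U z (1, 0) = -flux z.2 (u z)} :=
      measurableSet_eq_fun (measurable_lineDeriv hU.lip.continuous) hu.measurable_flux.neg
    have h2 : MeasurableSet (Ioo 0 T ×ˢ Ioo 0 X : Set (ℝ × ℝ)) :=
      measurableSet_Ioo.prod measurableSet_Ioo
    exact h2.himp h1
  rw [Measure.volume_eq_prod]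
  have hsw : ∀ᵐ z : ℝ × ℝ ∂(volume.prod volume), z.swap ∈ Ioo 0 T ×ˢ Ioo 0 X →
      lineDeriv ℝ U z.swap (1, 0) = -flux z.swap.2 (u z.swap) := by
    refine (Measure.ae_prod_iff_ae_ae (p := fun z : ℝ × ℝ => z.swap ∈ Ioo 0 T ×ˢ Ioo 0 X →
      lineDeriv ℝ U z.swap (1, 0) = -flux z.swap.2 (u z.swap)) (measurable_swap mD)).2 ?_
    filter_upwards [hU.ae_hasDerivAt_time hu] with x h1
    by_cases hx : x ∈ Ioo 0 X
    · filter_upwards [h1 hx] with t h2 ht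
      exact lineDeriv_fst_eq (h2 ht.1)
    · exact Eventually.of_forall fun t ht => absurd ht.2 hx
  have h3 := (Measure.measurePreserving_swap (μ := (volume : Measure ℝ))
      (ν := (volume : Measure ℝ))).quasiMeasurePreserving.ae hsw
  filter_upwards [h3] with z hz
  simpa using hz

/-! ### The potential is a viscosity subsolution -/

theorem integrable_mul_lineDeriv {A Θ : ℝ × ℝ → ℝ} (mA : Measurable A) (bA : CompactBounded A)
    (hL : LipschitzWith L Θ) (hc : HasCompactSupport Θ) (v : ℝ × ℝ) :
    Integrable fun z => A z * lineDeriv ℝ Θ z v := by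
  obtain ⟨a, ha⟩ := bA _ hc.isCompact
  have hK : MeasurableSet (tsupport Θ) := (isClosed_tsupport Θ).measurableSet
  refine Integrable.mono' (g := (tsupport Θ).indicator fun _ => a * (L * ‖v‖)) ?_ ?_ ?_
  · exact (integrable_indicator_iff hK).2 (integrableOn_const hc.isCompact.measure_lt_top.ne)
  · exact (mA.mul (measurable_lineDeriv hL.continuous)).aestronglyMeasurable
  · refine Eventually.of_forall fun z => ?_
    by_cases hz : z ∈ tsupport Θ
    · rw [indicator_of_mem hz, norm_mul]
      exact mul_le_mul (ha z hz) (norm_lineDeriv_le_of_lipschitz ℝ hL) (norm_nonneg _)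
        ((abs_nonneg _).trans (ha z hz))
    · rw [indicator_of_notMem hz, lineDeriv_eq_zero_of_notMem_tsupport hz]
      simp

theorem integrable_mul_of_hasCompactSupport {A Θ : ℝ × ℝ → ℝ} (mA : Measurable A)
    (bA : CompactBounded A) (hΘ : Continuous Θ) (hc : HasCompactSupport Θ) :
    Integrable fun z => A z * Θ z := by
  refine ((locallyIntegrable_of_compactBounded mA bA).integrable_smul_left_of_hasCompactSupport
    hΘ hc).congr (Eventually.of_forall fun z => ?_)
  simp [mul_comm]

theorem lineDeriv_eq_zero_of_nonneg {Θ : ℝ × ℝ → ℝ} (h0 : ∀ z, 0 ≤ Θ z) {z : ℝ × ℝ}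
    (hz : Θ z = 0) (v : ℝ × ℝ) : lineDeriv ℝ Θ z v = 0 := by
  refine IsLocalMin.deriv_eq_zero (Eventually.of_forall fun s => ?_)
  simpa [hz] using h0 _

theorem integral_lineDeriv_eq_zero {Θ : ℝ × ℝ → ℝ} (hL : LipschitzWith L Θ)
    (hc : HasCompactSupport Θ) (v : ℝ × ℝ) : ∫ z, lineDeriv ℝ Θ z v = 0 := by
  have h := LipschitzWith.integral_lineDeriv_mul_eq (μ := (volume : Measure (ℝ × ℝ)))
    (LipschitzWith.const (1 : ℝ)) hL hc (-v)
  simp only [neg_neg, mul_one] at h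
  rw [← h]
  simp [lineDeriv]

/-- The pointwise estimate of the integrand in the Kruzkov inequality of level `k`, with
`w = u - k`, `Fk = F(x, k)`, `F(x, u) = Fk + w d`, and with `q₁`, `q₂` the derivatives of the
penalty. The term with the factor `m` is a multiple of `∂ₜ Θ`, whose integral vanishes. -/
theorem subsolution_pointwise_bound {m ρ η Λ d w Fk b q₁ q₂ e : ℝ} (hd : |d| ≤ Λ)
    (h₁ : |q₁| ≤ 2 * η) (h₂ : |q₂| ≤ 2 * η) (hη : 0 < η) (hΛ : 2 * η * (1 + Λ) = ρ) (hm : 0 < m)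
    (hmΛ : m * Λ ≤ 2 * ρ) (he : e ≤ m * ρ) (hF : 3 * ρ ≤ b + Fk) :
    (|w| * (-(Fk + w * d) - b - q₁) + |w| * d * (w - q₂) + e) + m * (-(Fk + w * d) - b - q₁)
      ≤ -(m * ρ) := by
  have a0 : 0 ≤ |w| := abs_nonneg w
  have Λ0 : 0 ≤ Λ := (abs_nonneg d).trans hd
  set a := |w| with ha
  have n2 : -(a * q₁) ≤ a * (2 * η) := by
    have := mul_le_mul_of_nonneg_left (neg_le_of_abs_le h₁) a0
    linarith
  have n3 : -(a * d * q₂) ≤ a * (Λ * (2 * η)) := by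
    have h1 : |d * q₂| ≤ Λ * (2 * η) := by
      rw [abs_mul]; exact mul_le_mul hd h₂ (abs_nonneg _) Λ0
    have := mul_le_mul_of_nonneg_left (neg_le_of_abs_le h1) a0
    linarith
  have n4 : -(w * d) ≤ a * Λ := by
    refine (neg_le_abs _).trans ?_
    rw [abs_mul]; exact mul_le_mul_of_nonneg_left hd a0
  have n6 : -q₁ ≤ ρ := by
    have h3 := neg_le_of_abs_le h₁
    have h4 := mul_nonneg hη.le Λ0
    linarith
  have n7 : a * (2 * η) + a * (Λ * (2 * η)) = a * ρ := by rw [← hΛ]; ring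
  have n8 : m * (-(Fk + w * d) - b - q₁) ≤ m * (a * Λ - 2 * ρ) :=
    mul_le_mul_of_nonneg_left (by linarith) hm.le
  have n9 : a * (m * Λ) ≤ a * (2 * ρ) := mul_le_mul_of_nonneg_left hmΛ a0
  have n10 : a * (3 * ρ) ≤ a * (b + Fk) := mul_le_mul_of_nonneg_left hF a0
  have n11 : a * (-(Fk + w * d) - b - q₁) + a * d * (w - q₂)
      = -(a * (b + Fk)) + -(a * q₁) + -(a * d * q₂) := by ring
  linarith

set_option maxHeartbeats 1000000 in
/-- A potential of an entropy solution is a viscosity subsolution of the Hamilton-Jacobi equation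
`∂ₜ U + F(x, ∂ₓ U) = 0`: the inequality `b + F(x, k) ≤ 0` holds for every super-differential
`(b, k)`. If it failed at `z₁`, a small truncation `Θ` of `U` minus a steepened tangent cone would
be an admissible test function in the Kruzkov inequality of level `k`; since `∂ₓ Θ` and `∂ₜ Θ` are
`u - k` and `-F(x, u) - b` up to small errors, the terms with `F(x, u)` cancel and the integrand is
negative. -/
theorem IsPotential.add_flux_nonpos (hU : IsPotential T X u U L) (hu : IsRep T M u)
    {z₁ : ℝ × ℝ} (hz₁ : z₁ ∈ Ioo 0 T ×ˢ Ioo 0 X) {b k : ℝ}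
    (h : ∀ η > 0, ∀ᶠ z in 𝓝 z₁,
      U z ≤ U z₁ + b * (z.1 - z₁.1) + k * (z.2 - z₁.2) + η * ‖z - z₁‖) :
    b + flux z₁.2 k ≤ 0 := by
  by_contra hneg
  push Not at hneg
  set ρ : ℝ := (b + flux z₁.2 k) / 4 with hρ
  have ρpos : 0 < ρ := by positivity
  have hM : 0 ≤ M := (hu.nonneg 0).trans (hu.le 0)
  have hX : 0 < X := hz₁.2.1.trans hz₁.2.2
  set Λ : ℝ := 2 * X + X ^ 2 + M + |k| with hΛ
  have Λ0 : 0 ≤ Λ := by positivity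
  set η : ℝ := ρ / (2 * (1 + Λ)) with hη
  have ηpos : 0 < η := by positivity
  have hηe : 2 * η * (1 + Λ) = ρ := by rw [hη]; field_simp
  have hηρ : 2 * η ≤ ρ := by nlinarith [mul_nonneg ηpos.le Λ0]
  -- the radius of the neighbourhood
  have hnb : ∀ᶠ z in 𝓝 z₁, (U z ≤ U z₁ + b * (z.1 - z₁.1) + k * (z.2 - z₁.2) + η * ‖z - z₁‖)
      ∧ z ∈ Ioo 0 T ×ˢ Ioo 0 X ∧ 3 * ρ < b + flux z.2 k := by
    have c : Continuous fun z : ℝ × ℝ => b + flux z.2 k := by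
      unfold flux; fun_prop
    filter_upwards [h η ηpos, (isOpen_Ioo.prod isOpen_Ioo).mem_nhds hz₁,
      c.continuousAt.eventually (lt_mem_nhds (show 3 * ρ < b + flux z₁.2 k by
        rw [hρ]; linarith))] with z h1 h2 h3
    exact ⟨h1, h2, h3⟩
  obtain ⟨s, spos, hs⟩ := Metric.eventually_nhds_iff.1 hnb
  simp only [dist_eq_norm] at hs
  set D : ℝ × ℝ → ℝ := fun z => U z - (U z₁ + b * (z.1 - z₁.1) + k * (z.2 - z₁.2)) with hD
  set aff : ℝ × ℝ → ℝ := fun z => U z₁ + b * (z.1 - z₁.1) + k * (z.2 - z₁.2) with haff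
  have affLip : LipschitzWith (Real.toNNReal (|b| + |k|)) aff := by
    refine LipschitzWith.of_dist_le_mul fun z w => ?_
    rw [Real.coe_toNNReal _ (by positivity), Real.dist_eq, haff]
    have h3 : |z.1 - w.1| ≤ dist z w := by
      rw [← Real.dist_eq, Prod.dist_eq]; exact le_max_left _ _
    have h4 : |z.2 - w.2| ≤ dist z w := by
      rw [← Real.dist_eq, Prod.dist_eq]; exact le_max_right _ _
    calc _ = |b * (z.1 - w.1) + k * (z.2 - w.2)| := by congr 1; simp only; ring
      _ ≤ |b| * |z.1 - w.1| + |k| * |z.2 - w.2| := by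
        refine (abs_add_le _ _).trans ?_
        rw [abs_mul, abs_mul]
      _ ≤ |b| * dist z w + |k| * dist z w := by gcongr
      _ = _ := by ring
  have DLip : LipschitzWith (L + Real.toNNReal (|b| + |k|)) D := hU.lip.sub affLip
  set L' : NNReal := L + Real.toNNReal (|b| + |k|) with hL'
  have NLip : LipschitzWith 1 fun z : ℝ × ℝ => ‖z - z₁‖ := by
    refine LipschitzWith.of_dist_le_mul fun z w => ?_
    rw [NNReal.coe_one, one_mul, Real.dist_eq, dist_eq_norm]
    simpa using abs_norm_sub_norm_le (z - z₁) (w - z₁)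
  -- The penalty is a cone near `z₁`, and steep enough outside to dominate `D` everywhere.
  set p : ℝ × ℝ → ℝ := fun z => 2 * η * ‖z - z₁‖ + 2 * L' * max (‖z - z₁‖ - s / 2) 0 with hp
  have pLip : ∃ P, LipschitzWith P p := by
    have l1 : LipschitzWith _ fun z : ℝ × ℝ => (2 * η) • ‖z - z₁‖ :=
      (lipschitzWith_smul (2 * η)).comp NLip
    have l2 : LipschitzWith _ fun z : ℝ × ℝ => (2 * (L' : ℝ)) • max (‖z - z₁‖ - s / 2) 0 :=
      (lipschitzWith_smul (2 * (L' : ℝ))).comp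
        ((NLip.sub (LipschitzWith.const (s / 2))).max_const 0)
    exact ⟨_, l1.add l2⟩
  obtain ⟨P, pLip⟩ := pLip
  -- the weight `m` of `∂ₜ Θ`, and the height `c` of the truncation
  set C₀ : ℝ := (2 + 2 * X) * |k| with hC₀
  have C₀0 : 0 ≤ C₀ := by positivity
  set m : ℝ := 2 * ρ / (Λ + 1) with hm
  have mpos : 0 < m := by positivity
  set c : ℝ := min (η * s / 4) (m * ρ / (C₀ + 1)) with hc
  have cpos : 0 < c := by positivity
  have hcs : c ≤ η * s / 4 := min_le_left _ _
  have hcC : C₀ * c ≤ m * ρ := by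
    have h1 : c ≤ m * ρ / (C₀ + 1) := min_le_right _ _
    rw [le_div_iff₀ (by positivity)] at h1
    nlinarith
  set Θ : ℝ × ℝ → ℝ := fun z => max (D z - p z + c) 0 with hΘ
  have ΨLip : LipschitzWith (L' + P + 0) fun z => D z - p z + c :=
    (DLip.sub pLip).add (LipschitzWith.const c)
  have ΘLip : LipschitzWith (L' + P + 0) Θ := ΨLip.max_const 0
  have Θ0 : ∀ z, 0 ≤ Θ z := fun z => le_max_right _ _
  have hDz₁ : D z₁ = 0 := by simp [hD]
  have hpz₁ : p z₁ = 0 := by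
    simp only [hp, sub_self, norm_zero, mul_zero, zero_add]
    rw [max_eq_right (by linarith), mul_zero]
  have hpN : ∀ z, 2 * η * ‖z - z₁‖ ≤ p z := fun z => by
    have : 0 ≤ 2 * L' * max (‖z - z₁‖ - s / 2) 0 := by positivity
    simp only [hp]; linarith
  have hDη : ∀ z, ‖z - z₁‖ < s → D z ≤ η * ‖z - z₁‖ := fun z hz => by
    have := (hs hz).1
    simp only [hD]; linarith
  have hpos : ∀ z, 0 < Θ z → ‖z - z₁‖ < s / 4 ∧ Θ z ≤ c := by
    intro z hz
    have hz' : 0 < D z - p z + c := by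
      rcases lt_max_iff.1 hz with h1 | h1
      · exact h1
      · exact absurd h1 (lt_irrefl _)
    have hzs : ‖z - z₁‖ < s := by
      by_contra h1
      push Not at h1
      have h2 : D z ≤ L' * ‖z - z₁‖ := by
        have := DLip.dist_le_mul z z₁
        rw [Real.dist_eq, hDz₁, sub_zero, dist_eq_norm] at this
        exact (le_abs_self _).trans this
      have h3 : 2 * L' * (‖z - z₁‖ - s / 2) ≤ 2 * L' * max (‖z - z₁‖ - s / 2) 0 := by
        gcongr; exact le_max_left _ _
      have h4 : D z - p z + c ≤ L' * (s - ‖z - z₁‖) - 2 * η * ‖z - z₁‖ + c := by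
        simp only [hp]; linarith
      have h5 : (L' : ℝ) * (s - ‖z - z₁‖) ≤ 0 :=
        mul_nonpos_of_nonneg_of_nonpos L'.2 (by linarith)
      nlinarith
    have h1 := hDη z hzs
    have h2 := hpN z
    constructor
    · by_contra h3
      push Not at h3
      nlinarith
    · refine max_le ?_ cpos.le
      nlinarith [norm_nonneg (z - z₁)]
  have hsupp : Function.support Θ ⊆ Metric.closedBall z₁ (s / 4) := fun z hz => by
    rw [mem_closedBall_iff_norm]
    exact (hpos z (lt_of_le_of_ne (Θ0 z) (Ne.symm hz))).1.le
  have htsupp : tsupport Θ ⊆ Metric.closedBall z₁ (s / 4) :=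
    closure_minimal hsupp Metric.isClosed_closedBall
  have Θc : HasCompactSupport Θ :=
    HasCompactSupport.of_support_subset_isCompact (isCompact_closedBall _ _) hsupp
  have Θd : tsupport Θ ⊆ domain T := fun z hz => by
    have h1 := htsupp hz
    rw [mem_closedBall_iff_norm] at h1
    have h2 := (hs (show ‖z - z₁‖ < s by linarith)).2.1
    exact ⟨h2.1, h2.2.1⟩
  -- the Kruzkov inequality
  set A : ℝ × ℝ → ℝ := fun z => |u z - k| with hA
  set B : ℝ × ℝ → ℝ := fun z => |u z - k| * (drift z.2 - u z - k) with hB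
  set C : ℝ × ℝ → ℝ := fun z => -(Real.sign (u z - k) * ((2 - 2 * z.2) * k)) with hC
  have mA : Measurable A := (hu.meas.sub_const k).abs
  have mB : Measurable B :=
    mA.mul (((continuous_drift.measurable.comp measurable_snd).sub hu.meas).sub_const k)
  have mC : Measurable C := ((measurable_sign.comp (hu.meas.sub_const k)).mul
    ((measurable_const.sub (measurable_snd.const_mul 2)).mul_const k)).neg
  have bA' : ∀ z, |A z| ≤ M + |k| := fun z => by
    rw [hA, abs_abs]
    exact (abs_sub _ _).trans (add_le_add (hu.abs_apply_le z) le_rfl)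
  have bA : CompactBounded A := fun K _ => ⟨_, fun z _ => bA' z⟩
  have bB : CompactBounded B := fun K hK => by
    obtain ⟨d, hd⟩ := hK.exists_bound_of_continuousOn (f := fun z : ℝ × ℝ => drift z.2)
      (continuous_drift.comp continuous_snd).continuousOn
    refine ⟨(M + |k|) * (d + M + |k|), fun z hz => ?_⟩
    rw [hB, abs_mul]
    refine mul_le_mul (bA' z) ?_ (abs_nonneg _) (by positivity)
    refine (abs_sub _ _).trans (add_le_add ((abs_sub _ _).trans (add_le_add (hd z hz) ?_)) le_rfl)
    exact hu.abs_apply_le z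
  have bC : CompactBounded C := fun K hK => by
    obtain ⟨d, hd⟩ := hK.exists_bound_of_continuousOn (f := fun z : ℝ × ℝ => (2 - 2 * z.2) * k)
      (by fun_prop)
    refine ⟨1 * d, fun z hz => ?_⟩
    rw [hC, abs_neg, abs_mul]
    exact mul_le_mul (abs_sign_le _) (hd z hz) (abs_nonneg _) zero_le_one
  have hE := integral_nonneg_of_lipschitz mA mB mC bA bB bC (hu.entropy k) ΘLip Θc Θd Θ0
  have iE : Integrable fun z => A z * lineDeriv ℝ Θ z (1, 0) + B z * lineDeriv ℝ Θ z (0, 1)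
      + C z * Θ z :=
    ((integrable_mul_lineDeriv mA bA ΘLip Θc _).add
      (integrable_mul_lineDeriv mB bB ΘLip Θc _)).add
      (integrable_mul_of_hasCompactSupport mC bC ΘLip.continuous Θc)
  have iT : Integrable fun z => m * lineDeriv ℝ Θ z (1, 0) :=
    integrable_mul_lineDeriv measurable_const (fun K _ => ⟨|m|, fun z _ => le_rfl⟩) ΘLip Θc _
  have hT0 : ∫ z, m * lineDeriv ℝ Θ z (1, 0) = 0 := by
    rw [integral_const_mul, integral_lineDeriv_eq_zero ΘLip Θc, mul_zero]
  set S : Set (ℝ × ℝ) := {z | 0 < Θ z} with hS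
  have Sopen : IsOpen S := isOpen_lt continuous_const ΘLip.continuous
  have SK : S ⊆ Metric.closedBall z₁ (s / 4) := fun z hz => hsupp (ne_of_gt hz)
  have Sfin : volume S < ⊤ := (measure_mono SK).trans_lt (isCompact_closedBall _ _).measure_lt_top
  have Spos : 0 < volume S := by
    refine Sopen.measure_pos volume ⟨z₁, ?_⟩
    change 0 < Θ z₁
    rw [hΘ]
    simp only [hDz₁, hpz₁]
    exact lt_max_of_lt_left (by linarith)
  have hle : ∀ᵐ z, (A z * lineDeriv ℝ Θ z (1, 0) + B z * lineDeriv ℝ Θ z (0, 1)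
      + C z * Θ z) + m * lineDeriv ℝ Θ z (1, 0) ≤ S.indicator (fun _ => -(m * ρ)) z := by
    filter_upwards [hU.ae_lineDeriv_space hu, hU.ae_lineDeriv_time hu,
      hU.lip.ae_differentiableAt, pLip.ae_differentiableAt] with z e1 e2 dU dp
    by_cases hz : z ∈ S
    · rw [indicator_of_mem hz]
      obtain ⟨hz4, hzc⟩ := hpos z hz
      obtain ⟨-, hzQ, hz3⟩ := hs (show ‖z - z₁‖ < s by linarith)
      replace e1 := e1 hzQ
      replace e2 := e2 hzQ
      have hloc : Θ =ᶠ[𝓝 z] fun z => U z - aff z - p z + c := by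
        filter_upwards [Sopen.mem_nhds hz] with w hw
        have hw' : 0 < Θ w := hw
        rcases le_or_gt (D w - p w + c) 0 with h1 | h1
        · rw [hΘ] at hw'
          simp only [max_eq_right h1] at hw'
          exact absurd hw' (lt_irrefl _)
        · exact max_eq_left h1.le
      have daff : HasFDerivAt aff (b • ContinuousLinearMap.fst ℝ ℝ ℝ
          + k • ContinuousLinearMap.snd ℝ ℝ ℝ) z :=
        (((hasFDerivAt_fst.sub_const z₁.1).const_mul b).const_add (U z₁)).add
          ((hasFDerivAt_snd.sub_const z₁.2).const_mul k)
      have hder : ∀ v : ℝ × ℝ, lineDeriv ℝ Θ z v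
          = lineDeriv ℝ U z v - (b * v.1 + k * v.2) - lineDeriv ℝ p z v := by
        intro v
        have h1 : HasFDerivAt (fun z => U z - aff z - p z + c)
            (fderiv ℝ U z - (b • ContinuousLinearMap.fst ℝ ℝ ℝ
              + k • ContinuousLinearMap.snd ℝ ℝ ℝ) - fderiv ℝ p z) z :=
          ((dU.hasFDerivAt.sub daff).sub dp.hasFDerivAt).add_const c
        rw [hloc.lineDeriv_eq, (h1.hasLineDerivAt v).lineDeriv, dU.lineDeriv_eq_fderiv,
          dp.lineDeriv_eq_fderiv]
        simp
      have hpd : ∀ v : ℝ × ℝ, |lineDeriv ℝ p z v| ≤ 2 * η * ‖v‖ := by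
        intro v
        refine norm_lineDeriv_le_of_lip' (𝕜 := ℝ) (f := p) (x₀ := z) (C := 2 * η) (by positivity) ?_
        have hball : Metric.ball z₁ (s / 2) ∈ 𝓝 z :=
          Metric.isOpen_ball.mem_nhds (by rw [mem_ball_iff_norm]; linarith)
        filter_upwards [hball] with w hw
        rw [mem_ball_iff_norm] at hw
        have e3 : p w - p z = 2 * η * (‖w - z₁‖ - ‖z - z₁‖) := by
          simp only [hp]
          rw [max_eq_right (by linarith), max_eq_right (by linarith)]
          ring
        rw [e3, Real.norm_eq_abs, abs_mul, abs_of_pos (by positivity : 0 < 2 * η)]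
        have e4 := abs_norm_sub_norm_le (w - z₁) (z - z₁)
        rw [sub_sub_sub_cancel_right] at e4
        gcongr
      have hx := hder (0, 1)
      have ht := hder (1, 0)
      have px := hpd (0, 1)
      have pt := hpd (1, 0)
      rw [e1] at hx
      rw [e2] at ht
      simp only [Prod.norm_def, norm_zero, norm_one, mul_zero, mul_one, zero_add, add_zero,
        max_eq_right (zero_le_one' ℝ), max_eq_left (zero_le_one' ℝ)] at hx ht px pt
      set a := |u z - k| with ha
      have a0 : 0 ≤ a := abs_nonneg _
      set d := drift z.2 - u z - k with hd
      have hdΛ : |d| ≤ Λ := by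
        have h1 : |drift z.2| ≤ 2 * X + X ^ 2 := by
          unfold drift
          refine (abs_sub _ _).trans ?_
          have h2 : |z.2| ≤ X := by rw [abs_of_pos hzQ.2.1]; exact hzQ.2.2.le
          have h3 := pow_le_pow_left₀ (abs_nonneg z.2) h2 2
          rw [abs_mul, abs_two, abs_pow]
          linarith
        rw [hd, hΛ]
        exact (abs_sub _ _).trans (add_le_add ((abs_sub _ _).trans
          (add_le_add h1 (hu.abs_apply_le z))) le_rfl)
      have hflux : flux z.2 (u z) = flux z.2 k + (u z - k) * d := by
        rw [hd, flux_eq, flux_eq]; ring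
      have hCz : |C z| ≤ C₀ := by
        rw [hC, hC₀, abs_neg, abs_mul, abs_mul, ← mul_assoc]
        have h1 : |2 - 2 * z.2| ≤ 2 + 2 * X := by
          rw [abs_le]; constructor <;> linarith [hzQ.2.1, hzQ.2.2]
        gcongr
        calc |Real.sign (u z - k)| * |2 - 2 * z.2| ≤ 1 * (2 + 2 * X) :=
              mul_le_mul (abs_sign_le _) h1 (abs_nonneg _) zero_le_one
          _ = _ := one_mul _
      have hAz : A z = a := rfl
      have hBz : B z = a * d := rfl
      rw [hAz, hBz, hx, ht, hflux]
      have n1 : C z * Θ z ≤ C₀ * c :=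
        (le_abs_self _).trans (by
          rw [abs_mul, abs_of_nonneg (Θ0 z)]
          exact mul_le_mul hCz hzc (Θ0 z) C₀0)
      have n5 : m * Λ ≤ 2 * ρ := by
        rw [hm, div_mul_eq_mul_div, div_le_iff₀ (by positivity)]
        nlinarith
      have key := subsolution_pointwise_bound (w := u z - k) (Fk := flux z.2 k) (b := b) hdΛ pt px
        ηpos hηe mpos n5 (n1.trans hcC) hz3.le
      rw [← ha] at key
      refine le_trans (le_of_eq ?_) key
      ring
    · rw [indicator_of_notMem hz]
      have hz0 : Θ z = 0 := le_antisymm (not_lt.1 hz) (Θ0 z)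
      simp [hz0, lineDeriv_eq_zero_of_nonneg Θ0 hz0]
  have hfin := integral_mono_ae (iE.add iT) ((integrable_indicator_iff Sopen.measurableSet).2
    (integrableOn_const Sfin.ne)) hle
  have hsum := integral_add iE iT
  rw [hT0, add_zero] at hsum
  have hfin' : ∫ z, ((A z * lineDeriv ℝ Θ z (1, 0) + B z * lineDeriv ℝ Θ z (0, 1)
      + C z * Θ z) + m * lineDeriv ℝ Θ z (1, 0)) ≤ ∫ z, S.indicator (fun _ => -(m * ρ)) z := hfin
  rw [hsum, integral_indicator Sopen.measurableSet, setIntegral_const, smul_eq_mul] at hfin'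
  have : 0 < volume.real S := ENNReal.toReal_pos Spos.ne' Sfin.ne
  have : 0 < volume.real S * (m * ρ) := by positivity
  linarith

end

/-! ### Monotonicity of the potential and its extension to negative `x` -/

section

variable {T M X : ℝ} {u U : ℝ × ℝ → ℝ} {L : NNReal}

theorem continuous_left_of_lipschitz (hU : LipschitzWith L U) (t : ℝ) :
    Continuous fun x => U (t, x) := hU.continuous.comp (by fun_prop)

theorem continuous_right_of_lipschitz (hU : LipschitzWith L U) (x : ℝ) :
    Continuous fun t => U (t, x) := hU.continuous.comp (by fun_prop)

theorem IsPotential.monotoneOn_space (hU : IsPotential T X u U L) (hu : IsRep T M u)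
    {t : ℝ} (ht : t ∈ Ioo 0 T) : MonotoneOn (fun x => U (t, x)) (Ioo 0 X) := by
  intro x hx y hy hxy
  have hcl : IsClosed {t | U (t, x) ≤ U (t, y)} :=
    isClosed_le (continuous_right_of_lipschitz hU.lip x) (continuous_right_of_lipschitz hU.lip y)
  refine hcl.closure_subset_iff.2 ?_ (mem_closure_inter_of_ae hU.space isOpen_Ioo ht)
  rintro s ⟨hs, h3⟩
  have h4 := h3 hs x hx y hy
  have h5 : 0 ≤ ∫ r in x..y, u (s, r) :=
    intervalIntegral.integral_nonneg hxy fun r _ => hu.nonneg _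
  simp only [mem_ofPred_eq]
  linarith

/-- At `x = 0` the flux is `-u² ≤ 0`, so the potential increases in time. -/
theorem IsPotential.monotoneOn_left_boundary (hU : IsPotential T X u U L) (hu : IsRep T M u)
    (hX : 0 < X) : MonotoneOn (fun t => U (t, 0)) (Ioo 0 T) := by
  intro t ht s hs hts
  have hcl : IsClosed {x | -((s - t) * (drift x ^ 2 / 4)) ≤ U (s, x) - U (t, x)} := by
    have c1 := continuous_left_of_lipschitz hU.lip s
    have c2 := continuous_left_of_lipschitz hU.lip t
    have c3 := continuous_drift
    exact isClosed_le (by fun_prop) (c1.sub c2)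
  have h2 : Ioo 0 X ⊆ {x | -((s - t) * (drift x ^ 2 / 4)) ≤ U (s, x) - U (t, x)} := fun x hx => by
    refine hcl.closure_subset_iff.2 ?_ (mem_closure_inter_of_ae hU.time isOpen_Ioo hx)
    rintro y ⟨hy, h3⟩
    have h4 := h3 hy t ht s hs
    have h5 : ∫ r in t..s, flux y (u (r, y)) ≤ (s - t) * (drift y ^ 2 / 4) := by
      refine (intervalIntegral.integral_mono_on hts
        (intervalIntegrable_of_bound (hu.measurable_flux_right y) (hu.abs_flux_right_le y) t s)
        (intervalIntegrable_const (c := drift y ^ 2 / 4)) ?_).trans_eq ?_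
      · intro r _
        rw [flux_eq]
        nlinarith [sq_nonneg (u (r, y) - drift y / 2)]
      · rw [intervalIntegral.integral_const, smul_eq_mul]
    simp only [mem_ofPred_eq]
    linarith
  rw [← hcl.closure_subset_iff, closure_Ioo hX.ne] at h2
  have h3 := h2 (left_mem_Icc.2 hX.le)
  simp only [mem_ofPred_eq, drift] at h3
  norm_num at h3
  exact h3

/-- The extension of `U` to negative `x` by its boundary values at `x = 0`. -/
def extendLeft (U : ℝ × ℝ → ℝ) (z : ℝ × ℝ) : ℝ := U (z.1, max z.2 0)

theorem lipschitzWith_extendLeft (hU : LipschitzWith L U) : LipschitzWith L (extendLeft U) := by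
  refine LipschitzWith.of_dist_le_mul fun z w => (hU.dist_le_mul _ _).trans ?_
  refine mul_le_mul_of_nonneg_left ?_ L.2
  rw [Prod.dist_eq, Prod.dist_eq]
  refine max_le_max le_rfl ?_
  have := (LipschitzWith.id.max_const 0).dist_le_mul z.2 w.2
  simpa using this

theorem extendLeft_of_nonneg {t x : ℝ} (hx : 0 ≤ x) : extendLeft U (t, x) = U (t, x) := by
  simp [extendLeft, hx]

theorem nonneg_of_hasDerivAt_of_monotoneOn {f : ℝ → ℝ} {d a : ℝ} {s : Set ℝ} (hs : s ∈ 𝓝 a)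
    (hf : MonotoneOn f s) (h : HasDerivAt f d a) : 0 ≤ d := by
  refine ge_of_tendsto (hasDerivAt_iff_tendsto_slope.1 h) ?_
  filter_upwards [mem_nhdsWithin_of_mem_nhds hs] with y hy
  have ha := mem_of_mem_nhds hs
  rw [slope_def_field]
  rcases le_total y a with h1 | h1
  · exact div_nonneg_of_nonpos (sub_nonpos.2 (hf hy ha h1)) (by linarith)
  · exact div_nonneg (sub_nonneg.2 (hf ha hy h1)) (by linarith)

/-- The extended potential is a supersolution of the Hamilton-Jacobi equation in the form of its
Legendre transform: `∂ₜ U + v ∂ₓ U = u² - g u + v u ≥ -(v - g)² / 4` for every velocity `v`, where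
`g` is the drift. -/
theorem IsPotential.ae_le_lineDeriv_extendLeft (hU : IsPotential T X u U L) (hu : IsRep T M u)
    (hX : 0 < X) (v : ℝ) : ∀ᵐ z : ℝ × ℝ, z ∈ Ioo 0 T ×ˢ Iio X →
      -((v - drift z.2) ^ 2 / 4) ≤ lineDeriv ℝ (extendLeft U) z (1, v) := by
  have h0 : ∀ᵐ z : ℝ × ℝ, z.2 ≠ 0 := by
    have h1 : ∀ᵐ x : ℝ, x ≠ 0 := by simp [ae_iff]
    rw [Measure.volume_eq_prod]
    exact Measure.quasiMeasurePreserving_snd.ae h1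
  filter_upwards [h0, hU.ae_lineDeriv_space hu, hU.ae_lineDeriv_time hu,
    hU.lip.ae_differentiableAt, (lipschitzWith_extendLeft hU.lip).ae_differentiableAt]
    with z hz0 e1 e2 dU dE hz
  rcases lt_or_gt_of_ne hz0 with hz2 | hz2
  · have hloc : extendLeft U =ᶠ[𝓝 z] fun w => U (w.1, 0) := by
      filter_upwards [(isOpen_lt continuous_snd continuous_const).mem_nhds hz2] with w hw
      have hw' : w.2 < 0 := hw
      simp [extendLeft, hw'.le]
    have h1 := (dE.hasFDerivAt.congr_of_eventuallyEq hloc.symm).hasLineDerivAt (1, v)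
    rw [← dE.lineDeriv_eq_fderiv] at h1
    have h2 : HasDerivAt (fun s => U (z.1 + s, 0)) (lineDeriv ℝ (extendLeft U) z (1, v)) 0 := by
      simpa [HasLineDerivAt] using h1
    refine (neg_nonpos.2 (by positivity)).trans
      (nonneg_of_hasDerivAt_of_monotoneOn (s := (fun s => z.1 + s) ⁻¹' Ioo 0 T) ?_ ?_ h2)
    · exact (isOpen_Ioo.preimage (by fun_prop)).mem_nhds (by simpa using hz.1)
    · intro s hs r hr hsr
      exact hU.monotoneOn_left_boundary hu hX hs hr (by simpa using hsr)
  · have hloc : extendLeft U =ᶠ[𝓝 z] U := by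
      filter_upwards [(isOpen_lt continuous_const continuous_snd).mem_nhds hz2] with w hw
      exact extendLeft_of_nonneg (le_of_lt hw)
    have hzQ : z ∈ Ioo 0 T ×ˢ Ioo 0 X := ⟨hz.1, hz2, hz.2⟩
    have hv : ((1, v) : ℝ × ℝ) = (1, 0) + v • (0, 1) := by simp
    rw [hloc.lineDeriv_eq, dU.lineDeriv_eq_fderiv, hv, map_add, map_smul,
      ← dU.lineDeriv_eq_fderiv, ← dU.lineDeriv_eq_fderiv, e1 hzQ, e2 hzQ, flux_eq, smul_eq_mul]
    nlinarith [sq_nonneg (u z + (v - drift z.2) / 2)]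

/-- Mollification preserves the supersolution inequality, with the drift frozen up to the variation
over the support of the kernel, since for a fixed velocity the inequality is linear in the
potential. -/
theorem IsPotential.le_fderiv_mol_extendLeft (hU : IsPotential T X u U L) (hu : IsRep T M u)
    (hX : 0 < X) {j : ℕ} {z : ℝ × ℝ} (h1 : radius j ≤ z.1) (h2 : z.1 + radius j ≤ T)
    (h3 : z.2 + radius j ≤ X) {v c : ℝ}
    (hc : ∀ y, |y - z.2| < radius j → (v - drift y) ^ 2 ≤ c) :
    -(c / 4) ≤ fderiv ℝ (mol j (extendLeft U)) z (1, v) := by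
  have hL := lipschitzWith_extendLeft hU.lip
  rw [fderiv_mol_apply j hL]
  refine le_integral_kernel_mul j ?_ ?_
  · refine integrable_kernel_mul j (c := L * ‖((1, v) : ℝ × ℝ)‖) ?_ fun w =>
      norm_lineDeriv_le_of_lipschitz ℝ hL
    exact ((measurable_lineDeriv hL.continuous).comp
      (measurable_const.sub measurable_id)).aestronglyMeasurable
  · have h4 := (quasiMeasurePreserving_sub_left volume z).ae
      (hU.ae_le_lineDeriv_extendLeft hu hX v)
    filter_upwards [h4] with w hw hwj
    have hw1 : |w.1| < radius j := (norm_fst_le w).trans_lt hwj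
    have hw2 : |w.2| < radius j := (norm_snd_le w).trans_lt hwj
    rw [abs_lt] at hw1
    have hw3 := abs_lt.1 hw2
    refine le_trans ?_ (hw ⟨⟨?_, ?_⟩, ?_⟩)
    · have := hc (z - w).2 (by simpa using hw2)
      linarith
    · simp only [Prod.fst_sub]; linarith
    · simp only [Prod.fst_sub]; linarith
    · simp only [Prod.snd_sub, mem_Iio]; linarith

end

/-! ### Comparison with an average of two translates -/

section

variable {T M X : ℝ} {u U : ℝ × ℝ → ℝ} {L : NNReal}

theorem hasDerivAt_max_zero_sq (s : ℝ) :
    HasDerivAt (fun s : ℝ => max s 0 ^ 2) (2 * max s 0) s := by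
  rcases lt_trichotomy s 0 with h | h | h
  · rw [max_eq_right h.le, mul_zero]
    refine (hasDerivAt_const s (0 : ℝ)).congr_of_eventuallyEq ?_
    filter_upwards [gt_mem_nhds h] with r hr
    rw [max_eq_right hr.le]; norm_num
  · subst h
    have h1 : (fun s : ℝ => max s 0 ^ 2) =O[𝓝 0] fun s => ‖s - 0‖ ^ 2 := by
      refine Asymptotics.IsBigO.of_bound 1 (Eventually.of_forall fun s => ?_)
      rw [sub_zero, one_mul, norm_pow, norm_pow, norm_norm, Real.norm_eq_abs, Real.norm_eq_abs]
      refine pow_le_pow_left₀ (abs_nonneg _) ?_ 2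
      rw [abs_of_nonneg (le_max_right s 0)]
      exact max_le (le_abs_self s) (abs_nonneg s)
    have h2 := (h1.hasFDerivAt one_lt_two).hasDerivAt
    simpa using h2
  · rw [max_eq_left h.le]
    refine HasDerivAt.congr_of_eventuallyEq (f := fun s => s ^ 2)
      (by simpa using hasDerivAt_pow 2 s) ?_
    filter_upwards [lt_mem_nhds h] with r hr
    rw [max_eq_left hr.le]

/-- The differential inequalities at an interior maximum of `U - V - Φ` are incompatible. Here `k`
is the space derivative of `V + Φ`, `bV` the time derivative of the average `V`, `Φt` and `Φx` are
the derivatives of the penalty, and `g ± γ ξ - ξ²` is the drift at the two translates. The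
supersolution inequality is used in the directions `(1, v ± σ)`, where the velocity `v = g - 2 k`
is the optimal one in the Legendre transform. -/
theorem comparison_contradiction {bV Φt k Φx g γ ξ σ v e₂ P₁ P₂ : ℝ} (hv : v = g - 2 * k)
    (hk : 0 ≤ k)
    (hsub : bV + Φt ≤ k ^ 2 - g * k)
    (h₁ : -((v + σ - (g + γ * ξ - ξ ^ 2)) ^ 2 / 4) - e₂ ≤ P₁)
    (h₂ : -((v - σ - (g - γ * ξ - ξ ^ 2)) ^ 2 / 4) - e₂ ≤ P₂)
    (hP : bV + v * (k - Φx) = (P₁ + P₂) / 2)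
    (hΦ : (2 * k - g) * Φx + e₂ + ξ ^ 4 / 4 + (σ - γ * ξ) ^ 2 / 4 < Φt) : False := by
  subst hv
  have : 0 ≤ k * ξ ^ 2 := by positivity
  nlinarith

/-- The time derivative of the penalty exceeds all error terms: `C σ²` pays for the translation,
`3 δ` for the mollification and the logarithm, and the moving barrier of speed `K` for its own space
derivative `2 B s`. -/
theorem penalty_dominates {x X X₀ ξ σ τ C δ e k B s K c : ℝ} (hx : 0 < x) (hxX : x ≤ X)
    (hσ : 0 ≤ σ) (hξ : 0 ≤ ξ) (hξX : ξ ≤ X₀) (hξτ : ξ ≤ σ * τ)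
    (hC : (1 + (2 + 2 * X) * τ) ^ 2 / 4 + X₀ ^ 2 * τ ^ 2 / 4 ≤ C) (hδ : 0 < δ) (he : e < δ)
    (hk : 0 ≤ k) (hB : 0 ≤ B) (hs : 0 ≤ s) (hK : 2 * k - drift x ≤ K) (hc : 0 < c) :
    (2 * k - drift x) * (2 * B * s - δ / x) + e + ξ ^ 4 / 4 + (σ - (2 - 2 * x) * ξ) ^ 2 / 4
      < C * σ ^ 2 + 3 * δ + 2 * B * K * s + δ / c := by
  have q₁ : ξ ^ 4 ≤ X₀ ^ 2 * (σ * τ) ^ 2 := by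
    have a₁ := pow_le_pow_left₀ hξ hξX 2
    have a₂ := pow_le_pow_left₀ hξ hξτ 2
    calc ξ ^ 4 = ξ ^ 2 * ξ ^ 2 := by ring
      _ ≤ _ := mul_le_mul a₁ a₂ (by positivity) (by positivity)
  have q₀ : (2 + 2 * X) * ξ ≤ (2 + 2 * X) * (σ * τ) :=
    mul_le_mul_of_nonneg_left hξτ (by linarith)
  have q₂ : (σ - (2 - 2 * x) * ξ) ^ 2 ≤ (σ * (1 + (2 + 2 * X) * τ)) ^ 2 := by
    refine sq_le_sq' ?_ ?_
    · have : (2 - 2 * x) * ξ ≤ (2 + 2 * X) * ξ := mul_le_mul_of_nonneg_right (by linarith) hξ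
      linarith
    · have : -(2 - 2 * x) * ξ ≤ (2 + 2 * X) * ξ := mul_le_mul_of_nonneg_right (by linarith) hξ
      linarith
  have q₃ : ξ ^ 4 / 4 + (σ - (2 - 2 * x) * ξ) ^ 2 / 4 ≤ C * σ ^ 2 := by
    have := mul_le_mul_of_nonneg_right hC (sq_nonneg σ)
    have e₁ : ((1 + (2 + 2 * X) * τ) ^ 2 / 4 + X₀ ^ 2 * τ ^ 2 / 4) * σ ^ 2
        = (σ * (1 + (2 + 2 * X) * τ)) ^ 2 / 4 + X₀ ^ 2 * (σ * τ) ^ 2 / 4 := by ring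
    linarith
  have q₄ : (2 * k - drift x) * (2 * B * s) ≤ K * (2 * B * s) :=
    mul_le_mul_of_nonneg_right hK (by positivity)
  have q₅ : drift x * (δ / x) = δ * (2 - x) := by
    unfold drift; field_simp
  have q₆ : 0 ≤ k * (δ / x) := by positivity
  have q₇ : 0 < δ / c := by positivity
  have q₈ : 0 < δ * x := by positivity
  have q₉ : (2 * k - drift x) * (2 * B * s - δ / x) = (2 * k - drift x) * (2 * B * s)
      - 2 * (k * (δ / x)) + drift x * (δ / x) := by ring
  rw [q₉, q₅]
  linarith

/-- If `U ≤ P` with equality at an interior point where `P` is differentiable, then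
`∂ₓ P ≥ 0` and `∂ₜ P + F(x, ∂ₓ P) ≤ 0` there. -/
theorem IsPotential.touching (hU : IsPotential T X u U L) (hu : IsRep T M u)
    {z : ℝ × ℝ} (hz : z ∈ Ioo 0 T ×ˢ Ioo 0 X) {P : ℝ × ℝ → ℝ} {b k : ℝ}
    (hP : HasFDerivAt P (b • ContinuousLinearMap.fst ℝ ℝ ℝ + k • ContinuousLinearMap.snd ℝ ℝ ℝ) z)
    (hle : ∀ᶠ w in 𝓝 z, U w - P w ≤ U z - P z) :
    0 ≤ k ∧ b ≤ k ^ 2 - drift z.2 * k := by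
  have h : ∀ η > 0, ∀ᶠ w in 𝓝 z,
      U w ≤ U z + b * (w.1 - z.1) + k * (w.2 - z.2) + η * ‖w - z‖ := by
    intro η hη
    filter_upwards [hle, (hasFDerivAt_iff_isLittleO.1 hP).def hη] with w h1 h2
    have h3 := (le_abs_self _).trans h2
    simp at h3
    linarith
  constructor
  · have h1 : Tendsto (fun y : ℝ => (z.1, y)) (𝓝[>] z.2) (𝓝 z) := by
      have : Continuous fun y : ℝ => (z.1, y) := by fun_prop
      exact (this.tendsto z.2).mono_left nhdsWithin_le_nhds
    by_contra hk
    push Not at hk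
    obtain ⟨y, h2, h3, h4⟩ := ((h1.eventually (h (-k / 2) (by linarith))).and
      (Filter.Eventually.and self_mem_nhdsWithin
        (mem_nhdsWithin_of_mem_nhds (isOpen_Ioo.mem_nhds hz.2)))).exists
    have h5 : U z ≤ U (z.1, y) := hU.monotoneOn_space hu hz.1 hz.2 h4 (le_of_lt h3)
    have h6 : ‖((z.1, y) : ℝ × ℝ) - z‖ = y - z.2 := by
      rw [Prod.norm_def]
      simp [abs_of_pos (sub_pos.2 h3), h3.le]
    rw [h6] at h2
    simp only [sub_self, mul_zero, add_zero] at h2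
    have h7 := sub_pos.2 h3
    nlinarith
  · have := hU.add_flux_nonpos hu hz h
    rw [flux_eq] at this
    nlinarith


theorem hasFDerivAt_average {Y : ℝ × ℝ → ℝ} (hY : Differentiable ℝ Y) (σ t₀ : ℝ) (z : ℝ × ℝ) :
    HasFDerivAt
      (fun w : ℝ × ℝ => (Y (w.1, w.2 + σ * (w.1 - t₀)) + Y (w.1, w.2 - σ * (w.1 - t₀))) / 2)
      (((fderiv ℝ Y (z.1, z.2 + σ * (z.1 - t₀)) (1, σ)
          + fderiv ℝ Y (z.1, z.2 - σ * (z.1 - t₀)) (1, -σ)) / 2) • ContinuousLinearMap.fst ℝ ℝ ℝ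
        + ((fderiv ℝ Y (z.1, z.2 + σ * (z.1 - t₀)) (0, 1)
          + fderiv ℝ Y (z.1, z.2 - σ * (z.1 - t₀)) (0, 1)) / 2) • ContinuousLinearMap.snd ℝ ℝ ℝ)
      z := by
  have h : ∀ τ : ℝ, HasFDerivAt (fun w : ℝ × ℝ => Y (w.1, w.2 + τ * (w.1 - t₀)))
      ((fderiv ℝ Y (z.1, z.2 + τ * (z.1 - t₀)) (1, τ)) • ContinuousLinearMap.fst ℝ ℝ ℝ
        + (fderiv ℝ Y (z.1, z.2 + τ * (z.1 - t₀)) (0, 1)) • ContinuousLinearMap.snd ℝ ℝ ℝ) z := by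
    intro τ
    have h1 : HasFDerivAt (fun w : ℝ × ℝ => (w.1, w.2 + τ * (w.1 - t₀)))
        ((ContinuousLinearMap.fst ℝ ℝ ℝ).prod
          (ContinuousLinearMap.snd ℝ ℝ ℝ + τ • ContinuousLinearMap.fst ℝ ℝ ℝ)) z :=
      hasFDerivAt_fst.prodMk (hasFDerivAt_snd.add ((hasFDerivAt_fst.sub_const t₀).const_mul τ))
    refine ((hY _).hasFDerivAt.comp z h1).congr_fderiv ?_
    ext
    · simp
    · simp
  have h2 := h (-σ)
  simp only [neg_mul, ← sub_eq_add_neg] at h2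
  refine (((h σ).add h2).mul_const (2⁻¹ : ℝ)).congr_fderiv ?_
  ext
  · simp; ring
  · simp; ring

theorem hasFDerivAt_penalty {A B K δ X₀ t₀ t₂ : ℝ} {z : ℝ × ℝ} (h₁ : z.1 < t₂) (h₂ : 0 < z.2) :
    HasFDerivAt (fun w : ℝ × ℝ => A * (w.1 - t₀) + B * max (w.2 - X₀ + K * (w.1 - t₂)) 0 ^ 2
        - δ * Real.log w.2 + δ / (t₂ - w.1))
      ((A + 2 * B * K * max (z.2 - X₀ + K * (z.1 - t₂)) 0 + δ / (t₂ - z.1) ^ 2)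
          • ContinuousLinearMap.fst ℝ ℝ ℝ
        + (2 * B * max (z.2 - X₀ + K * (z.1 - t₂)) 0 - δ / z.2) • ContinuousLinearMap.snd ℝ ℝ ℝ)
      z := by
  have h3 : HasFDerivAt (fun w : ℝ × ℝ => w.2 - X₀ + K * (w.1 - t₂))
      (ContinuousLinearMap.snd ℝ ℝ ℝ + K • ContinuousLinearMap.fst ℝ ℝ ℝ) z :=
    (hasFDerivAt_snd.sub_const X₀).add ((hasFDerivAt_fst.sub_const t₂).const_mul K)
  have h4 :=
    ((hasDerivAt_max_zero_sq (z.2 - X₀ + K * (z.1 - t₂))).comp_hasFDerivAt z h3).const_mul B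
  have h9 : HasFDerivAt (Prod.snd : ℝ × ℝ → ℝ) (ContinuousLinearMap.snd ℝ ℝ ℝ) z :=
    hasFDerivAt_snd
  have h5 := ((Real.hasDerivAt_log h₂.ne').comp_hasFDerivAt z h9).const_mul δ
  have h6 : HasFDerivAt (fun w : ℝ × ℝ => t₂ - w.1) (-ContinuousLinearMap.fst ℝ ℝ ℝ) z :=
    hasFDerivAt_fst.const_sub t₂
  have h7 := ((hasDerivAt_inv (sub_pos.2 h₁).ne').comp_hasFDerivAt z h6).const_mul δ
  have h8 := (((hasFDerivAt_fst.sub_const t₀).const_mul A).add h4).sub h5 |>.add h7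
  refine h8.congr_fderiv ?_
  ext
  · simp; ring
  · simp; ring


/-- A function on `[t₀, t₂) × (0, X₁]` that is dominated by `D + δ log x - δ / (t₂ - t)` attains
every value that it exceeds on the parabolic boundary at most as an interior maximum. -/
theorem exists_interior_max {W : ℝ × ℝ → ℝ} {t₀ t₂ X₁ D δ m : ℝ} (hδ : 0 < δ)
    (hW : ContinuousOn W (Ico t₀ t₂ ×ˢ Ioc 0 X₁))
    (hD : ∀ z ∈ Ico t₀ t₂ ×ˢ Ioc 0 X₁, W z ≤ D + δ * Real.log z.2 - δ / (t₂ - z.1))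
    (h₀ : ∀ x ∈ Ioc 0 X₁, W (t₀, x) ≤ m) (h₁ : ∀ t ∈ Ico t₀ t₂, W (t, X₁) ≤ m)
    {z₀ : ℝ × ℝ} (hz₀ : z₀ ∈ Ico t₀ t₂ ×ˢ Ioc 0 X₁) (hm : m < W z₀) :
    ∃ z ∈ Ioo t₀ t₂ ×ˢ Ioo 0 X₁, ∀ w ∈ Ico t₀ t₂ ×ˢ Ioc 0 X₁, W w ≤ W z := by
  set y : ℝ := Real.exp ((W z₀ - D) / δ) with hy
  set γ : ℝ := δ / (|D + δ * Real.log X₁ - W z₀| + 1) with hγ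
  have ypos : 0 < y := Real.exp_pos _
  have γpos : 0 < γ := by positivity
  have hout : ∀ w ∈ Ico t₀ t₂ ×ˢ Ioc 0 X₁, W z₀ ≤ W w → w ∈ Icc t₀ (t₂ - γ) ×ˢ Icc y X₁ := by
    intro w hw hle
    have h2 := hD w hw
    have hpos : 0 < δ / (t₂ - w.1) := div_pos hδ (sub_pos.2 hw.1.2)
    refine ⟨⟨hw.1.1, ?_⟩, ?_, hw.2.2⟩
    · have h3 : δ * Real.log w.2 ≤ δ * Real.log X₁ :=
        mul_le_mul_of_nonneg_left (Real.log_le_log hw.2.1 hw.2.2) hδ.le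
      have h4 : δ / (t₂ - w.1) ≤ |D + δ * Real.log X₁ - W z₀| + 1 := by
        have := le_abs_self (D + δ * Real.log X₁ - W z₀)
        linarith
      rw [div_le_iff₀ (sub_pos.2 hw.1.2), mul_comm, ← div_le_iff₀ (by positivity)] at h4
      linarith
    · have h3 : (W z₀ - D) / δ ≤ Real.log w.2 := by
        rw [div_le_iff₀ hδ]; linarith
      exact (Real.le_log_iff_exp_le hw.2.1).1 h3
  have hsub : Icc t₀ (t₂ - γ) ×ˢ Icc y X₁ ⊆ Ico t₀ t₂ ×ˢ Ioc 0 X₁ := fun w hw =>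
    ⟨⟨hw.1.1, by linarith [hw.1.2]⟩, ypos.trans_le hw.2.1, hw.2.2⟩
  obtain ⟨z, hz, hmax⟩ := (isCompact_Icc.prod isCompact_Icc).exists_isMaxOn
    ⟨z₀, hout z₀ hz₀ le_rfl⟩ (hW.mono hsub)
  have hz₀z : W z₀ ≤ W z := hmax (hout z₀ hz₀ le_rfl)
  have hzR := hsub hz
  refine ⟨z, ⟨⟨lt_of_le_of_ne hzR.1.1 fun h => ?_, hzR.1.2⟩, hzR.2.1,
    lt_of_le_of_ne hzR.2.2 fun h => ?_⟩, fun w hw => ?_⟩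
  · have := h₀ z.2 hzR.2
    rw [h] at this
    exact absurd (hm.trans_le (hz₀z.trans this)) (lt_irrefl _)
  · have := h₁ z.1 hzR.1
    rw [← h] at this
    exact absurd (hm.trans_le (hz₀z.trans this)) (lt_irrefl _)
  · by_cases hw' : W z₀ ≤ W w
    · exact hmax (hout w hw hw')
    · exact (lt_of_not_ge hw').le.trans hz₀z

set_option maxHeartbeats 1000000 in
/-- Comparison of `U` with the average of the translates of a smooth supersolution `Y` by
`±σ (t - t₀)`. The penalty keeps the maximum of the difference away from `x = 0` (by `-δ log x`),
from `t = t₂` (by `δ / (t₂ - t)`) and from `x = X₀ + 2` (by a quadratic barrier that starts at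
`X₀ + K (t₂ - t)` and so moves at the speed `K`, which exceeds the speed of propagation). -/
theorem IsPotential.le_average_of_supersolution (hU : IsPotential T X u U L) (hu : IsRep T M u)
    {Y : ℝ × ℝ → ℝ} {X₀ t₀ t₂ σ e₁ e₂ δ G B K N C : ℝ}
    (hX₀ : 0 < X₀) (hX : X = 2 * X₀ + 3) (ht₀ : 0 < t₀) (h02 : t₀ < t₂) (ht₂ : t₂ < T)
    (hσ : 0 ≤ σ) (hσX : σ * (t₂ - t₀) ≤ X₀) (hG : ∀ x ∈ Ioo 0 X, |drift x| ≤ G)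
    (hB : L * X₀ + 1 ≤ B) (hK : 2 * L + 8 * B + G ≤ K) (hK1 : K * (t₂ - t₀) ≤ 1)
    (hN : G + 2 * (L + 4 * B) + σ ≤ N)
    (hC : (1 + (2 + 2 * X) * (t₂ - t₀)) ^ 2 / 4 + X₀ ^ 2 * (t₂ - t₀) ^ 2 / 4 ≤ C)
    (hY : Differentiable ℝ Y) (hYx : ∀ z, |fderiv ℝ Y z (0, 1)| ≤ L)
    (hYU : ∀ z, |Y z - extendLeft U z| ≤ e₁)
    (hYs : ∀ t ∈ Ioo t₀ t₂, ∀ x ∈ Icc (-X) (2 * X₀ + 2), ∀ v, |v| ≤ N →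
      -((v - drift x) ^ 2 / 4) - e₂ ≤ fderiv ℝ Y (t, x) (1, v))
    (he₂ : 0 ≤ e₂) (he : e₂ < δ) {t x : ℝ} (ht : t ∈ Ico t₀ t₂) (hx : x ∈ Ioc 0 X₀) :
    U (t, x) ≤ (Y (t, x + σ * (t - t₀)) + Y (t, x - σ * (t - t₀))) / 2
      + (C * σ ^ 2 + 3 * δ) * (t - t₀) - δ * Real.log x + δ / (t₂ - t) + e₁
      + δ * Real.log (X₀ + 2) := by
  have hδ : 0 < δ := he₂.trans_lt he
  have hL0 : (0 : ℝ) ≤ L := L.2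
  have hLX : 0 ≤ (L : ℝ) * X₀ := by positivity
  have hB0 : 0 < B := by linarith
  have hC0 : 0 ≤ C := le_trans (by positivity) hC
  have hG0 : 0 ≤ G := (abs_nonneg _).trans (hG 1 ⟨one_pos, by linarith⟩)
  have hK0 : 0 ≤ K := le_trans (by positivity) hK
  set V : ℝ × ℝ → ℝ := fun w =>
    (Y (w.1, w.2 + σ * (w.1 - t₀)) + Y (w.1, w.2 - σ * (w.1 - t₀))) / 2 with hV
  set Φ : ℝ × ℝ → ℝ := fun w => (C * σ ^ 2 + 3 * δ) * (w.1 - t₀)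
    + B * max (w.2 - X₀ + K * (w.1 - t₂)) 0 ^ 2 - δ * Real.log w.2 + δ / (t₂ - w.1) with hΦ
  have hlogX : 0 ≤ δ * Real.log (X₀ + 2) := mul_nonneg hδ.le (Real.log_nonneg (by linarith))
  -- `U - V` is small at `t = t₀` and bounded throughout
  have hUV : ∀ w ∈ Ico t₀ t₂ ×ˢ Ioc 0 (X₀ + 2), U w - V w ≤ L * (σ * (w.1 - t₀)) + e₁ := by
    intro w hw
    have hξ : 0 ≤ σ * (w.1 - t₀) := mul_nonneg hσ (sub_nonneg.2 hw.1.1)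
    have h1 : ∀ s : ℝ, |s| = σ * (w.1 - t₀) →
        U w - Y (w.1, w.2 + s) ≤ L * (σ * (w.1 - t₀)) + e₁ := by
      intro s hs
      have h2 := (lipschitzWith_extendLeft hU.lip).dist_le_mul (w.1, w.2) (w.1, w.2 + s)
      rw [extendLeft_of_nonneg hw.2.1.le, Real.dist_eq, Prod.dist_eq] at h2
      simp only [dist_self, dist_self_add_right, Real.norm_eq_abs] at h2
      rw [max_eq_right (abs_nonneg s), hs] at h2
      have h3 := abs_le.1 (hYU (w.1, w.2 + s))
      have h4 := abs_le.1 h2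
      linarith [h3.1, h4.2]
    have h2 := h1 (σ * (w.1 - t₀)) (abs_of_nonneg hξ)
    have h3 := h1 (-(σ * (w.1 - t₀))) (by rw [abs_neg, abs_of_nonneg hξ])
    rw [← sub_eq_add_neg] at h3
    simp only [hV]
    linarith
  have hξX : ∀ r ∈ Ico t₀ t₂, σ * (r - t₀) ≤ X₀ := fun r hr =>
    (mul_le_mul_of_nonneg_left (by linarith [hr.2]) hσ).trans hσX
  by_contra hcon
  push Not at hcon
  -- At `(t, x)` the function `U - V - Φ` exceeds its bound on the parabolic boundary, so that it
  -- has an interior maximum.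
  obtain ⟨z, hz, hmax⟩ : ∃ z ∈ Ioo t₀ t₂ ×ˢ Ioo 0 (X₀ + 2),
      ∀ w ∈ Ico t₀ t₂ ×ˢ Ioc 0 (X₀ + 2), U w - V w - Φ w ≤ U z - V z - Φ z := by
    have hΦ1 : ∀ w ∈ Ico t₀ t₂ ×ˢ Ioc 0 (X₀ + 2), 0 ≤ (C * σ ^ 2 + 3 * δ) * (w.1 - t₀) :=
      fun w hw => mul_nonneg (by positivity) (sub_nonneg.2 hw.1.1)
    have hΦ2 : ∀ w : ℝ × ℝ, 0 ≤ B * max (w.2 - X₀ + K * (w.1 - t₂)) 0 ^ 2 := fun w => by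
      positivity
    have hΦ3 : ∀ w ∈ Ico t₀ t₂ ×ˢ Ioc 0 (X₀ + 2), 0 ≤ δ / (t₂ - w.1) :=
      fun w hw => (div_pos hδ (sub_pos.2 hw.1.2)).le
    have hΦ4 : ∀ w ∈ Ico t₀ t₂ ×ˢ Ioc 0 (X₀ + 2), δ * Real.log w.2 ≤ δ * Real.log (X₀ + 2) :=
      fun w hw => mul_le_mul_of_nonneg_left (Real.log_le_log hw.2.1 hw.2.2) hδ.le
    refine exists_interior_max (W := fun w => U w - V w - Φ w) (D := L * X₀ + e₁)
      (m := e₁ + δ * Real.log (X₀ + 2)) (z₀ := (t, x)) hδ ?_ ?_ ?_ ?_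
      ⟨ht, hx.1, by linarith [hx.2]⟩ ?_
    · intro w hw
      have h1 := (hasFDerivAt_average hY σ t₀ w).continuousAt
      have h2 := (hasFDerivAt_penalty (A := C * σ ^ 2 + 3 * δ) (B := B) (K := K) (δ := δ)
        (X₀ := X₀) (t₀ := t₀) hw.1.2 hw.2.1).continuousAt
      exact ((hU.lip.continuous.continuousAt.sub h1).sub h2).continuousWithinAt
    · intro w hw
      have h1 := hUV w hw
      have h2 := mul_le_mul_of_nonneg_left (hξX w.1 hw.1) hL0
      have h3 := hΦ1 w hw
      have h4 := hΦ2 w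
      simp only [hΦ]
      linarith
    · intro y hy
      have hw : ((t₀, y) : ℝ × ℝ) ∈ Ico t₀ t₂ ×ˢ Ioc 0 (X₀ + 2) := ⟨⟨le_rfl, h02⟩, hy⟩
      have h1 := hUV _ hw
      have h3 := hΦ1 _ hw
      have h4 := hΦ2 (t₀, y)
      have h5 := hΦ3 _ hw
      have h6 := hΦ4 _ hw
      simp only [hΦ]
      simp only [sub_self, mul_zero, zero_add] at h1 h3 h4 h5 h6 ⊢
      linarith
    · intro r hr
      have hw : ((r, X₀ + 2) : ℝ × ℝ) ∈ Ico t₀ t₂ ×ˢ Ioc 0 (X₀ + 2) :=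
        ⟨hr, by linarith, le_rfl⟩
      have h1 := hUV _ hw
      have h2 := mul_le_mul_of_nonneg_left (hξX r hr) hL0
      have h3 := hΦ1 _ hw
      have h5 := hΦ3 _ hw
      have h7 : 1 ≤ max (X₀ + 2 - X₀ + K * (r - t₂)) 0 := by
        refine le_max_of_le_left ?_
        have : K * (t₂ - r) ≤ K * (t₂ - t₀) := mul_le_mul_of_nonneg_left (by linarith [hr.1]) hK0
        linarith
      have h8 : B ≤ B * max (X₀ + 2 - X₀ + K * (r - t₂)) 0 ^ 2 :=
        le_mul_of_one_le_right hB0.le (one_le_pow₀ h7)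
      simp only [hΦ]
      simp only at h1 h3 h5
      linarith
    · have h1 : max (x - X₀ + K * (t - t₂)) 0 = 0 := by
        refine max_eq_right ?_
        have : K * (t - t₂) ≤ 0 := mul_nonpos_of_nonneg_of_nonpos hK0 (by linarith [ht.2])
        linarith [hx.2]
      simp only [hV, hΦ, h1]
      linarith
  -- the derivatives at the maximum
  have hzQ : z ∈ Ioo 0 T ×ˢ Ioo 0 X :=
    ⟨⟨ht₀.trans hz.1.1, hz.1.2.trans ht₂⟩, hz.2.1, by linarith [hz.2.2]⟩
  set ξ : ℝ := σ * (z.1 - t₀) with hξ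
  set s : ℝ := max (z.2 - X₀ + K * (z.1 - t₂)) 0 with hs
  have hs0 : 0 ≤ s := le_max_right _ _
  have hs2 : s ≤ 2 := by
    refine max_le ?_ (by norm_num)
    have : K * (z.1 - t₂) ≤ 0 := mul_nonpos_of_nonneg_of_nonpos hK0 (by linarith [hz.1.2])
    linarith [hz.2.2]
  have dV := hasFDerivAt_average hY σ t₀ z
  have dΦ := hasFDerivAt_penalty (A := C * σ ^ 2 + 3 * δ) (B := B) (K := K) (δ := δ)
    (X₀ := X₀) (t₀ := t₀) hz.1.2 hz.2.1
  rw [← hs] at dΦ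
  rw [← hξ] at dV
  set bV := (fderiv ℝ Y (z.1, z.2 + ξ) (1, σ) + fderiv ℝ Y (z.1, z.2 - ξ) (1, -σ)) / 2 with hbV
  set kV := (fderiv ℝ Y (z.1, z.2 + ξ) (0, 1) + fderiv ℝ Y (z.1, z.2 - ξ) (0, 1)) / 2 with hkV
  set Φt := C * σ ^ 2 + 3 * δ + 2 * B * K * s + δ / (t₂ - z.1) ^ 2 with hΦt
  set Φx := 2 * B * s - δ / z.2 with hΦx
  have dP : HasFDerivAt (fun w => V w + Φ w) ((bV + Φt) • ContinuousLinearMap.fst ℝ ℝ ℝ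
      + (kV + Φx) • ContinuousLinearMap.snd ℝ ℝ ℝ) z := by
    refine (dV.add dΦ).congr_fderiv ?_
    rw [add_smul bV, add_smul kV]
    exact add_add_add_comm (bV • ContinuousLinearMap.fst ℝ ℝ ℝ) _ _ _
  have hnear : ∀ᶠ w in 𝓝 z, U w - (V w + Φ w) ≤ U z - (V z + Φ z) := by
    filter_upwards [(isOpen_Ioo.prod isOpen_Ioo).mem_nhds hz] with w hw
    have := hmax w ⟨Ioo_subset_Ico_self hw.1, Ioo_subset_Ioc_self hw.2⟩
    linarith
  obtain ⟨hk0, hb⟩ := hU.touching hu hzQ dP hnear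
  have hδx : 0 < δ / z.2 := div_pos hδ hz.2.1
  have hkV' : kV ≤ L := by
    have h1 := (abs_le.1 (hYx (z.1, z.2 + ξ))).2
    have h2 := (abs_le.1 (hYx (z.1, z.2 - ξ))).2
    rw [hkV]; linarith
  have hBs : B * s ≤ 2 * B := by nlinarith
  have hkL : kV + Φx ≤ L + 4 * B := by rw [hΦx]; linarith
  have hg := abs_le.1 (hG z.2 hzQ.2)
  have hξ0 : 0 ≤ ξ := mul_nonneg hσ (by linarith [hz.1.1])
  have hξX' : ξ ≤ X₀ := hξX z.1 ⟨hz.1.1.le, hz.1.2⟩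
  have hξτ : ξ ≤ σ * (t₂ - t₀) := mul_le_mul_of_nonneg_left (by linarith [hz.1.2]) hσ
  set k := kV + Φx with hk
  set v := drift z.2 - 2 * k with hv
  have lin : ∀ y τ : ℝ, fderiv ℝ Y (z.1, y) (1, τ) + v * fderiv ℝ Y (z.1, y) (0, 1)
      = fderiv ℝ Y (z.1, y) (1, v + τ) := by
    intro y τ
    have : ((1, v + τ) : ℝ × ℝ) = (1, τ) + v • (0, 1) := by simp [add_comm]
    rw [this, map_add, map_smul, smul_eq_mul]
  have g₁ := hYs z.1 hz.1 (z.2 + ξ) ⟨by linarith [hz.2.1], by linarith [hz.2.2]⟩ (v + σ) (by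
    rw [abs_le]; constructor <;> linarith)
  have g₂ := hYs z.1 hz.1 (z.2 - ξ) ⟨by linarith [hz.2.1], by linarith [hz.2.2]⟩ (v - σ) (by
    rw [abs_le]; constructor <;> linarith)
  have d₁ : drift (z.2 + ξ) = drift z.2 + (2 - 2 * z.2) * ξ - ξ ^ 2 := by unfold drift; ring
  have d₂ : drift (z.2 - ξ) = drift z.2 - (2 - 2 * z.2) * ξ - ξ ^ 2 := by unfold drift; ring
  rw [d₁] at g₁
  rw [d₂] at g₂
  refine comparison_contradiction hv hk0 hb g₁ g₂ ?_ ?_ (Φx := Φx)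
  · have l₁ := lin (z.2 + ξ) σ
    have l₂ := lin (z.2 - ξ) (-σ)
    rw [← sub_eq_add_neg] at l₂
    rw [← l₁, ← l₂, hk, hbV, hkV]
    ring
  · exact penalty_dominates hz.2.1 hzQ.2.2.le hσ hξ0 hξX' hξτ hC hδ he hk0 hB0.le hs0
      (by linarith) (pow_pos (sub_pos.2 hz.1.2) 2)

end

/-! ### Semiconvexity of the potential -/

section

variable {T M X : ℝ} {u U : ℝ × ℝ → ℝ} {L : NNReal}

theorem abs_drift_le {x X : ℝ} (hx : |x| ≤ X) : |drift x| ≤ 2 * X + X ^ 2 := by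
  unfold drift
  refine (abs_sub _ _).trans ?_
  have h3 := pow_le_pow_left₀ (abs_nonneg x) hx 2
  rw [abs_mul, abs_two, abs_pow]
  linarith

theorem sq_sub_drift_le {x y v X N r : ℝ} (hX : 0 ≤ X) (hx : |x| ≤ X) (hy : |y - x| < r)
    (hr : r ≤ 1) (hv : |v| ≤ N) : (v - drift y) ^ 2 ≤ (v - drift x) ^ 2
      + (2 * X + 3) * (2 * N + 2 * (2 * (X + 1) + (X + 1) ^ 2)) * r := by
  have hyX : |y| ≤ X + 1 := by
    have : y = (y - x) + x := by ring
    rw [this]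
    exact (abs_add_le _ _).trans (by linarith)
  have h1 := abs_le.1 (abs_drift_le (hx.trans (by linarith : X ≤ X + 1)))
  have h2 := abs_le.1 (abs_drift_le hyX)
  have h3 := abs_le.1 hv
  have h4 : |2 * v - drift x - drift y| ≤ 2 * N + 2 * (2 * (X + 1) + (X + 1) ^ 2) := by
    rw [abs_le]; constructor <;> linarith
  have h5 : |2 - y - x| ≤ 2 * X + 3 := by
    have h6 := abs_le.1 hyX
    have h7 := abs_le.1 hx
    rw [abs_le]; constructor <;> linarith
  have h6 : (v - drift y) ^ 2 - (v - drift x) ^ 2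
      = -((2 - y - x) * (2 * v - drift x - drift y) * (y - x)) := by unfold drift; ring
  have h7 : |(2 - y - x) * (2 * v - drift x - drift y) * (y - x)|
      ≤ (2 * X + 3) * (2 * N + 2 * (2 * (X + 1) + (X + 1) ^ 2)) * r := by
    rw [abs_mul, abs_mul]
    have := (abs_nonneg _).trans h5
    have := (abs_nonneg _).trans h4
    exact mul_le_mul (mul_le_mul h5 h4 (abs_nonneg _) (by positivity)) hy.le (abs_nonneg _)
      (by positivity)
  have h8 := neg_le_abs ((2 - y - x) * (2 * v - drift x - drift y) * (y - x))
  linarith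

set_option maxHeartbeats 1000000 in
/-- A one-sided bound for the second differences of the potential in `x`, uniform in time away from
`t = 0`: comparison on `[t - τ, t + θ)` with the translates at speed `σ = ξ / τ`, which at the time
`t` are displaced by exactly `±ξ`. The error `C₁ σ² τ` is then `(C₁ / τ) ξ²`, and the remaining
errors vanish with the radius of mollification. -/
theorem IsPotential.exists_midpoint_le {X₀ : ℝ} (hU : IsPotential T (2 * X₀ + 3) u U L)
    (hu : IsRep T M u) (hX₀ : 0 < X₀) {t' : ℝ} (ht' : t' ∈ Ioo 0 T) :
    ∃ C, ∀ t ∈ Ico t' T, ∀ x ∈ Ioo 0 X₀, ∀ ξ ∈ Ioo 0 x,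
      U (t, x) ≤ (U (t, x + ξ) + U (t, x - ξ)) / 2 + C * ξ ^ 2 := by
  set X : ℝ := 2 * X₀ + 3 with hX
  have hL0 : (0 : ℝ) ≤ L := L.2
  set G : ℝ := 2 * X + X ^ 2 with hG
  have hXpos : 0 < X := by rw [hX]; linarith
  have hGpos : 0 < G := by positivity
  set B : ℝ := L * X₀ + 1 with hB
  have hBpos : 0 < B := by positivity
  set K : ℝ := 2 * L + 8 * B + G with hK
  have hKpos : 0 < K := by positivity
  set τ : ℝ := min (t' / 2) (1 / (2 * K)) with hτ
  have hτpos : 0 < τ := lt_min (half_pos ht'.1) (by positivity)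
  have hτt : τ ≤ t' / 2 := min_le_left _ _
  have hτK : K * (2 * τ) ≤ 1 := by
    have : τ ≤ 1 / (2 * K) := min_le_right _ _
    rw [le_div_iff₀ (by positivity)] at this
    linarith
  set C₁ : ℝ := (1 + (2 + 2 * X) * T) ^ 2 / 4 + X₀ ^ 2 * T ^ 2 / 4 with hC₁
  refine ⟨C₁ / τ, fun t ht x hx ξ hξ => ?_⟩
  -- `θ` leaves room after `t` while the displacement `σ (t₂ - t₀)` stays below `X₀`
  have hξX : 0 < X₀ - ξ := by linarith [hξ.2, hx.2]
  have hξ0 := hξ.1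
  set θ : ℝ := min ((T - t) / 2) (min τ (τ * (X₀ - ξ) / ξ)) with hθ
  have hθpos : 0 < θ :=
    lt_min (by linarith [ht.2]) (lt_min hτpos (by positivity))
  have hθ1 : θ ≤ (T - t) / 2 := min_le_left _ _
  have hθ2 : θ ≤ τ := (min_le_right _ _).trans (min_le_left _ _)
  have hθ3 : θ ≤ τ * (X₀ - ξ) / ξ := (min_le_right _ _).trans (min_le_right _ _)
  set σ : ℝ := ξ / τ with hσ
  have hσpos : 0 < σ := by positivity
  have hστ : σ * τ = ξ := by rw [hσ]; field_simp
  set t₀ : ℝ := t - τ with ht₀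
  set t₂ : ℝ := t + θ with ht₂
  have hdiff : t₂ - t₀ = τ + θ := by rw [ht₂, ht₀]; ring
  have hσX : σ * (t₂ - t₀) ≤ X₀ := by
    rw [hdiff, mul_add, hστ]
    have : σ * θ ≤ σ * (τ * (X₀ - ξ) / ξ) := mul_le_mul_of_nonneg_left hθ3 hσpos.le
    have h2 : σ * (τ * (X₀ - ξ) / ξ) = X₀ - ξ := by rw [hσ]; field_simp
    linarith
  have ht₀pos : 0 < t₀ := by rw [ht₀]; linarith [ht.1, ht'.1]
  have ht₂T : t₂ < T := by rw [ht₂]; linarith [ht.2]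
  set N : ℝ := G + 2 * (L + 4 * B) + σ with hN
  have hNpos : 0 < N := by positivity
  set E : ℝ := (2 * X + 3) * (2 * N + 2 * (2 * (X + 1) + (X + 1) ^ 2)) with hE
  have hEpos : 0 < E := by positivity
  have hdT : t₂ - t₀ ≤ T := by rw [hdiff]; linarith [ht'.2]
  have hd0 : 0 ≤ t₂ - t₀ := by rw [hdiff]; positivity
  have hC : (1 + (2 + 2 * X) * (t₂ - t₀)) ^ 2 / 4 + X₀ ^ 2 * (t₂ - t₀) ^ 2 / 4 ≤ C₁ := by
    rw [hC₁]; gcongr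
  set Z : ℝ := (L : ℝ) + ((E + 1) * (3 * (t - t₀) - Real.log x + 1 / (t₂ - t)
    + Real.log (X₀ + 2)) + L) with hZ
  have hj : ∀ᶠ j in atTop, U (t, x) ≤ (U (t, x + ξ) + U (t, x - ξ)) / 2 + C₁ / τ * ξ ^ 2
      + radius j * Z := by
    filter_upwards [tendsto_radius.eventually (gt_mem_nhds ht₀pos),
      tendsto_radius.eventually (gt_mem_nhds (sub_pos.2 ht₂T))] with j j1 j2
    have hr := radius_pos j
    have hr1 := radius_le_one j
    have hmolU := abs_mol_sub_le j (lipschitzWith_extendLeft hU.lip)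
    have key := hU.le_average_of_supersolution hu (Y := mol j (extendLeft U)) (t₀ := t₀) (t₂ := t₂)
      (σ := σ) (e₁ := L * radius j) (e₂ := E * radius j / 4) (δ := (E + 1) * radius j) (G := G)
      (B := B) (K := K) (N := N) (C := C₁) (t := t) (x := x) hX₀ hX ht₀pos (by linarith) ht₂T
      hσpos.le hσX
      (fun y hy => abs_drift_le (by rw [abs_of_pos hy.1]; exact hy.2.le)) le_rfl le_rfl
      (by rw [hdiff]; exact le_trans (mul_le_mul_of_nonneg_left (by linarith) hKpos.le) hτK)
      le_rfl hC
      ((mol_contDiff j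
        (lipschitzWith_extendLeft hU.lip).continuous.locallyIntegrable).differentiable (by simp))
      (fun z => by
        simpa [Prod.norm_def] using
          abs_fderiv_mol_apply_le j (lipschitzWith_extendLeft hU.lip) z (0, 1))
      hmolU ?_ (by positivity) (by nlinarith) ⟨by linarith, by linarith⟩ ⟨hx.1, hx.2.le⟩
    · have ht₀t : t - t₀ = τ := by rw [ht₀]; ring
      rw [ht₀t, hστ] at key
      have m1 := (abs_le.1 (hmolU (t, x + ξ))).2
      have m2 := (abs_le.1 (hmolU (t, x - ξ))).2
      rw [extendLeft_of_nonneg (by linarith [hx.1])] at m1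
      rw [extendLeft_of_nonneg (by linarith [hξ.2])] at m2
      have e1 : C₁ * σ ^ 2 * τ = C₁ / τ * ξ ^ 2 := by rw [hσ]; field_simp
      have e2 : radius j * Z = L * radius j + (3 * ((E + 1) * radius j) * τ
          - (E + 1) * radius j * Real.log x + (E + 1) * radius j / (t₂ - t)
          + (E + 1) * radius j * Real.log (X₀ + 2) + L * radius j) := by
        rw [hZ, ht₀t]; ring
      linarith
    · intro s hs y hy v hv
      have hyX : |y| ≤ X := abs_le.2 ⟨hy.1, by linarith [hy.2]⟩
      have := hU.le_fderiv_mol_extendLeft hu hXpos (j := j) (z := (s, y)) (v := v)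
        (c := (v - drift y) ^ 2 + E * radius j) (by linarith [hs.1]) (by linarith [hs.2])
        (by linarith [hy.2]) (fun r hr' => sq_sub_drift_le hXpos.le hyX hr' hr1 hv)
      linarith
  have hlim : Tendsto (fun j => (U (t, x + ξ) + U (t, x - ξ)) / 2 + C₁ / τ * ξ ^ 2
      + radius j * Z) atTop (𝓝 ((U (t, x + ξ) + U (t, x - ξ)) / 2 + C₁ / τ * ξ ^ 2 + 0 * Z)) :=
    (tendsto_radius.mul_const Z).const_add _
  rw [zero_mul, add_zero] at hlim
  exact ge_of_tendsto hlim hj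

/-- A continuous function with strict midpoint convexity is convex: its difference to a chord cannot
have a positive interior maximum. -/
theorem convexOn_of_midpoint_lt {f : ℝ → ℝ} {a b : ℝ} (hf : ContinuousOn f (Ioo a b))
    (h : ∀ x ξ, 0 < ξ → x - ξ ∈ Ioo a b → x + ξ ∈ Ioo a b →
      f x < (f (x + ξ) + f (x - ξ)) / 2) : ConvexOn ℝ (Ioo a b) f := by
  refine LinearOrder.convexOn_of_lt (convex_Ioo a b) fun x hx y hy hxy p q hp hq hpq => ?_
  set s : ℝ := (f y - f x) / (y - x) with hs
  set g : ℝ → ℝ := fun z => f z - (f x + s * (z - x)) with hg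
  have hsub : Icc x y ⊆ Ioo a b := fun z hz => ⟨hx.1.trans_le hz.1, hz.2.trans_lt hy.2⟩
  have gx : g x = 0 := by simp [hg]
  have gy : g y = 0 := by
    have : y - x ≠ 0 := (sub_pos.2 hxy).ne'
    simp only [hg, hs]; field_simp; ring
  obtain ⟨c, hc, hmax⟩ := isCompact_Icc.exists_isMaxOn (nonempty_Icc.2 hxy.le)
    (show ContinuousOn g (Icc x y) from (hf.mono hsub).sub (by fun_prop))
  have hgc : g c ≤ 0 := by
    by_contra hpos
    push Not at hpos
    have hcx : x < c := lt_of_le_of_ne hc.1 fun h => by rw [← h, gx] at hpos; exact lt_irrefl _ hpos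
    have hcy : c < y := lt_of_le_of_ne hc.2 fun h => by rw [h, gy] at hpos; exact lt_irrefl _ hpos
    set ξ := min (c - x) (y - c) with hξ
    have h1 : 0 < ξ := lt_min (by linarith) (by linarith)
    have h2 : ξ ≤ c - x := min_le_left _ _
    have h3 : ξ ≤ y - c := min_le_right _ _
    have m1 : c + ξ ∈ Icc x y := ⟨by linarith, by linarith⟩
    have m2 : c - ξ ∈ Icc x y := ⟨by linarith, by linarith⟩
    have h4 := h c ξ h1 (hsub m2) (hsub m1)
    have h5 : g (c + ξ) ≤ g c := hmax m1
    have h6 : g (c - ξ) ≤ g c := hmax m2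
    simp only [hg] at h5 h6
    linarith
  have hz : p • x + q • y ∈ Icc x y := by
    simp only [smul_eq_mul]
    have : p = 1 - q := by linarith
    subst this
    constructor <;> nlinarith
  have h1 : g (p • x + q • y) ≤ 0 := (hmax hz).trans hgc
  have h2 : s * (p * x + q * y - x) = q * (f y - f x) := by
    have hne : y - x ≠ 0 := (sub_pos.2 hxy).ne'
    have : p = 1 - q := by linarith
    rw [hs, this]; field_simp; ring
  simp only [hg, smul_eq_mul] at h1 ⊢
  rw [h2] at h1
  have : p = 1 - q := by linarith
  rw [this] at h1 ⊢
  linarith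

/-- Semiconvexity of the potential, up to `x = 0` and up to and including the final time. -/
theorem IsPotential.exists_convexOn {X₀ : ℝ} (hU : IsPotential T (2 * X₀ + 3) u U L)
    (hu : IsRep T M u) (hX₀ : 0 < X₀) {t' : ℝ} (ht' : t' ∈ Ioo 0 T) :
    ∃ C, ∀ t ∈ Icc t' T, ConvexOn ℝ (Ioo 0 X₀) fun x => U (t, x) + C * x ^ 2 := by
  obtain ⟨C, hC⟩ := hU.exists_midpoint_le hu hX₀ ht'
  refine ⟨C + 1, fun t ht => convexOn_of_midpoint_lt ?_ fun x ξ hξ h1 h2 => ?_⟩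
  · have := continuous_left_of_lipschitz hU.lip t
    exact (this.add (by fun_prop)).continuousOn
  · have hcl : IsClosed {t | U (t, x) ≤ (U (t, x + ξ) + U (t, x - ξ)) / 2 + C * ξ ^ 2} := by
      have c := continuous_right_of_lipschitz hU.lip
      exact isClosed_le (c x) ((((c _).add (c _)).div_const 2).add continuous_const)
    have hsub : Ico t' T ⊆ {t | U (t, x) ≤ (U (t, x + ξ) + U (t, x - ξ)) / 2 + C * ξ ^ 2} :=
      fun s hs => hC s hs x ⟨by linarith [h1.1], by linarith [h2.2]⟩ ξ ⟨hξ, by linarith [h1.1]⟩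
    rw [← hcl.closure_subset_iff, closure_Ico ht'.2.ne] at hsub
    have := hsub ht
    simp only [mem_ofPred_eq] at this
    have : 0 < ξ ^ 2 := by positivity
    linarith

end

/-! ### One-sided derivatives of semiconvex functions -/

section Semiconvex

variable {f : ℝ → ℝ} {C X : ℝ}

theorem hasDerivWithinAt_of_semiconvex (hf : ConvexOn ℝ (Ioo 0 X) fun x => f x + C * x ^ 2)
    {x : ℝ} (hx : x ∈ Ioo 0 X) : HasDerivWithinAt f
      (derivWithin (fun x => f x + C * x ^ 2) (Ioi x) x - 2 * C * x) (Ioi x) x := by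
  have h1 := hf.hasDerivWithinAt_rightDeriv_of_mem_interior (by rwa [interior_Ioo])
  have h2 : HasDerivWithinAt (fun x : ℝ => C * x ^ 2) (2 * C * x) (Ioi x) x := by
    refine (((hasDerivAt_pow 2 x).const_mul C).congr_deriv ?_).hasDerivWithinAt
    push_cast; ring
  refine (h1.sub h2).congr_of_eventuallyEq (Eventually.of_forall fun y => ?_) ?_ <;> simp

theorem derivWithin_of_semiconvex (hf : ConvexOn ℝ (Ioo 0 X) fun x => f x + C * x ^ 2)
    {x : ℝ} (hx : x ∈ Ioo 0 X) : derivWithin f (Ioi x) x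
      = derivWithin (fun x => f x + C * x ^ 2) (Ioi x) x - 2 * C * x :=
  (hasDerivWithinAt_of_semiconvex hf hx).derivWithin (uniqueDiffWithinAt_Ioi x)

theorem abs_derivWithin_of_semiconvex_le (hf : ConvexOn ℝ (Ioo 0 X) fun x => f x + C * x ^ 2)
    {L : NNReal} (hL : LipschitzWith L f) {x : ℝ} (hx : x ∈ Ioo 0 X) :
    |derivWithin f (Ioi x) x| ≤ L := by
  rw [derivWithin_of_semiconvex hf hx]
  have h := (hasDerivWithinAt_iff_tendsto_slope' (self_notMem_Ioi (a := x))).1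
    (hasDerivWithinAt_of_semiconvex hf hx)
  refine le_of_tendsto h.abs ?_
  filter_upwards [self_mem_nhdsWithin] with y hy
  have h1 := hL.dist_le_mul y x
  have hyx : 0 < y - x := sub_pos.2 hy
  rw [Real.dist_eq, Real.dist_eq, abs_of_pos hyx] at h1
  rw [slope_def_field, abs_div, abs_of_pos hyx, div_le_iff₀ hyx]
  exact h1

theorem exists_bound_of_semiconvex (hf : ConvexOn ℝ (Ioo 0 X) fun x => f x + C * x ^ 2)
    {L : NNReal} (hL : LipschitzWith L f) : ∃ c, ∀ x ∈ Ioo 0 X,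
      |derivWithin (fun x => f x + C * x ^ 2) (Ioi x) x| ≤ c := by
  refine ⟨L + 2 * |C| * X, fun x hx => ?_⟩
  have h1 := abs_derivWithin_of_semiconvex_le hf hL hx
  have h2 : derivWithin (fun x => f x + C * x ^ 2) (Ioi x) x
      = derivWithin f (Ioi x) x + 2 * C * x := by rw [derivWithin_of_semiconvex hf hx]; ring
  rw [h2]
  refine (abs_add_le _ _).trans (add_le_add h1 ?_)
  rw [abs_mul, abs_mul, abs_two, abs_of_pos hx.1]
  exact mul_le_mul_of_nonneg_left hx.2.le (by positivity)

theorem exists_tendsto_rightDeriv_nhdsGT (hf : ConvexOn ℝ (Ioo 0 X) fun x => f x + C * x ^ 2)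
    {L : NNReal} (hL : LipschitzWith L f) {x : ℝ} (hx : x ∈ Ico 0 X) :
    ∃ c, Tendsto (fun y => derivWithin f (Ioi y) y) (𝓝[>] x) (𝓝 c) := by
  obtain ⟨c, hc⟩ := exists_bound_of_semiconvex hf hL
  have hsub : Ioo x X ⊆ Ioo 0 X := Ioo_subset_Ioo_left hx.1
  have hm := hf.monotoneOn_rightDeriv
  rw [interior_Ioo] at hm
  have h1 := (hm.mono hsub).tendsto_nhdsWithin_Ioo_right (nonempty_Ioo.2 hx.2) (by
    refine ⟨-c, ?_⟩
    rintro _ ⟨y, hy, rfl⟩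
    exact (abs_le.1 (hc y (hsub hy))).1)
  have h2 : Tendsto (fun y : ℝ => 2 * C * y) (𝓝[>] x) (𝓝 (2 * C * x)) :=
    ((continuous_const.mul continuous_id).tendsto x).mono_left nhdsWithin_le_nhds
  refine ⟨_, (h1.sub h2).congr' ?_⟩
  filter_upwards [Ioo_mem_nhdsGT hx.2] with y hy
  exact (derivWithin_of_semiconvex hf (hsub hy)).symm

theorem exists_tendsto_rightDeriv_nhdsLT (hf : ConvexOn ℝ (Ioo 0 X) fun x => f x + C * x ^ 2)
    {L : NNReal} (hL : LipschitzWith L f) {x : ℝ} (hx : x ∈ Ioc 0 X) :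
    ∃ c, Tendsto (fun y => derivWithin f (Ioi y) y) (𝓝[<] x) (𝓝 c) := by
  obtain ⟨c, hc⟩ := exists_bound_of_semiconvex hf hL
  have hsub : Ioo 0 x ⊆ Ioo 0 X := Ioo_subset_Ioo_right hx.2
  have hm := hf.monotoneOn_rightDeriv
  rw [interior_Ioo] at hm
  have h1 := (hm.mono hsub).tendsto_nhdsWithin_Ioo_left (nonempty_Ioo.2 hx.1) (by
    refine ⟨c, ?_⟩
    rintro _ ⟨y, hy, rfl⟩
    exact (abs_le.1 (hc y (hsub hy))).2)
  have h2 : Tendsto (fun y : ℝ => 2 * C * y) (𝓝[<] x) (𝓝 (2 * C * x)) :=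
    ((continuous_const.mul continuous_id).tendsto x).mono_left nhdsWithin_le_nhds
  refine ⟨_, (h1.sub h2).congr' ?_⟩
  filter_upwards [Ioo_mem_nhdsLT hx.1] with y hy
  exact (derivWithin_of_semiconvex hf (hsub hy)).symm

end Semiconvex

/-- One-sided derivatives of uniformly semiconvex functions `U t` converge, as `t → t₁`, at every
point where the limit function is differentiable. -/
theorem tendsto_rightDeriv_of_semiconvex {U : ℝ → ℝ → ℝ} {C X x d t₁ : ℝ} {l : Filter ℝ}
    (hl : l ≤ 𝓝 t₁) (hU : ∀ x, Continuous fun t => U t x)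
    (hf : ∀ᶠ t in l, ConvexOn ℝ (Ioo 0 X) fun x => U t x + C * x ^ 2)
    (hx : x ∈ Ioo 0 X) (hd : HasDerivAt (U t₁) d x) :
    Tendsto (fun t => derivWithin (U t) (Ioi x) x) l (𝓝 d) := by
  set F : ℝ → ℝ → ℝ := fun t x => U t x + C * x ^ 2 with hF
  have hFc : ∀ x, Continuous fun t => F t x := fun x => (hU x).add continuous_const
  have hFd : HasDerivAt (F t₁) (d + 2 * C * x) x := by
    refine hd.add (((hasDerivAt_pow 2 x).const_mul C).congr_deriv ?_)
    push_cast; ring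
  have hsl : ∀ y, Tendsto (fun t => slope (F t) x y) l (𝓝 (slope (F t₁) x y)) := by
    intro y
    simp only [slope_def_field]
    exact ((((hFc y).sub (hFc x)).div_const _).tendsto t₁).mono_left hl
  have hs := hasDerivAt_iff_tendsto_slope.1 hFd
  suffices h : Tendsto (fun t => derivWithin (F t) (Ioi x) x) l (𝓝 (d + 2 * C * x)) by
    have h2 := h.sub_const (2 * C * x)
    rw [add_sub_cancel_right] at h2
    refine h2.congr' ?_
    filter_upwards [hf] with t ht
    exact (derivWithin_of_semiconvex ht hx).symm
  refine tendsto_order.2 ⟨fun a ha => ?_, fun a ha => ?_⟩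
  · have h1 : ∀ᶠ y in 𝓝[<] x, a < slope (F t₁) x y ∧ y ∈ Ioo 0 x :=
      ((hs.mono_left (nhdsWithin_mono x fun y hy => ne_of_lt hy)).eventually
        (lt_mem_nhds ha)).and (Ioo_mem_nhdsLT hx.1)
    obtain ⟨y, hy1, hy2⟩ := h1.exists
    filter_upwards [hf, (hsl y).eventually (lt_mem_nhds hy1)] with t ht h2
    have hxi : x ∈ interior (Ioo 0 X) := by rwa [interior_Ioo]
    have h3 := ht.slope_le_leftDeriv_of_mem_interior ⟨hy2.1, hy2.2.trans hx.2⟩ hxi hy2.2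
    rw [slope_comm] at h3
    exact h2.trans_le (h3.trans (ht.leftDeriv_le_rightDeriv_of_mem_interior hxi))
  · have h1 : ∀ᶠ y in 𝓝[>] x, slope (F t₁) x y < a ∧ y ∈ Ioo x X :=
      ((hs.mono_left (nhdsWithin_mono x fun y hy => ne_of_gt hy)).eventually
        (gt_mem_nhds ha)).and (Ioo_mem_nhdsGT hx.2)
    obtain ⟨y, hy1, hy2⟩ := h1.exists
    filter_upwards [hf, (hsl y).eventually (gt_mem_nhds hy1)] with t ht h2
    have hxi : x ∈ interior (Ioo 0 X) := by rwa [interior_Ioo]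
    exact (ht.rightDeriv_le_slope_of_mem_interior hxi ⟨hx.1.trans hy2.1, hy2.2⟩ hy2.1).trans_lt h2

/-! ### Existence of traces -/

/-- A bounded family `v s` that coincides almost everywhere, for every `s ∈ G`, with a family `D s`
converging pointwise along `l`, converges in `L¹`. The filter `l ⊓ 𝓟 G` is countably generated,
unlike `l ⊓ ae volume`, so that dominated convergence applies. -/
theorem exists_tendsto_lintegral_sub {μ : Measure ℝ} [IsFiniteMeasure μ] {v D : ℝ → ℝ → ℝ} {M : ℝ}
    (mv : ∀ s, Measurable (v s)) (v0 : ∀ s y, 0 ≤ v s y) (vM : ∀ s y, v s y ≤ M)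
    {l : Filter ℝ} [l.IsCountablyGenerated] {G : Set ℝ} (hl : (l ⊓ 𝓟 G).NeBot)
    (hG : ∀ s ∈ G, D s =ᵐ[μ] v s)
    (hD : ∀ᵐ y ∂μ, ∃ c, Tendsto (fun s => D s y) l (𝓝 c)) :
    ∃ γ : ℝ → ℝ, Measurable γ ∧ (∀ y, 0 ≤ γ y ∧ γ y ≤ M) ∧
      Tendsto (fun s => ∫⁻ y, ‖v s y - γ y‖ₑ ∂μ) (l ⊓ 𝓟 G) (𝓝 0) := by
  have hM : 0 ≤ M := (v0 0 0).trans (vM 0 0)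
  classical
  set γ₀ : ℝ → ℝ := fun y => if h : ∃ c, Tendsto (fun s => D s y) l (𝓝 c) then h.choose else 0
    with hγ₀
  have hγ₀' : ∀ᵐ y ∂μ, Tendsto (fun s => D s y) l (𝓝 (γ₀ y)) := by
    filter_upwards [hD] with y hy
    simp only [hγ₀, dif_pos hy]
    exact hy.choose_spec
  obtain ⟨s, hs⟩ := exists_seq_tendsto (l ⊓ 𝓟 G)
  obtain ⟨hs1, hs2⟩ := tendsto_inf.1 hs
  have hs2' : ∀ᶠ k in atTop, s k ∈ G := tendsto_principal.1 hs2
  obtain ⟨k₀, hk₀⟩ := eventually_atTop.1 hs2'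
  have hsD : ∀ᵐ y ∂μ, ∀ k, k₀ ≤ k → D (s k) y = v (s k) y := by
    rw [ae_all_iff]
    intro k
    by_cases hk : k₀ ≤ k
    · filter_upwards [hG _ (hk₀ k hk)] with y hy _
      exact hy
    · exact Eventually.of_forall fun y h => absurd h hk
  have hsv : ∀ᵐ y ∂μ, Tendsto (fun k => v (s k) y) atTop (𝓝 (γ₀ y)) := by
    filter_upwards [hγ₀', hsD] with y h1 h2
    refine (h1.comp hs1).congr' ?_
    filter_upwards [eventually_ge_atTop k₀] with k hk
    exact h2 k hk
  have mγ₀ : AEStronglyMeasurable γ₀ μ :=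
    aestronglyMeasurable_of_tendsto_ae atTop (fun k => (mv (s k)).aestronglyMeasurable) hsv
  have bγ₀ : ∀ᵐ y ∂μ, 0 ≤ γ₀ y ∧ γ₀ y ≤ M := by
    filter_upwards [hsv] with y h1
    exact ⟨ge_of_tendsto' h1 fun k => v0 _ _, le_of_tendsto' h1 fun k => vM _ _⟩
  set γ : ℝ → ℝ := fun y => max 0 (min M (mγ₀.mk γ₀ y)) with hγ
  have hγγ₀ : γ =ᵐ[μ] γ₀ := by
    filter_upwards [mγ₀.ae_eq_mk, bγ₀] with y h1 h2
    simp only [hγ]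
    rw [← h1, min_eq_right h2.2, max_eq_right h2.1]
  have mγ : Measurable γ :=
    measurable_const.max (measurable_const.min mγ₀.stronglyMeasurable_mk.measurable)
  have bγ : ∀ y, 0 ≤ γ y ∧ γ y ≤ M := fun y => ⟨le_max_left _ _, max_le hM (min_le_left _ _)⟩
  refine ⟨γ, mγ, bγ, ?_⟩
  have key : Tendsto (fun s => ∫⁻ y, ‖D s y - γ y‖ₑ ∂μ) (l ⊓ 𝓟 G) (𝓝 0) := by
    have h0 : (0 : ENNReal) = ∫⁻ _, 0 ∂μ := by simp
    rw [h0]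
    refine tendsto_lintegral_filter_of_dominated_convergence' (fun _ => ENNReal.ofReal M)
      ?_ ?_ (by simp [ENNReal.mul_eq_top, measure_ne_top]) ?_
    · filter_upwards [mem_inf_of_right (mem_principal_self G)] with s hs
      refine AEMeasurable.enorm ?_
      exact ((mv s).aemeasurable.congr (hG s hs).symm).sub mγ.aemeasurable
    · filter_upwards [mem_inf_of_right (mem_principal_self G)] with s hs
      filter_upwards [hG s hs] with y hy
      rw [hy, Real.enorm_eq_ofReal_abs]
      refine ENNReal.ofReal_le_ofReal (abs_sub_le_of_nonneg_of_le (v0 s y) (vM s y) ?_ ?_)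
      · exact (bγ y).1
      · exact (bγ y).2
    · filter_upwards [hγ₀', hγγ₀] with y h1 h2
      rw [h2]
      have h3 := ((h1.mono_left (inf_le_left : l ⊓ 𝓟 G ≤ l)).sub_const (γ₀ y)).enorm
      simpa using h3
  refine key.congr' ?_
  filter_upwards [mem_inf_of_right (mem_principal_self G)] with s hs
  refine lintegral_congr_ae ?_
  filter_upwards [hG s hs] with y hy
  rw [hy]

theorem neBot_inf_ae {l : Filter ℝ} (h : ∀ s ∈ l, ∃ U, IsOpen U ∧ U.Nonempty ∧ U ⊆ s) :
    (l ⊓ ae (volume : Measure ℝ)).NeBot := by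
  refine inf_neBot_iff.2 fun {s} hs {s'} hs' => ?_
  obtain ⟨U, hU, ⟨x, hx⟩, hUs⟩ := h s hs
  have h1 := mem_closure_inter_of_ae (p := fun x => x ∈ s') hs' hU hx
  obtain ⟨y, hy1, hy2⟩ := closure_nonempty_iff.1 ⟨_, h1⟩
  exact ⟨y, hUs hy1, hy2⟩

theorem neBot_nhdsGT_inf_ae (x : ℝ) : (𝓝[>] x ⊓ ae (volume : Measure ℝ)).NeBot :=
  neBot_inf_ae fun s hs => by
    obtain ⟨b, hb, h⟩ := mem_nhdsGT_iff_exists_Ioo_subset.1 hs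
    exact ⟨_, isOpen_Ioo, nonempty_Ioo.2 hb, h⟩

theorem neBot_nhdsLT_inf_ae (x : ℝ) : (𝓝[<] x ⊓ ae (volume : Measure ℝ)).NeBot :=
  neBot_inf_ae fun s hs => by
    obtain ⟨b, hb, h⟩ := mem_nhdsLT_iff_exists_Ioo_subset.1 hs
    exact ⟨_, isOpen_Ioo, nonempty_Ioo.2 hb, h⟩

theorem nhds_inf_ae_le (x : ℝ) : 𝓝 x ⊓ ae (volume : Measure ℝ)
    ≤ (𝓝[<] x ⊓ ae volume) ⊔ (𝓝[>] x ⊓ ae volume) := by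
  rw [← inf_sup_right, nhdsLT_sup_nhdsGT]
  refine le_inf (le_inf inf_le_left (inf_le_right.trans ?_)) inf_le_right
  rw [le_principal_iff, mem_ae_iff, compl_compl]
  exact Real.volume_singleton

section

variable {T M X : ℝ} {u U : ℝ × ℝ → ℝ} {L : NNReal}

theorem IsPotential.ae_rightDeriv_eq (hU : IsPotential T X u U L) (hu : IsRep T M u) :
    ∀ᵐ z : ℝ × ℝ, z ∈ Ioo 0 T ×ˢ Ioo 0 X →
      derivWithin (fun y => U (z.1, y)) (Ioi z.2) z.2 = u z := by
  filter_upwards [hU.ae_lineDeriv_space hu, hU.lip.ae_differentiableAt] with z h1 h2 hz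
  have h3 : HasFDerivAt (fun y : ℝ => (z.1, y)) (ContinuousLinearMap.inr ℝ ℝ ℝ) z.2 :=
    hasFDerivAt_prodMk_right z.1 z.2
  have h4 : HasFDerivAt U (fderiv ℝ U z) (z.1, z.2) := h2.hasFDerivAt
  have h5 := (h4.comp z.2 h3).hasDerivAt
  rw [← h1 hz, h2.lineDeriv_eq_fderiv]
  have h6 := h5.hasDerivWithinAt.derivWithin (uniqueDiffWithinAt_Ioi z.2)
  simpa [Function.comp_def] using h6

theorem exists_tendsto_lintegral_sub_ae {μ : Measure ℝ} [IsFiniteMeasure μ] {v D : ℝ → ℝ → ℝ}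
    (mv : ∀ s, Measurable (v s)) (v0 : ∀ s y, 0 ≤ v s y) (vM : ∀ s y, v s y ≤ M)
    {l : Filter ℝ} [l.IsCountablyGenerated] (hl : (l ⊓ ae (volume : Measure ℝ)).NeBot)
    (hG : ∀ᶠ s in l ⊓ ae (volume : Measure ℝ), D s =ᵐ[μ] v s)
    (hD : ∀ᵐ y ∂μ, ∃ c, Tendsto (fun s => D s y) l (𝓝 c)) :
    ∃ γ : ℝ → ℝ, Measurable γ ∧ (∀ y, 0 ≤ γ y ∧ γ y ≤ M) ∧
      Tendsto (fun s => ∫⁻ y, ‖v s y - γ y‖ₑ ∂μ) (l ⊓ ae volume) (𝓝 0) := by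
  have hle : l ⊓ ae (volume : Measure ℝ) ≤ l ⊓ 𝓟 {s | D s =ᵐ[μ] v s} :=
    le_inf inf_le_left (le_principal_iff.2 hG)
  obtain ⟨γ, h1, h2, h3⟩ := exists_tendsto_lintegral_sub mv v0 vM (hl.mono hle)
    (fun s hs => hs) hD
  exact ⟨γ, h1, h2, h3.mono_left hle⟩

/-- A trace along a filter of positions exists as soon as the right derivatives of semiconvex
functions converge along that filter. -/
theorem IsRep.exists_spaceTrace (hu : IsRep T M u) (hT : 0 < T) {l : Filter ℝ}
    [l.IsCountablyGenerated] (hl : (l ⊓ ae (volume : Measure ℝ)).NeBot) {X₀ : ℝ} (hX₀ : 0 < X₀)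
    (hlX : Ioo 0 X₀ ∈ l)
    (hlim : ∀ ⦃f : ℝ → ℝ⦄ ⦃C : ℝ⦄ ⦃L : NNReal⦄,
      (ConvexOn ℝ (Ioo 0 X₀) fun x => f x + C * x ^ 2) → LipschitzWith L f →
      ∃ c, Tendsto (fun y => derivWithin f (Ioi y) y) l (𝓝 c)) :
    ∃ γ : ℝ → ℝ, Measurable γ ∧ (∀ y, 0 ≤ γ y ∧ γ y ≤ M) ∧
      HasSpaceTrace T (fun t x => u (t, x)) l γ := by
  obtain ⟨U, L, hU⟩ := hu.exists_potential hT (show 0 < 2 * X₀ + 3 by linarith)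
  refine exists_tendsto_lintegral_sub_ae (v := fun x t => u (t, x))
    (D := fun x t => derivWithin (fun y => U (t, y)) (Ioi x) x)
    (fun x => hu.meas.comp measurable_prodMk_right) (fun x t => hu.nonneg _) (fun x t => hu.le _)
    hl ?_ ?_
  · have h1 := ae_ae_swap (hU.ae_rightDeriv_eq hu)
    filter_upwards [mem_inf_of_left hlX, mem_inf_of_right h1] with x hx h2
    rw [EventuallyEq, ae_restrict_iff' measurableSet_Ioo]
    filter_upwards [h2] with t h3 ht
    exact h3 ⟨ht, hx.1, by linarith [hx.1, hx.2]⟩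
  · rw [ae_restrict_iff' measurableSet_Ioo]
    refine Eventually.of_forall fun t ht => ?_
    obtain ⟨C, hC⟩ := hU.exists_convexOn hu hX₀ ht
    refine hlim (hC t ⟨le_rfl, ht.2.le⟩) (LipschitzWith.of_dist_le_mul (K := L) fun x y => ?_)
    simpa [Prod.dist_eq] using hU.lip.dist_le_mul (t, x) (t, y)

theorem IsRep.exists_spaceTrace_nhdsGT (hu : IsRep T M u) (hT : 0 < T) {R : ℝ} (hR : 0 ≤ R) :
    ∃ γ : ℝ → ℝ, Measurable γ ∧ (∀ y, 0 ≤ γ y ∧ γ y ≤ M) ∧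
      HasSpaceTrace T (fun t x => u (t, x)) (𝓝[>] R) γ := by
  refine hu.exists_spaceTrace hT (neBot_nhdsGT_inf_ae R) (X₀ := R + 1) (by linarith) ?_
    fun _ _ _ hf hL => exists_tendsto_rightDeriv_nhdsGT hf hL ⟨hR, by linarith⟩
  filter_upwards [Ioo_mem_nhdsGT (show R < R + 1 by linarith)] with x hx
  exact ⟨hR.trans_lt hx.1, hx.2⟩

theorem IsRep.exists_spaceTrace_nhdsLT (hu : IsRep T M u) (hT : 0 < T) {R : ℝ} (hR : 0 < R) :
    ∃ γ : ℝ → ℝ, Measurable γ ∧ (∀ y, 0 ≤ γ y ∧ γ y ≤ M) ∧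
      HasSpaceTrace T (fun t x => u (t, x)) (𝓝[<] R) γ :=
  hu.exists_spaceTrace hT (neBot_nhdsLT_inf_ae R) hR (Ioo_mem_nhdsLT hR)
    fun _ _ _ hf hL => exists_tendsto_rightDeriv_nhdsLT hf hL ⟨hR, le_rfl⟩

/-- The trace at the final time: `U(T, ·)` is Lipschitz, hence differentiable almost everywhere,
and at these points the right derivatives of `U(t, ·)` converge by uniform semiconvexity. -/
theorem IsRep.exists_timeTrace_Ioo (hu : IsRep T M u) (hT : 0 < T) {X₀ : ℝ} (hX₀ : 0 < X₀) :
    ∃ γ : ℝ → ℝ, Measurable γ ∧ (∀ y, 0 ≤ γ y ∧ γ y ≤ M) ∧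
      Tendsto (fun t => ∫⁻ x in Ioo 0 X₀, ‖u (t, x) - γ x‖ₑ) (𝓝[<] T ⊓ ae volume) (𝓝 0) := by
  obtain ⟨U, L, hU⟩ := hu.exists_potential hT (show 0 < 2 * X₀ + 3 by linarith)
  refine exists_tendsto_lintegral_sub_ae (v := fun t x => u (t, x))
    (D := fun t x => derivWithin (fun y => U (t, y)) (Ioi x) x)
    (fun t => hu.measurable_left t) (fun x t => hu.nonneg _) (fun x t => hu.le _)
    (neBot_nhdsLT_inf_ae T) ?_ ?_
  · have h0 := hU.ae_rightDeriv_eq hu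
    rw [Measure.volume_eq_prod] at h0
    have h1 := Measure.ae_ae_of_ae_prod h0
    filter_upwards [mem_inf_of_left (Ioo_mem_nhdsLT hT), mem_inf_of_right h1] with t ht h2
    rw [EventuallyEq, ae_restrict_iff' measurableSet_Ioo]
    filter_upwards [h2] with x h3 hx
    exact h3 ⟨ht, hx.1, by linarith [hx.1, hx.2]⟩
  · obtain ⟨C, hC⟩ := hU.exists_convexOn hu hX₀ (show T / 2 ∈ Ioo 0 T by constructor <;> linarith)
    have hlip : LipschitzWith L fun x => U (T, x) := LipschitzWith.of_dist_le_mul fun x y => by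
      simpa [Prod.dist_eq] using hU.lip.dist_le_mul (T, x) (T, y)
    rw [ae_restrict_iff' measurableSet_Ioo]
    filter_upwards [hlip.ae_differentiableAt] with x hx hxX
    refine ⟨_, tendsto_rightDeriv_of_semiconvex (U := fun t x => U (t, x)) (C := C)
      nhdsWithin_le_nhds (continuous_right_of_lipschitz hU.lip) ?_ hxX hx.hasDerivAt⟩
    filter_upwards [Ioo_mem_nhdsLT (show T / 2 < T by linarith)] with t ht
    exact hC t ⟨ht.1.le, ht.2.le⟩

theorem IsRep.exists_timeTrace (hu : IsRep T M u) (hT : 0 < T) :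
    ∃ γ : ℝ → ℝ, Measurable γ ∧ (∀ y, 0 ≤ γ y ∧ γ y ≤ M) ∧
      HasTimeTrace (fun t x => u (t, x)) (𝓝[<] T) γ := by
  have h := fun m : ℕ => hu.exists_timeTrace_Ioo hT (show (0 : ℝ) < m + 1 by positivity)
  choose γ mγ bγ hγ using h
  refine ⟨fun x => γ ⌊x⌋₊ x, ?_, fun y => bγ _ y, fun r hr => ?_⟩
  · have h1 : Measurable fun p : ℕ × ℝ => γ p.1 p.2 := measurable_from_prod_countable_right mγ
    exact h1.comp (Nat.measurable_floor.prodMk measurable_id)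
  · have h1 : Tendsto (fun t => ∑ m : Fin (⌊r⌋₊ + 1),
        ∫⁻ x in Ioo 0 ((m : ℝ) + 1), ‖u (t, x) - γ m x‖ₑ) (𝓝[<] T ⊓ ae volume) (𝓝 0) := by
      simpa using tendsto_finsetSum Finset.univ fun (m : Fin (⌊r⌋₊ + 1)) _ => hγ m
    refine tendsto_of_tendsto_of_tendsto_of_le_of_le tendsto_const_nhds h1
      (fun t => zero_le (a := ∫⁻ x in Ioo 0 r, ‖u (t, x) - γ ⌊x⌋₊ x‖ₑ)) fun t => ?_
    have h2 : Ioo 0 r ⊆ ⋃ m : Fin (⌊r⌋₊ + 1), Ico (m : ℝ) (m + 1) ∩ Ioo 0 r := by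
      intro x hx
      rw [mem_iUnion]
      exact ⟨⟨⌊x⌋₊, Nat.lt_succ_of_le (Nat.floor_mono hx.2.le)⟩,
        ⟨Nat.floor_le hx.1.le, Nat.lt_floor_add_one x⟩, hx⟩
    refine (lintegral_mono_set h2).trans ((lintegral_iUnion_le _ _).trans ?_)
    rw [tsum_fintype]
    refine Finset.sum_le_sum fun m _ => ?_
    have m1 : MeasurableSet (Ico (m : ℝ) (m + 1) ∩ Ioo 0 r) :=
      measurableSet_Ico.inter measurableSet_Ioo
    rw [setLIntegral_congr_fun m1 (g := fun x => ‖u (t, x) - γ m x‖ₑ)]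
    · exact lintegral_mono_set fun x hx => ⟨hx.2.1, hx.1.2⟩
    · intro x hx
      have : ⌊x⌋₊ = m := (Nat.floor_eq_iff hx.2.1.le).2 hx.1
      simp only [this]

end

/-! ### Two-sided traces for `R > 2` -/

section

variable {T M X : ℝ} {u U : ℝ × ℝ → ℝ} {L : NNReal}

theorem integrable_of_bound {μ : Measure ℝ} [IsFiniteMeasure μ] {f : ℝ → ℝ} (mf : Measurable f)
    {c : ℝ} (hf : ∀ y, |f y| ≤ c) : Integrable f μ :=
  Integrable.of_bound mf.aestronglyMeasurable c (Eventually.of_forall hf)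

theorem tendsto_integral_abs_sub {μ : Measure ℝ} {ι : Type*} {l : Filter ι} {v : ι → ℝ → ℝ}
    {γ : ℝ → ℝ} (mv : ∀ s, Measurable (v s)) (mγ : Measurable γ)
    (h : Tendsto (fun s => ∫⁻ y, ‖v s y - γ y‖ₑ ∂μ) l (𝓝 0)) :
    Tendsto (fun s => ∫ y, |v s y - γ y| ∂μ) l (𝓝 0) := by
  have h1 := (ENNReal.tendsto_toReal ENNReal.zero_ne_top).comp h
  refine h1.congr fun s => ?_
  exact (integral_norm_eq_lintegral_enorm ((mv s).sub mγ).aestronglyMeasurable).symm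

theorem tendsto_integral_of_abs_sub_le {μ : Measure ℝ} [IsFiniteMeasure μ] {ι : Type*}
    {l : Filter ι} {F g : ι → ℝ → ℝ} {e : ι → ℝ}
    (ig : ∀ s, Integrable (g s) μ) (he : Tendsto e l (𝓝 0))
    (hg : Tendsto (fun s => ∫ y, g s y ∂μ) l (𝓝 0)) (h : ∀ s y, |F s y| ≤ e s + g s y) :
    Tendsto (fun s => ∫ y, |F s y| ∂μ) l (𝓝 0) := by
  have h1 : Tendsto (fun s => e s * μ.real univ + ∫ y, g s y ∂μ) l (𝓝 (0 * μ.real univ + 0)) :=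
    (he.mul_const _).add hg
  rw [zero_mul, add_zero] at h1
  refine squeeze_zero (fun s => integral_nonneg fun y => abs_nonneg _) (fun s => ?_) h1
  have h2 : ∫ y, (e s + g s y) ∂μ = e s * μ.real univ + ∫ y, g s y ∂μ := by
    rw [integral_add (integrable_const _) (ig s), integral_const, smul_eq_mul, mul_comm]
  rw [← h2]
  exact integral_mono_of_nonneg (Eventually.of_forall fun y => abs_nonneg _)
    ((integrable_const _).add (ig s)) (Eventually.of_forall (h s))

theorem abs_flux_sub_flux_le {x R a c : ℝ} (ha : 0 ≤ a) (haM : a ≤ M) (hc : 0 ≤ c) (hcM : c ≤ M) :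
    |flux x a - flux R c| ≤ |drift x - drift R| * M + (|drift R| + 2 * M) * |a - c| := by
  have h1 : flux x a - flux R c = (drift x - drift R) * a + (drift R - (a + c)) * (a - c) := by
    rw [flux_eq, flux_eq]; ring
  rw [h1]
  refine (abs_add_le _ _).trans (add_le_add ?_ ?_)
  · rw [abs_mul, abs_of_nonneg ha]
    exact mul_le_mul_of_nonneg_left haM (abs_nonneg _)
  · rw [abs_mul]
    refine mul_le_mul_of_nonneg_right ((abs_sub _ _).trans (add_le_add le_rfl ?_)) (abs_nonneg _)
    rw [abs_of_nonneg (add_nonneg ha hc)]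
    linarith

theorem IsRep.tendsto_integral_flux_sub (hu : IsRep T M u) {R : ℝ} {l : Filter ℝ} (hl : l ≤ 𝓝 R)
    {γ : ℝ → ℝ} (mγ : Measurable γ) (bγ : ∀ y, 0 ≤ γ y ∧ γ y ≤ M)
    (h : HasSpaceTrace T (fun t x => u (t, x)) l γ) :
    Tendsto (fun x => ∫ t in Ioo 0 T, |flux x (u (t, x)) - flux R (γ t)|) (l ⊓ ae volume)
      (𝓝 0) := by
  have mu : ∀ x, Measurable fun t => u (t, x) := fun x => hu.meas.comp measurable_prodMk_right
  have h1 := tendsto_integral_abs_sub mu mγ h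
  have h2 : Tendsto (fun x => |drift x - drift R| * M) (l ⊓ ae volume) (𝓝 0) := by
    have : Tendsto (fun x => |drift x - drift R| * M) (𝓝 R) (𝓝 (|drift R - drift R| * M)) := by
      have := continuous_drift
      exact ((this.sub continuous_const).abs.mul continuous_const).tendsto R
    rw [sub_self, abs_zero, zero_mul] at this
    exact this.mono_left (inf_le_left.trans hl)
  refine tendsto_integral_of_abs_sub_le (g := fun x t => (|drift R| + 2 * M) * |u (t, x) - γ t|)
    (fun x => ?_) h2 ?_ fun x t =>
      abs_flux_sub_flux_le (hu.nonneg _) (hu.le _) (bγ t).1 (bγ t).2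
  · refine (integrable_of_bound (c := M) ((mu x).sub mγ).abs fun t => ?_).const_mul _
    rw [abs_abs]
    exact abs_sub_le_of_nonneg_of_le (hu.nonneg _) (hu.le _) (bγ t).1 (bγ t).2
  · simp only [integral_const_mul]
    simpa using h1.const_mul (|drift R| + 2 * M)

/-- The time derivative of the potential on the line `x = R` is minus the flux of either trace. -/
theorem IsPotential.sub_eq_integral_trace (hU : IsPotential T X u U L) (hu : IsRep T M u) {R : ℝ}
    (hR : R ∈ Ioo 0 X) {l : Filter ℝ} (hl : l ≤ 𝓝 R) (hn : (l ⊓ ae (volume : Measure ℝ)).NeBot)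
    {γ : ℝ → ℝ} (mγ : Measurable γ) (bγ : ∀ y, 0 ≤ γ y ∧ γ y ≤ M)
    (h : HasSpaceTrace T (fun t x => u (t, x)) l γ) {t s : ℝ} (ht : t ∈ Ioo 0 T)
    (hs : s ∈ Ioo 0 T) : U (s, R) - U (t, R) = -∫ r in t..s, flux R (γ r) := by
  have bf : ∀ r, |flux R (γ r)| ≤ (2 * |R| + |R| ^ 2) * M + M ^ 2 := fun r =>
    abs_flux_le (bγ r).1 (bγ r).2 le_rfl
  have mf : Measurable fun r => flux R (γ r) := by
    unfold flux; fun_prop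
  have hsub : uIoc t s ⊆ Ioo 0 T := fun r hr => by
    rcases uIoc_subset_uIcc hr with ⟨h1, h2⟩
    exact ⟨(lt_min ht.1 hs.1).trans_le h1, h2.trans_lt (max_lt ht.2 hs.2)⟩
  have h1 : Tendsto (fun x => ∫ r in t..s, flux x (u (r, x))) (l ⊓ ae volume)
      (𝓝 (∫ r in t..s, flux R (γ r))) := by
    rw [tendsto_iff_dist_tendsto_zero]
    refine squeeze_zero (fun x => dist_nonneg) (fun x => ?_)
      (hu.tendsto_integral_flux_sub hl mγ bγ h)
    have i1 := intervalIntegrable_of_bound (hu.measurable_flux_right x)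
      (hu.abs_flux_right_le x) t s
    have i2 := intervalIntegrable_of_bound mf bf t s
    rw [Real.dist_eq, ← intervalIntegral.integral_sub i1 i2]
    refine (intervalIntegral.norm_integral_le_integral_norm_uIoc (μ := volume)
      (f := fun r => flux x (u (r, x)) - flux R (γ r))).trans ?_
    refine setIntegral_mono_set ?_ (Eventually.of_forall fun r => abs_nonneg _)
      hsub.eventuallyLE
    exact ((integrable_of_bound (hu.measurable_flux_right x) (hu.abs_flux_right_le x)).sub
      (integrable_of_bound mf bf)).abs
  have h2 : Tendsto (fun x => U (s, x) - U (t, x)) (l ⊓ ae volume) (𝓝 (U (s, R) - U (t, R))) :=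
    (((continuous_left_of_lipschitz hU.lip s).sub
      (continuous_left_of_lipschitz hU.lip t)).tendsto R).mono_left (inf_le_left.trans hl)
  refine tendsto_nhds_unique (h2.congr' ?_) h1.neg
  filter_upwards [mem_inf_of_left (hl (isOpen_Ioo.mem_nhds hR)), mem_inf_of_right hU.time]
    with x hx h3
  exact h3 hx t ht s hs

/-- For `R > 2` the one-sided traces at `R` agree, since the flux is continuous across `R` and
`F(R, ·)` is injective on `[0, ∞)`. -/
theorem IsRep.spaceTrace_unique (hu : IsRep T M u) (hT : 0 < T) {R : ℝ} (hR : 2 < R)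
    {γ γ' : ℝ → ℝ} (mγ : Measurable γ) (bγ : ∀ y, 0 ≤ γ y ∧ γ y ≤ M)
    (h : HasSpaceTrace T (fun t x => u (t, x)) (𝓝[>] R) γ)
    (mγ' : Measurable γ') (bγ' : ∀ y, 0 ≤ γ' y ∧ γ' y ≤ M)
    (h' : HasSpaceTrace T (fun t x => u (t, x)) (𝓝[<] R) γ') :
    γ =ᵐ[volume.restrict (Ioo 0 T)] γ' := by
  obtain ⟨U, L, hU⟩ := hu.exists_potential hT (show 0 < R + 1 by linarith)
  have hRX : R ∈ Ioo 0 (R + 1) := ⟨by linarith, by linarith⟩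
  set G : ℝ → ℝ := fun r => flux R (γ r) - flux R (γ' r) with hG
  have bf : ∀ {γ : ℝ → ℝ}, (∀ y, 0 ≤ γ y ∧ γ y ≤ M) → ∀ r,
      |flux R (γ r)| ≤ (2 * |R| + |R| ^ 2) * M + M ^ 2 := fun bγ r =>
    abs_flux_le (bγ r).1 (bγ r).2 le_rfl
  have mf : ∀ {γ : ℝ → ℝ}, Measurable γ → Measurable fun r => flux R (γ r) := fun mγ => by
    unfold flux; fun_prop
  have hzero : ∀ t ∈ Ioo 0 T, ∀ s ∈ Ioo 0 T, ∫ r in t..s, G r = 0 := by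
    intro t ht s hs
    have h1 := hU.sub_eq_integral_trace hu hRX nhdsWithin_le_nhds (neBot_nhdsGT_inf_ae R) mγ bγ h
      ht hs
    have h2 := hU.sub_eq_integral_trace hu hRX nhdsWithin_le_nhds (neBot_nhdsLT_inf_ae R) mγ' bγ'
      h' ht hs
    rw [intervalIntegral.integral_sub (intervalIntegrable_of_bound (mf mγ) (bf bγ) t s)
      (intervalIntegrable_of_bound (mf mγ') (bf bγ') t s)]
    linarith
  have iG : LocallyIntegrable G := by
    rw [locallyIntegrable_iff]
    intro K hK
    refine Measure.integrableOn_of_bounded (M := ((2 * |R| + |R| ^ 2) * M + M ^ 2)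
      + ((2 * |R| + |R| ^ 2) * M + M ^ 2)) hK.measure_lt_top.ne
      ((mf mγ).sub (mf mγ')).aestronglyMeasurable (Eventually.of_forall fun r => ?_)
    exact (abs_sub _ _).trans (add_le_add (bf bγ r) (bf bγ' r))
  rw [EventuallyEq, ae_restrict_iff' measurableSet_Ioo]
  filter_upwards [_root_.LocallyIntegrable.ae_hasDerivAt_integral iG] with t h1 ht
  have h2 : (fun s => ∫ r in t..s, G r) =ᶠ[𝓝 t] fun _ => 0 := by
    filter_upwards [isOpen_Ioo.mem_nhds ht] with s hs
    exact hzero t ht s hs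
  have h3 : G t = 0 := (h1 t).unique ((hasDerivAt_const t (0 : ℝ)).congr_of_eventuallyEq h2)
  have h4 : (γ t - γ' t) * (drift R - γ t - γ' t) = 0 := by
    rw [← h3, hG]; simp only [flux_eq]; ring
  rcases mul_eq_zero.1 h4 with h5 | h5
  · linarith
  · have : drift R < 0 := by unfold drift; nlinarith
    linarith [(bγ t).1, (bγ' t).1]

theorem IsRep.exists_spaceTrace_nhds (hu : IsRep T M u) (hT : 0 < T) {R : ℝ} (hR : 2 < R) :
    ∃ γ : ℝ → ℝ, Measurable γ ∧ (∀ y, 0 ≤ γ y ∧ γ y ≤ M) ∧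
      HasSpaceTrace T (fun t x => u (t, x)) (𝓝 R) γ := by
  obtain ⟨γ, mγ, bγ, h⟩ := hu.exists_spaceTrace_nhdsGT hT (show 0 ≤ R by linarith)
  obtain ⟨γ', mγ', bγ', h'⟩ := hu.exists_spaceTrace_nhdsLT hT (show 0 < R by linarith)
  have hγ := hu.spaceTrace_unique hT hR mγ bγ h mγ' bγ' h'
  refine ⟨γ, mγ, bγ, ?_⟩
  refine Tendsto.mono_left (tendsto_sup.2 ⟨h'.congr fun x => ?_, h⟩) (nhds_inf_ae_le R)
  refine lintegral_congr_ae ?_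
  filter_upwards [hγ] with t ht
  rw [ht]

/-! ### Traces of functions equal almost everywhere -/

section Transfer

variable {n : ℝ → ℝ → ℝ}

theorem HasSpaceTrace.congr_ae {l : Filter ℝ} {γ : ℝ → ℝ}
    (hn : ∀ᵐ p ∂volume.restrict (domain T), n p.1 p.2 = u p) (hl : ∀ᶠ x in l, 0 < x) :
    HasSpaceTrace T n l γ ↔ HasSpaceTrace T (fun t x => u (t, x)) l γ := by
  refine tendsto_congr' ?_
  rw [ae_restrict_iff' (isOpen_domain T).measurableSet] at hn
  filter_upwards [mem_inf_of_left hl, mem_inf_of_right (ae_ae_swap hn)] with x hx h1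
  refine lintegral_congr_ae ?_
  rw [EventuallyEq, ae_restrict_iff' measurableSet_Ioo]
  filter_upwards [h1] with t h2 ht
  rw [h2 ⟨ht, hx⟩]

theorem HasTimeTrace.congr_ae {l : Filter ℝ} {γ : ℝ → ℝ}
    (hn : ∀ᵐ p ∂volume.restrict (domain T), n p.1 p.2 = u p) (hl : ∀ᶠ t in l, t ∈ Ioo 0 T) :
    HasTimeTrace n l γ ↔ HasTimeTrace (fun t x => u (t, x)) l γ := by
  refine forall₂_congr fun r _ => tendsto_congr' ?_
  rw [ae_restrict_iff' (isOpen_domain T).measurableSet, Measure.volume_eq_prod] at hn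
  filter_upwards [mem_inf_of_left hl, mem_inf_of_right (Measure.ae_ae_of_ae_prod hn)] with t ht h1
  refine lintegral_congr_ae ?_
  rw [EventuallyEq, ae_restrict_iff' measurableSet_Ioo]
  filter_upwards [h1] with x h2 hx
  rw [h2 ⟨ht, hx.1⟩]

end Transfer

end

/-! ### The contraction inequality -/

section

variable {T M : ℝ} {u u' : ℝ × ℝ → ℝ}

/-- The entropy flux `sgn(a - a') (F(x, a) - F(x, a'))`, with the factor `a - a'` taken out. -/
def entropyFlux (x a a' : ℝ) : ℝ := drift x * |a - a'| - |a - a'| * (a + a')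

theorem entropyFlux_zero {a a' : ℝ} (ha : 0 ≤ a) (ha' : 0 ≤ a') :
    entropyFlux 0 a a' = -|a ^ 2 - a' ^ 2| := by
  have h1 : a ^ 2 - a' ^ 2 = (a - a') * (a + a') := by ring
  rw [h1, abs_mul, abs_of_nonneg (add_nonneg ha ha')]
  simp [entropyFlux, drift]

theorem entropyFlux_of_two_lt {R a a' : ℝ} (hR : 2 < R) (ha : 0 ≤ a) (ha' : 0 ≤ a') :
    entropyFlux R a a' = -|flux R a - flux R a'| := by
  have h1 : flux R a - flux R a' = (a - a') * (drift R - a - a') := by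
    rw [flux_eq, flux_eq]; ring
  have h2 : drift R - a - a' ≤ 0 := by
    have : drift R < 0 := by unfold drift; nlinarith
    linarith
  rw [h1, abs_mul, abs_of_nonpos h2, entropyFlux]
  ring

theorem abs_entropyFlux_le {x a a' : ℝ} (ha : 0 ≤ a) (haM : a ≤ M) (ha' : 0 ≤ a') (haM' : a' ≤ M) :
    |entropyFlux x a a'| ≤ |drift x| * M + M * (2 * M) := by
  have h1 : |a - a'| ≤ M := abs_sub_le_of_nonneg_of_le ha haM ha' haM'
  unfold entropyFlux
  refine (abs_sub _ _).trans (add_le_add ?_ ?_)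
  · rw [abs_mul, abs_abs]
    exact mul_le_mul_of_nonneg_left h1 (abs_nonneg _)
  · rw [abs_mul, abs_abs, abs_of_nonneg (add_nonneg ha ha')]
    exact mul_le_mul h1 (by linarith) (by linarith) (ha.trans haM)

theorem abs_entropyFlux_sub_le {x R a a' c c' : ℝ} (ha : 0 ≤ a) (haM : a ≤ M) (ha' : 0 ≤ a')
    (haM' : a' ≤ M) (hc : 0 ≤ c) (hcM : c ≤ M) (hc' : 0 ≤ c') (hcM' : c' ≤ M) :
    |entropyFlux x a a' - entropyFlux R c c'|
      ≤ |drift x - drift R| * M + (|drift R| + 2 * M) * (|a - c| + |a' - c'|) := by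
  have sq : ∀ {a a' : ℝ}, 0 ≤ a → 0 ≤ a' → |a - a'| * (a + a') = |a ^ 2 - a' ^ 2| := by
    intro a a' ha ha'
    have h1 : a ^ 2 - a' ^ 2 = (a - a') * (a + a') := by ring
    rw [h1, abs_mul, abs_of_nonneg (add_nonneg ha ha')]
  have hsq : ∀ {a c : ℝ}, 0 ≤ a → a ≤ M → 0 ≤ c → c ≤ M → |a ^ 2 - c ^ 2| ≤ 2 * M * |a - c| := by
    intro a c ha haM hc hcM
    rw [← sq ha hc, mul_comm]
    exact mul_le_mul_of_nonneg_right (by linarith) (abs_nonneg _)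
  have tri : ∀ a a' c c' : ℝ, |(|a - a'| - |c - c'|)| ≤ |a - c| + |a' - c'| := by
    intro a a' c c'
    refine (abs_abs_sub_abs_le_abs_sub _ _).trans ?_
    have : a - a' - (c - c') = (a - c) - (a' - c') := by ring
    rw [this]
    exact abs_sub _ _
  have e : entropyFlux x a a' - entropyFlux R c c' = (drift x - drift R) * |a - a'|
      + drift R * (|a - a'| - |c - c'|) - (|a ^ 2 - a' ^ 2| - |c ^ 2 - c' ^ 2|) := by
    rw [entropyFlux, entropyFlux, sq ha ha', sq hc hc']; ring
  have h1 : |a - a'| ≤ M := abs_sub_le_of_nonneg_of_le ha haM ha' haM'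
  have h2 : |(drift x - drift R) * (|a - a'|)| ≤ |drift x - drift R| * M := by
    rw [abs_mul, abs_abs]
    exact mul_le_mul_of_nonneg_left h1 (abs_nonneg _)
  have h3 : |drift R * (|a - a'| - |c - c'|)| ≤ |drift R| * (|a - c| + |a' - c'|) := by
    rw [abs_mul]
    exact mul_le_mul_of_nonneg_left (tri a a' c c') (abs_nonneg _)
  have h4 := (tri (a ^ 2) (a' ^ 2) (c ^ 2) (c' ^ 2)).trans
    (add_le_add (hsq ha haM hc hcM) (hsq ha' haM' hc' hcM'))
  rw [e]
  refine (abs_sub _ _).trans ((add_le_add ((abs_add_le _ _).trans (add_le_add h2 h3)) h4).trans ?_)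
  apply le_of_eq
  ring

theorem IsRep.measurable_entropyFlux (hu : IsRep T M u) (hu' : IsRep T M u') :
    Measurable fun z : ℝ × ℝ => entropyFlux z.2 (u z) (u' z) := by
  have h1 := (hu.meas.sub hu'.meas).abs
  exact ((continuous_drift.measurable.comp measurable_snd).mul h1).sub
    (h1.mul (hu.meas.add hu'.meas))

theorem IsRep.compactBounded_entropyFlux (hu : IsRep T M u) (hu' : IsRep T M u') :
    CompactBounded fun z : ℝ × ℝ => entropyFlux z.2 (u z) (u' z) := fun K hK => by
  obtain ⟨d, hd⟩ := hK.exists_bound_of_continuousOn (f := fun z : ℝ × ℝ => drift z.2)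
    (continuous_drift.comp continuous_snd).continuousOn
  have hM : 0 ≤ M := (hu.nonneg 0).trans (hu.le 0)
  refine ⟨d * M + M * (2 * M), fun z hz =>
    (abs_entropyFlux_le (hu.nonneg z) (hu.le z) (hu'.nonneg z) (hu'.le z)).trans ?_⟩
  have := mul_le_mul_of_nonneg_right (hd z hz) hM
  exact add_le_add this le_rfl

theorem IsRep.tendsto_integral_entropyFlux (hu : IsRep T M u) (hu' : IsRep T M u') {R : ℝ}
    {l : Filter ℝ} (hl : l ≤ 𝓝 R) {γ γ' : ℝ → ℝ} (mγ : Measurable γ)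
    (bγ : ∀ y, 0 ≤ γ y ∧ γ y ≤ M) (mγ' : Measurable γ') (bγ' : ∀ y, 0 ≤ γ' y ∧ γ' y ≤ M)
    (h : HasSpaceTrace T (fun t x => u (t, x)) l γ)
    (h' : HasSpaceTrace T (fun t x => u' (t, x)) l γ') :
    Tendsto (fun x => ∫ t in Ioo 0 T, entropyFlux x (u (t, x)) (u' (t, x))) (l ⊓ ae volume)
      (𝓝 (∫ t in Ioo 0 T, entropyFlux R (γ t) (γ' t))) := by
  have mr : ∀ {u : ℝ × ℝ → ℝ}, IsRep T M u → ∀ x, Measurable fun t => u (t, x) :=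
    fun hu x => hu.meas.comp measurable_prodMk_right
  have ir : ∀ {u : ℝ × ℝ → ℝ} {γ : ℝ → ℝ}, IsRep T M u → Measurable γ →
      (∀ y, 0 ≤ γ y ∧ γ y ≤ M) → ∀ x,
      Integrable (fun t => |u (t, x) - γ t|) (volume.restrict (Ioo 0 T)) := by
    intro u γ hu mγ bγ x
    refine integrable_of_bound (c := M) ((mr hu x).sub mγ).abs fun t => ?_
    rw [abs_abs]
    exact abs_sub_le_of_nonneg_of_le (hu.nonneg _) (hu.le _) (bγ t).1 (bγ t).2
  have h1 := tendsto_integral_abs_sub (mr hu) mγ h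
  have h1' := tendsto_integral_abs_sub (mr hu') mγ' h'
  have h2 : Tendsto (fun x => |drift x - drift R| * M) (l ⊓ ae volume) (𝓝 0) := by
    have : Tendsto (fun x => |drift x - drift R| * M) (𝓝 R) (𝓝 (|drift R - drift R| * M)) := by
      have := continuous_drift
      exact ((this.sub continuous_const).abs.mul continuous_const).tendsto R
    rw [sub_self, abs_zero, zero_mul] at this
    exact this.mono_left (inf_le_left.trans hl)
  have h3 := tendsto_integral_of_abs_sub_le (μ := volume.restrict (Ioo 0 T))
    (F := fun x t => entropyFlux x (u (t, x)) (u' (t, x)) - entropyFlux R (γ t) (γ' t))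
    (g := fun x t => (|drift R| + 2 * M) * (|u (t, x) - γ t| + |u' (t, x) - γ' t|))
    (fun x => ((ir hu mγ bγ x).add (ir hu' mγ' bγ' x)).const_mul _) h2
    (by
      have h4 := (h1.add h1').const_mul (|drift R| + 2 * M)
      rw [add_zero, mul_zero] at h4
      refine h4.congr fun x => ?_
      rw [integral_const_mul, integral_add (ir hu mγ bγ x) (ir hu' mγ' bγ' x)])
    (fun x t => abs_entropyFlux_sub_le (hu.nonneg _) (hu.le _) (hu'.nonneg _) (hu'.le _)
      (bγ t).1 (bγ t).2 (bγ' t).1 (bγ' t).2)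
  rw [tendsto_iff_dist_tendsto_zero]
  refine squeeze_zero (fun x => dist_nonneg) (fun x => ?_) h3
  have i1 : Integrable (fun t => entropyFlux x (u (t, x)) (u' (t, x)))
      (volume.restrict (Ioo 0 T)) :=
    integrable_of_bound ((hu.measurable_entropyFlux hu').comp
      (measurable_prodMk_right (y := x))) fun t =>
      abs_entropyFlux_le (hu.nonneg _) (hu.le _) (hu'.nonneg _) (hu'.le _)
  have i2 : Integrable (fun t => entropyFlux R (γ t) (γ' t)) (volume.restrict (Ioo 0 T)) := by
    refine integrable_of_bound ?_ fun t =>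
      abs_entropyFlux_le (bγ t).1 (bγ t).2 (bγ' t).1 (bγ' t).2
    unfold entropyFlux
    exact ((mγ.sub mγ').abs.const_mul _).sub ((mγ.sub mγ').abs.mul (mγ.add mγ'))
  rw [Real.dist_eq, ← integral_sub i1 i2]
  exact norm_integral_le_integral_norm fun t =>
    entropyFlux x (u (t, x)) (u' (t, x)) - entropyFlux R (γ t) (γ' t)

theorem tendsto_integral_abs_sub_sub {μ : Measure ℝ} {ι : Type*} {l : Filter ι}
    {v v' : ι → ℝ → ℝ} {γ γ' : ℝ → ℝ} (iv : ∀ s, Integrable (v s) μ)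
    (iv' : ∀ s, Integrable (v' s) μ) (iγ : Integrable γ μ) (iγ' : Integrable γ' μ)
    (h : Tendsto (fun s => ∫⁻ y, ‖v s y - γ y‖ₑ ∂μ) l (𝓝 0))
    (h' : Tendsto (fun s => ∫⁻ y, ‖v' s y - γ' y‖ₑ ∂μ) l (𝓝 0)) :
    Tendsto (fun s => ∫ y, |v s y - v' s y| ∂μ) l (𝓝 (∫ y, |γ y - γ' y| ∂μ)) := by
  refine tendsto_integral_of_L1 (fun y => |γ y - γ' y|) ((iγ.sub iγ').abs.aestronglyMeasurable)
    (Eventually.of_forall fun s => ((iv s).sub (iv' s)).abs) ?_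
  have h1 := h.add h'
  rw [add_zero] at h1
  refine tendsto_of_tendsto_of_tendsto_of_le_of_le tendsto_const_nhds h1
    (fun s => zero_le (a := ∫⁻ y, ‖|v s y - v' s y| - |γ y - γ' y|‖ₑ ∂μ)) fun s => ?_
  have h2 : AEMeasurable (fun y => ‖v s y - γ y‖ₑ) μ :=
    ((iv s).sub iγ).aestronglyMeasurable.enorm
  change _ ≤ (∫⁻ y, ‖v s y - γ y‖ₑ ∂μ) + ∫⁻ y, ‖v' s y - γ' y‖ₑ ∂μ
  rw [← lintegral_add_left' h2]
  refine lintegral_mono fun y => ?_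
  simp only [Real.enorm_eq_ofReal_abs]
  rw [← ENNReal.ofReal_add (abs_nonneg _) (abs_nonneg _)]
  refine ENNReal.ofReal_le_ofReal ((abs_abs_sub_abs_le_abs_sub _ _).trans ?_)
  have : v s y - v' s y - (γ y - γ' y) = (v s y - γ y) - (v' s y - γ' y) := by ring
  rw [this]
  exact abs_sub _ _

/-- The integrated Kato inequality on almost every rectangle `(t, s) × (x, y)`, with the integrals
extended to `(0, T)` and `(0, R)` at the expense of an error. -/
theorem IsRep.exists_rectangle_le (hu : IsRep T M u) (hu' : IsRep T M u') (R : ℝ) :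
    ∃ (c : ℝ) (P Q : ℝ → Prop), (∀ᵐ t, P t) ∧ (∀ᵐ x, Q x) ∧
    ∀ t s x y, P t → P s → Q x → Q y → 0 < t → t ≤ s → s < T → 0 < x → x ≤ y → y < R →
      (∫ r in Ioo 0 R, |u (s, r) - u' (s, r)|)
          + ∫ r in Ioo 0 T, entropyFlux y (u (r, y)) (u' (r, y))
        ≤ (∫ r in Ioo 0 R, |u (t, r) - u' (t, r)|)
          + (∫ r in Ioo 0 T, entropyFlux x (u (r, x)) (u' (r, x)))
          + c * ((t + (T - s)) + (x + (R - y))) := by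
  have hM : 0 ≤ M := (hu.nonneg 0).trans (hu.le 0)
  set A : ℝ × ℝ → ℝ := fun z => |u z - u' z| with hA
  set B : ℝ × ℝ → ℝ := fun z => entropyFlux z.2 (u z) (u' z) with hB
  have mA : Measurable A := (hu.meas.sub hu'.meas).abs
  have mB : Measurable B := hu.measurable_entropyFlux hu'
  have bA' : ∀ z, |A z| ≤ M := fun z => by
    rw [hA, abs_abs]
    exact abs_sub_le_of_nonneg_of_le (hu.nonneg z) (hu.le z) (hu'.nonneg z) (hu'.le z)
  have bA : CompactBounded A := fun K _ => ⟨M, fun z _ => bA' z⟩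
  have bB : CompactBounded B := hu.compactBounded_entropyFlux hu'
  set c : ℝ := M + 2 * ((2 * R + R ^ 2) * M + M * (2 * M)) with hc
  have bB' : ∀ x, 0 < x → x < R → ∀ t, |B (t, x)| ≤ (2 * R + R ^ 2) * M + M * (2 * M) := by
    intro x hx hxR t
    refine (abs_entropyFlux_le (hu.nonneg _) (hu.le _) (hu'.nonneg _) (hu'.le _)).trans ?_
    have h1 := abs_drift_le (x := x) (X := R) (by rw [abs_of_pos hx]; exact hxR.le)
    exact add_le_add (mul_le_mul_of_nonneg_right h1 hM) le_rfl
  -- comparison of an integral over `(a, b)` with the integral over a larger interval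
  have cmp : ∀ (f : ℝ → ℝ) (d a b S : ℝ), Measurable f → (∀ r, |f r| ≤ d) → 0 < a → a ≤ b → b < S →
      |(∫ r in Ioo 0 S, f r) - ∫ r in a..b, f r| ≤ d * (a + (S - b)) := by
    intro f d a b S mf hf ha hab hb
    have i := intervalIntegrable_of_bound mf hf
    have h0 : ∫ r in Ioo 0 S, f r = ∫ r in (0 : ℝ)..S, f r := by
      rw [intervalIntegral.integral_of_le (by linarith), integral_Ioc_eq_integral_Ioo]
    have h1 := intervalIntegral.integral_add_adjacent_intervals (i 0 a) (i a b)
    have h2 := intervalIntegral.integral_add_adjacent_intervals (i 0 b) (i b S)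
    have h3 := norm_intervalIntegral_le_of_forall hf 0 a
    have h4 := norm_intervalIntegral_le_of_forall hf b S
    rw [sub_zero, abs_of_pos ha] at h3
    rw [abs_of_pos (sub_pos.2 hb)] at h4
    have h5 : (∫ r in Ioo 0 S, f r) - ∫ r in a..b, f r
        = (∫ r in (0 : ℝ)..a, f r) + ∫ r in b..S, f r := by rw [h0]; linarith
    rw [h5]
    refine (abs_add_le _ _).trans ?_
    linarith
  refine ⟨c, _, _, ae_mol_tendsto_left (locallyIntegrable_of_compactBounded mA bA),
    ae_mol_tendsto_right (locallyIntegrable_of_compactBounded mB bB), ?_⟩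
  intro t s x y ht hs hx hy t0 hts hsT x0 hxy hyR
  have key := rectangle_le mA mB bA bB (fun φ hφ h0 => kato hu hu' hφ h0) t0 hts hsT x0 hxy
    ht hs hx hy
  have mA' : ∀ t, Measurable fun r => A (t, r) := fun t => mA.comp measurable_prodMk_left
  have mB' : ∀ x, Measurable fun r => B (r, x) := fun x => mB.comp measurable_prodMk_right
  have k₁ := abs_le.1 (cmp _ M x y R (mA' s) (fun r => bA' _) x0 hxy hyR)
  have k₂ := abs_le.1 (cmp _ M x y R (mA' t) (fun r => bA' _) x0 hxy hyR)
  have k₃ := abs_le.1 (cmp _ _ t s T (mB' x) (bB' x x0 (hxy.trans_lt hyR)) t0 hts hsT)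
  have k₄ := abs_le.1 (cmp _ _ t s T (mB' y) (bB' y (x0.trans_le hxy) hyR) t0 hts hsT)
  have k₅ : ∫ r in x..y, A (t, r) ≤ ∫ r in Ioo 0 R, A (t, r) := by
    rw [intervalIntegral.integral_of_le hxy]
    refine setIntegral_mono_set (integrable_of_bound (mA' t) fun r => bA' _)
      (Eventually.of_forall fun r => abs_nonneg _) (LE.le.eventuallyLE ?_)
    exact fun r hr => ⟨x0.trans hr.1, hr.2.trans_lt hyR⟩
  have p₁ : 0 ≤ t + (T - s) := by linarith
  have p₂ : 0 ≤ x + (R - y) := by linarith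
  have hR : 0 < R := x0.trans (hxy.trans_lt hyR)
  set d : ℝ := (2 * R + R ^ 2) * M + M * (2 * M) with hd
  have d0 : 0 ≤ d := by positivity
  have p₃ : 0 ≤ M * (t + (T - s)) := mul_nonneg hM p₁
  have p₄ : 0 ≤ d * (x + (R - y)) := mul_nonneg d0 p₂
  have e₁ : c * ((t + (T - s)) + (x + (R - y))) = M * (x + (R - y)) + 2 * (d * (t + (T - s)))
      + M * (t + (T - s)) + 2 * (d * (x + (R - y))) := by rw [hc]; ring
  rw [e₁]
  linarith [k₁.2, k₃.1, k₃.2, k₄.1, k₄.2]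

/-- The contraction inequality for representatives: all four sides of a rectangle are moved to the
boundary of `(0, T) × (0, R)` along points where the integrated Kato inequality holds. -/
theorem IsRep.contraction (hu : IsRep T M u) (hu' : IsRep T M u') (hT : 0 < T) {R : ℝ} (hR : 2 < R)
    {n₀ n₀' nT nT' a a' b b' : ℝ → ℝ}
    (i₀ : IntegrableOn n₀ (Ioi 0)) (i₀' : IntegrableOn n₀' (Ioi 0))
    (h₀ : HasTimeTrace (fun t x => u (t, x)) (𝓝[>] 0) n₀)
    (h₀' : HasTimeTrace (fun t x => u' (t, x)) (𝓝[>] 0) n₀')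
    (mT : Measurable nT) (bT : ∀ y, 0 ≤ nT y ∧ nT y ≤ M)
    (hnT : HasTimeTrace (fun t x => u (t, x)) (𝓝[<] T) nT)
    (mT' : Measurable nT') (bT' : ∀ y, 0 ≤ nT' y ∧ nT' y ≤ M)
    (hnT' : HasTimeTrace (fun t x => u' (t, x)) (𝓝[<] T) nT')
    (ma : Measurable a) (ba : ∀ y, 0 ≤ a y ∧ a y ≤ M)
    (ha : HasSpaceTrace T (fun t x => u (t, x)) (𝓝[>] 0) a)
    (ma' : Measurable a') (ba' : ∀ y, 0 ≤ a' y ∧ a' y ≤ M)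
    (ha' : HasSpaceTrace T (fun t x => u' (t, x)) (𝓝[>] 0) a')
    (mb : Measurable b) (bb : ∀ y, 0 ≤ b y ∧ b y ≤ M)
    (hb : HasSpaceTrace T (fun t x => u (t, x)) (𝓝 R) b)
    (mb' : Measurable b') (bb' : ∀ y, 0 ≤ b' y ∧ b' y ≤ M)
    (hb' : HasSpaceTrace T (fun t x => u' (t, x)) (𝓝 R) b') :
    (∫ x in Ioo 0 R, |nT x - nT' x|) + (∫ t in Ioo 0 T, |a t ^ 2 - a' t ^ 2|) ≤
      (∫ x in Ioo 0 R, |n₀ x - n₀' x|) + ∫ t in Ioo 0 T, |flux R (b t) - flux R (b' t)| := by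
  have hR0 : 0 < R := by linarith
  obtain ⟨c, P, Q, hP, hQ, key⟩ := hu.exists_rectangle_le hu' R
  have iu : ∀ {u : ℝ × ℝ → ℝ}, IsRep T M u → ∀ s, Integrable (fun y => u (s, y))
      (volume.restrict (Ioo 0 R)) := fun hu s =>
    integrable_of_bound (hu.measurable_left s) fun y => hu.abs_apply_le _
  have ib : ∀ {γ : ℝ → ℝ}, Measurable γ → (∀ y, 0 ≤ γ y ∧ γ y ≤ M) →
      Integrable γ (volume.restrict (Ioo 0 R)) := fun mγ bγ =>
    integrable_of_bound mγ fun y => abs_le.2 ⟨by linarith [(bγ y).1, (bγ y).2], (bγ y).2⟩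
  have lT := tendsto_integral_abs_sub_sub (iu hu) (iu hu') (ib mT bT) (ib mT' bT')
    (hnT R hR0) (hnT' R hR0)
  have l₀ := tendsto_integral_abs_sub_sub (iu hu) (iu hu') (i₀.mono_set Ioo_subset_Ioi_self)
    (i₀'.mono_set Ioo_subset_Ioi_self) (h₀ R hR0) (h₀' R hR0)
  have la := hu.tendsto_integral_entropyFlux hu' nhdsWithin_le_nhds ma ba ma' ba' ha ha'
  have lb := (hu.tendsto_integral_entropyFlux hu' le_rfl mb bb mb' bb' hb hb').mono_left
    (inf_le_inf_right (ae volume) (nhdsWithin_le_nhds (s := Iio R)))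
  have ea : ∫ t in Ioo 0 T, entropyFlux 0 (a t) (a' t) = -∫ t in Ioo 0 T, |a t ^ 2 - a' t ^ 2| := by
    rw [← integral_neg]
    exact integral_congr_ae (Eventually.of_forall fun t => entropyFlux_zero (ba t).1 (ba' t).1)
  have eb : ∫ t in Ioo 0 T, entropyFlux R (b t) (b' t)
      = -∫ t in Ioo 0 T, |flux R (b t) - flux R (b' t)| := by
    rw [← integral_neg]
    exact integral_congr_ae (Eventually.of_forall fun t =>
      entropyFlux_of_two_lt hR (bb t).1 (bb' t).1)
  rw [ea] at la
  rw [eb] at lb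
  have n₁ := neBot_nhdsGT_inf_ae 0
  have n₂ := neBot_nhdsLT_inf_ae T
  have n₃ := neBot_nhdsLT_inf_ae R
  set l₁ : Filter ℝ := 𝓝[>] 0 ⊓ ae volume with hl₁
  set l₂ : Filter ℝ := 𝓝[<] T ⊓ ae volume with hl₂
  set l₃ : Filter ℝ := 𝓝[<] R ⊓ ae volume with hl₃
  have q₁ : Tendsto id l₁ (𝓝 0) := tendsto_id.mono_left (inf_le_left.trans nhdsWithin_le_nhds)
  have q₂ : Tendsto id l₂ (𝓝 T) := tendsto_id.mono_left (inf_le_left.trans nhdsWithin_le_nhds)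
  have q₃ : Tendsto id l₃ (𝓝 R) := tendsto_id.mono_left (inf_le_left.trans nhdsWithin_le_nhds)
  -- the sides `t, s, x, y` of the rectangle as a point of a product
  set l := (l₁ ×ˢ l₂) ×ˢ (l₁ ×ˢ l₃) with hl
  have πt : Tendsto (fun w : (ℝ × ℝ) × (ℝ × ℝ) => w.1.1) l l₁ := tendsto_fst.comp tendsto_fst
  have πs : Tendsto (fun w : (ℝ × ℝ) × (ℝ × ℝ) => w.1.2) l l₂ := tendsto_snd.comp tendsto_fst
  have πx : Tendsto (fun w : (ℝ × ℝ) × (ℝ × ℝ) => w.2.1) l l₁ := tendsto_fst.comp tendsto_snd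
  have πy : Tendsto (fun w : (ℝ × ℝ) × (ℝ × ℝ) => w.2.2) l l₃ := tendsto_snd.comp tendsto_snd
  have lerr : Tendsto (fun w : (ℝ × ℝ) × (ℝ × ℝ) =>
      c * ((w.1.1 + (T - w.1.2)) + (w.2.1 + (R - w.2.2)))) l
      (𝓝 (c * ((0 + (T - T)) + (0 + (R - R))))) :=
    (((q₁.comp πt).add ((q₂.comp πs).const_sub T)).add
      ((q₁.comp πx).add ((q₃.comp πy).const_sub R))).const_mul c
  have fin := le_of_tendsto_of_tendsto ((lT.comp πs).add (lb.comp πy))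
    (((l₀.comp πt).add (la.comp πx)).add lerr) (by
      have p₁ : ∀ᶠ t in l₁, P t := mem_inf_of_right hP
      have p₂ : ∀ᶠ s in l₂, P s := mem_inf_of_right hP
      have p₃ : ∀ᶠ x in l₁, Q x := mem_inf_of_right hQ
      have p₄ : ∀ᶠ y in l₃, Q y := mem_inf_of_right hQ
      have o₁ : ∀ᶠ t in l₁, 0 < t := mem_inf_of_left self_mem_nhdsWithin
      have o₂ : ∀ᶠ s in l₂, s < T := mem_inf_of_left self_mem_nhdsWithin
      have o₃ : ∀ᶠ y in l₃, y < R := mem_inf_of_left self_mem_nhdsWithin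
      have et := (p₁.and o₁).and (q₁.eventually (gt_mem_nhds (half_pos hT)))
      have es := (p₂.and o₂).and (q₂.eventually (lt_mem_nhds (half_lt_self hT)))
      have ex := (p₃.and o₁).and (q₁.eventually (gt_mem_nhds (half_pos hR0)))
      have ey := (p₄.and o₃).and (q₃.eventually (lt_mem_nhds (half_lt_self hR0)))
      filter_upwards [πt.eventually et, πs.eventually es, πx.eventually ex, πy.eventually ey]
        with w h1 h2 h3 h4
      exact key w.1.1 w.1.2 w.2.1 w.2.2 h1.1.1 h2.1.1 h3.1.1 h4.1.1 h1.1.2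
        (h1.2.trans h2.2).le h2.1.2 h3.1.2 (h3.2.trans h4.2).le h4.1.2)
  simp only [sub_self, add_zero, mul_zero] at fin
  linarith

end

theorem memLp_top_of_bounds {M : ℝ} {μ : Measure ℝ} {γ : ℝ → ℝ} (mγ : Measurable γ)
    (bγ : ∀ y, 0 ≤ γ y ∧ γ y ≤ M) : MemLp γ ⊤ μ :=
  memLp_top_of_bound mγ.aestronglyMeasurable M (Eventually.of_forall fun y => by
    rw [Real.norm_eq_abs, abs_of_nonneg (bγ y).1]; exact (bγ y).2)

end Kompaneets

theorem mainTheorem5 (T : ℝ) (hT : 0 < T) (n n' : ℝ → ℝ → ℝ) (n₀ n₀' : ℝ → ℝ)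
    (hn : Kompaneets.IsNonnegBoundedSolution T n n₀)
    (hn' : Kompaneets.IsNonnegBoundedSolution T n' n₀') :
    ∃ nT nT' a a' : ℝ → ℝ,
      Kompaneets.IsFinalValue T n nT ∧ Kompaneets.IsFinalValue T n' nT' ∧
      Kompaneets.IsValueAtZero T n a ∧ Kompaneets.IsValueAtZero T n' a' ∧
      ∀ R : ℝ, 2 < R → ∃ b b' : ℝ → ℝ,
        Kompaneets.IsValueAt T n R b ∧ Kompaneets.IsValueAt T n' R b' ∧
        (∫ x in Ioo 0 R, |nT x - nT' x|) + (∫ t in Ioo 0 T, |a t ^ 2 - a' t ^ 2|) ≤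
          (∫ x in Ioo 0 R, |n₀ x - n₀' x|) +
            ∫ t in Ioo 0 T, |Kompaneets.flux R (b t) - Kompaneets.flux R (b' t)| := by
  obtain ⟨M, u, hu, hnu⟩ := hn.exists_rep
  obtain ⟨M', u', hu', hnu'⟩ := hn'.exists_rep
  replace hu := hu.mono (le_max_left M M')
  replace hu' := hu'.mono (le_max_right M M')
  obtain ⟨nT, mT, bT, hnT⟩ := hu.exists_timeTrace hT
  obtain ⟨nT', mT', bT', hnT'⟩ := hu'.exists_timeTrace hT
  obtain ⟨a, ma, ba, ha⟩ := hu.exists_spaceTrace_nhdsGT hT le_rfl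
  obtain ⟨a', ma', ba', ha'⟩ := hu'.exists_spaceTrace_nhdsGT hT le_rfl
  have eT : ∀ᶠ t in 𝓝[<] T, t ∈ Ioo 0 T := Ioo_mem_nhdsLT hT
  have e₀ : ∀ᶠ t in 𝓝[>] (0 : ℝ), t ∈ Ioo 0 T := Ioo_mem_nhdsGT hT
  have ex : ∀ᶠ x in 𝓝[>] (0 : ℝ), 0 < x := self_mem_nhdsWithin
  refine ⟨nT, nT', a, a',
    ⟨Kompaneets.memLp_top_of_bounds mT bT, (Kompaneets.HasTimeTrace.congr_ae hnu eT).2 hnT⟩,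
    ⟨Kompaneets.memLp_top_of_bounds mT' bT', (Kompaneets.HasTimeTrace.congr_ae hnu' eT).2 hnT'⟩,
    ⟨Kompaneets.memLp_top_of_bounds ma ba, (Kompaneets.HasSpaceTrace.congr_ae hnu ex).2 ha⟩,
    ⟨Kompaneets.memLp_top_of_bounds ma' ba', (Kompaneets.HasSpaceTrace.congr_ae hnu' ex).2 ha'⟩,
    fun R hR => ?_⟩
  obtain ⟨b, mb, bb, hb⟩ := hu.exists_spaceTrace_nhds hT hR
  obtain ⟨b', mb', bb', hb'⟩ := hu'.exists_spaceTrace_nhds hT hR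
  have eR : ∀ᶠ x in 𝓝 R, 0 < x := lt_mem_nhds (by linarith)
  refine ⟨b, b',
    ⟨Kompaneets.memLp_top_of_bounds mb bb, (Kompaneets.HasSpaceTrace.congr_ae hnu eR).2 hb⟩,
    ⟨Kompaneets.memLp_top_of_bounds mb' bb', (Kompaneets.HasSpaceTrace.congr_ae hnu' eR).2 hb'⟩, ?_⟩
  exact hu.contraction hu' hT hR hn.initial_integrable hn'.initial_integrable
    ((Kompaneets.HasTimeTrace.congr_ae hnu e₀).1 hn.initial)
    ((Kompaneets.HasTimeTrace.congr_ae hnu' e₀).1 hn'.initial)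
    mT bT hnT mT' bT' hnT' ma ba ha ma' ba' ha' mb bb hb mb' bb' hb'
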